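/- **Setting.** Let $X$ be a Polish space, $Y,\mathcal H$ real separable Hilbert spaces, and $\mathcal H'$ a separable reproducing kernel Hilbert space of functions $X\to Y$ with kernel sections $K_x:Y\to\mathcal H'$, such that $\sup_x\|K_x\|_{HS}^2\le\kappa^2$ and $(x,t)\mapsto\langle K_tv,K_xw\rangle_{\mathcal H'}$ is measurable for all $v,w\in Y$. Let $L$ be a densely defined, self-adjoint, strictly positive operator in $\mathcal H$ with $\ell_L\|f\|\le\|Lf\|$ on $\mathcal D(L)$, $\ell_L>0$; put $\mathcal H_a=\mathcal D(L^a)$, $\|f\|_{\mathcal H_a}=\|L^af\|$. Let $A:\mathcal D(A)\subset\mathcal H\to\mathcal H'$, where $\mathcal D(A)$ is closed and convex, be weak-to-weak sequentially continuous, and let $\bar f\in\mathcal D(A)\cap\mathcal D(L)$. Let $\rho$ be a probability measure on $X\times Y$ with $\int\|y\|^2d\rho<\infty$ and marginal $\nu$ on $X$, let $\hat f\in\operatorname{int}\mathcal D(A)$ satisfy $\int y\,d\rho(y|x)=A(\hat f)(x)$ for almost all $x$, and suppose that for some $M>0$, $\Sigma\ge0$, with $\varepsilon=y-A(\hat f)(x)$,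 $$\int\Big(e^{\|\varepsilon\|/M}-\tfrac{\|\varepsilon\|}{M}-1\Big)d\rho(y|x)\le\frac{\Sigma^2}{2M^2}\quad\text{for almost all }x .$$ Let $I_\nu:\mathcal H'\to L^2(X,\nu;Y)$ be the canonical injection, $T_\nu=I_\nu^*I_\nu$, $\mathcal N(\lambda)=\operatorname{Tr}((T_\nu+\lambda I)^{-1}T_\nu)$. Let $p\ge0$, $s,\alpha,\beta,d>0$, $\theta\ge0$, and let $Q\subset\mathcal D(A)\cap\{f:\|f-\hat f\|_{\mathcal H_\theta}\le d\}$ be such that for all $f\in Q$ $$\|f-\hat f\|_{\mathcal H_{-p}}\le\alpha\|I_\nu[A(f)-A(\hat f)]\|_{L^2}^s\le\beta\|f-\hat f\|_{\mathcal H_{-p}} .$$ Let $A$ be Lipschitz with constant $\ell_A$ on $\mathcal D(A)\cap B$ for a closed ball $B\subset\mathcal H$ around $\hat f$ with $Q\subset B$; let $\ell\ge\ell_A/\ell_L$, and let $\ell_1$ satisfy $\|A(f)-2A(\hat f)+A(g)\|_{\mathcal H'}\le\ell_1$ for all $f,g\in Q$. Let $1\le q\le2+p$, $q(s-1)\le p+s$,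 and suppose that $\hat f-\bar f=L^{-r}v$ with $\|v\|\le R^\dagger$, where $0\le r\le q$, $r+p\le2q$ and $(p+r)-s(r-1)>0$. Put $$u=\frac{p+r}{2(p+r)-2s(r-1)},\qquad \Theta_{\mathcal N,u}(t)=\frac{t^u}{\sqrt{\mathcal N(t)}} ,$$ and let $\lambda^*=\lambda^*_m>0$ satisfy $\Theta_{\mathcal N,u}(\lambda^*)=1/\sqrt m$. Assume that for all sufficiently large $m$ we have $\lambda^*\le1$ and, for a fixed $c_0>0$, that $\mathcal N(\lambda^*)\le m\lambda^*$ or $m\lambda^*\mathcal N(\lambda^*)\ge c_0$. For an i.i.d. sample $\mathbf z=((x_i,y_i))_{i\le m}$ from $\rho$ let $f_{\mathbf z,\lambda^*}$ be any minimizer over $\mathcal D(A)\cap\mathcal D(L)$ of $$\frac1m\sum_{i=1}^m\|A(f)(x_i)-y_i\|_Y^2+\lambda^*\|L(f-\bar f)\|_{\mathcal H}^2 ,$$ and for $R>0$ let $\hat f^R$ be the element closest to $\hat f$ in $\mathcal H$ of $\{f:f-\bar f=L^{-q}w,\ \|w\|\le R\}$. Assume that $f_{\mathbf z,\lambda^*}\in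 Q$ almost surely for all sufficiently large $m$, and $\hat f^R\in Q$ for all sufficiently large $R$. **Claim.** $\frac{2u(s+p)-p}{2(p+1)}=\frac{sr}{2(p+r)-2s(r-1)}$, and there is a constant $\overline C>0$ that depends only on $\ell,\ell_1,p,q,r,s,\kappa,M,\Sigma,\alpha,\beta,R^\dagger,c_0$ such that, for all sufficiently large $m$ and all $0<\eta<1$, with probability at least $1-\eta$ both $$\|I_\nu[A(f_{\mathbf z,\lambda^*})-A(\hat f)]\|_{L^2}\le\overline C(\lambda^*)^u\log\frac4\eta$$ and $$\|f_{\mathbf z,\lambda^*}-\hat f\|_{\mathcal H}\le\overline C(\lambda^*)^{\frac{sr}{2(p+r)-2s(r-1)}}\Big(\log\frac4\eta\Big)^{\max\{1,\frac{p+s}{p+1}\}} ;$$ for $s\le1$ the last exponent is $1$. -/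

import Mathlib

open MeasureTheory ProbabilityTheory Filter Topology
open scoped InnerProductSpace ENNReal

namespace HilbertScale

noncomputable section

/-! ### Hilbert–Schmidt norm and trace -/

section Trace

variable {E F : Type*} [NormedAddCommGroup E] [InnerProductSpace ℝ E] [CompleteSpace E]
  [NormedAddCommGroup F] [InnerProductSpace ℝ F]

/-- Index set of a fixed Hilbert basis of `E`. -/
def basisIndex (E : Type*) [NormedAddCommGroup E] [InnerProductSpace ℝ E] [CompleteSpace E] :
    Set E :=
  (exists_hilbertBasis ℝ E).choose

/-- A fixed Hilbert (orthonormal) basis of `E`. -/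
def basis (E : Type*) [NormedAddCommGroup E] [InnerProductSpace ℝ E] [CompleteSpace E] :
    HilbertBasis (basisIndex E) ℝ E :=
  (exists_hilbertBasis ℝ E).choose_spec.choose

/-- The squared Hilbert–Schmidt norm `∑ᵢ ‖S eᵢ‖² = tr (S* S)`, with value `∞` when `S` is not
Hilbert–Schmidt. It does not depend on the orthonormal basis. -/
def hsNormSq (S : E →L[ℝ] F) : ℝ≥0∞ :=
  ∑' i, ENNReal.ofReal (‖S (basis E i)‖ ^ 2)

/-- The trace `∑ᵢ ⟪eᵢ, S eᵢ⟫` of a trace class operator. -/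
def opTrace (S : E →L[ℝ] E) : ℝ :=
  ∑' i, ⟪(basis E i : E), S (basis E i)⟫_ℝ

lemma norm_apply_sq_le_of_hsNormSq_le {S : E →L[ℝ] F} {c : ℝ} (hc : 0 ≤ c)
    (hS : hsNormSq S ≤ ENNReal.ofReal c) (x : E) : ‖S x‖ ^ 2 ≤ c * ‖x‖ ^ 2 := by
  have hfin : (∑' i, ENNReal.ofReal (‖S (basis E i)‖ ^ 2)) ≠ ∞ :=
    ne_top_of_le_ne_top ENNReal.ofReal_ne_top hS
  have hsum : Summable fun i => ‖S (basis E i)‖ ^ 2 := by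
    have h := ENNReal.summable_toReal hfin
    refine h.congr fun i => ?_
    rw [ENNReal.toReal_ofReal (by positivity)]
  have htsum : ∑' i, ‖S (basis E i)‖ ^ 2 ≤ c := by
    have h1 : ENNReal.ofReal (∑' i, ‖S (basis E i)‖ ^ 2) ≤ ENNReal.ofReal c := by
      rw [ENNReal.ofReal_tsum_of_nonneg (fun i => by positivity) hsum]
      exact hS
    exact (ENNReal.ofReal_le_ofReal_iff hc).1 h1
  have hrep : HasSum (fun i => S ((basis E).repr x i • basis E i)) (S x) :=
    ((basis E).hasSum_repr x).mapL S
  have hx : ∀ t : Finset (basisIndex E), ∑ i ∈ t, |(basis E).repr x i| ^ 2 ≤ ‖x‖ ^ 2 := by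
    intro t
    have h := (basis E).orthonormal.sum_inner_products_le (x := x) (s := t)
    simpa [(basis E).repr_apply_apply] using h
  have hbound : ∀ t : Finset (basisIndex E),
      ‖∑ i ∈ t, S ((basis E).repr x i • basis E i)‖ ^ 2 ≤ c * ‖x‖ ^ 2 := by
    intro t
    have h1 : ‖∑ i ∈ t, S ((basis E).repr x i • basis E i)‖
        ≤ ∑ i ∈ t, |(basis E).repr x i| * ‖S (basis E i)‖ := by
      refine (norm_sum_le _ _).trans (le_of_eq (Finset.sum_congr rfl fun i _ => ?_))
      rw [map_smul, norm_smul, Real.norm_eq_abs]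
    have h2 := Finset.sum_mul_sq_le_sq_mul_sq t (fun i => |(basis E).repr x i|)
      (fun i => ‖S (basis E i)‖)
    have h3 : ∑ i ∈ t, ‖S (basis E i)‖ ^ 2 ≤ c :=
      (hsum.sum_le_tsum t fun i _ => by positivity).trans htsum
    calc _ ≤ (∑ i ∈ t, |(basis E).repr x i| * ‖S (basis E i)‖) ^ 2 := by gcongr
      _ ≤ _ := h2
      _ ≤ ‖x‖ ^ 2 * c := mul_le_mul (hx t) h3
          (Finset.sum_nonneg fun i _ => by positivity) (by positivity)
      _ = _ := mul_comm _ _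
  exact le_of_tendsto' ((hrep.norm).pow 2) hbound

lemma countable_basisIndex [TopologicalSpace.SeparableSpace E] : Countable (basisIndex E) := by
  refine Pairwise.countable_of_isOpen_disjoint
    (s := fun i : basisIndex E => Metric.ball (basis E i) (1 / 2)) (fun i j hij => ?_)
    (fun i => Metric.isOpen_ball) (fun i => ⟨basis E i, by simp⟩)
  refine Metric.ball_disjoint_ball ?_
  have h1 : ‖basis E i - basis E j‖ ^ 2 = 2 := by
    rw [@norm_sub_sq_real, (basis E).orthonormal.1 i, (basis E).orthonormal.1 j,
      (basis E).orthonormal.2 hij]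
    norm_num
  rw [dist_eq_norm]
  nlinarith [norm_nonneg (basis E i - basis E j)]

end Trace

/-! ### The generator of the Hilbert scale and its powers -/

section Scale

variable {H : Type*} [NormedAddCommGroup H] [InnerProductSpace ℝ H] [CompleteSpace H]

/-- `L` is a densely defined, closed, self-adjoint, strictly positive operator that satisfies
`ℓL ‖f‖ ≤ ‖L f‖` on its domain (self-adjointness includes closedness). -/
structure IsGenerator (L : H →ₗ.[ℝ] H) (ℓL : ℝ) : Prop where
  dense : Dense (L.domain : Set H)
  selfAdjoint : IsSelfAdjoint L
  pos : ∀ f : L.domain, f ≠ 0 → 0 < ⟪L f, (f : H)⟫_ℝ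
  const_pos : 0 < ℓL
  bound : ∀ f : L.domain, ℓL * ‖(f : H)‖ ≤ ‖L f‖

/-- `B` is a bounded everywhere defined two-sided inverse of `L`. -/
def IsBoundedInverse (L : H →ₗ.[ℝ] H) (B : H →L[ℝ] H) : Prop :=
  (∀ x, ∃ h : B x ∈ L.domain, L ⟨B x, h⟩ = x) ∧ ∀ f : L.domain, B (L f) = f

lemma IsGenerator.exists_isBoundedInverse {L : H →ₗ.[ℝ] H} {ℓL : ℝ} (hL : IsGenerator L ℓL) :
    ∃ B : H →L[ℝ] H, IsBoundedInverse L B := by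
  have hc := hL.const_pos
  have hcl : L.IsClosed := hL.selfAdjoint.isClosed
  have hrange_closed : IsClosed (LinearMap.range L.toFun : Set H) := by
    refine IsSeqClosed.isClosed fun y y₀ hy hlim => ?_
    choose x hx using hy
    have hcauchy : CauchySeq fun n => (x n : H) := by
      refine Metric.cauchySeq_iff.2 fun ε hε => ?_
      obtain ⟨N, hN⟩ := Metric.cauchySeq_iff.1 hlim.cauchySeq (ℓL * ε) (by positivity)
      refine ⟨N, fun m hm n hn => ?_⟩
      have h1 := hN m hm n hn
      rw [dist_eq_norm, ← hx m, ← hx n, ← map_sub] at h1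
      have h2 := hL.bound (x m - x n)
      rw [dist_eq_norm]
      have h3 : ℓL * ‖(x m : H) - x n‖ < ℓL * ε := lt_of_le_of_lt h2 h1
      exact lt_of_mul_lt_mul_left h3 hc.le
    obtain ⟨x₀, hx₀⟩ := cauchySeq_tendsto_of_complete hcauchy
    have hgraph : (x₀, y₀) ∈ L.graph := by
      refine hcl.mem_of_tendsto (hx₀.prodMk_nhds hlim) (Eventually.of_forall fun n => ?_)
      exact (LinearPMap.mem_graph_iff L).2 ⟨x n, rfl, hx n⟩
    obtain ⟨w, -, hw⟩ := (LinearPMap.mem_graph_iff L).1 hgraph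
    exact ⟨w, hw⟩
  have horth : (LinearMap.range L.toFun)ᗮ = ⊥ := by
    refine (Submodule.eq_bot_iff _).2 fun y hy => ?_
    have h0 : ∀ x : L.domain, ⟪(0 : H), x⟫_ℝ = ⟪y, L x⟫_ℝ := fun x => by
      rw [inner_zero_left, real_inner_comm]
      exact ((Submodule.mem_orthogonal _ _).1 hy _ ⟨x, rfl⟩).symm
    have hmem : y ∈ L.adjoint.domain := LinearPMap.mem_adjoint_domain_of_exists y ⟨0, h0⟩
    have happ : L.adjoint ⟨y, hmem⟩ = 0 := LinearPMap.adjoint_apply_eq hL.dense _ h0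
    have hg : (y, (0 : H)) ∈ L.adjoint.graph := (LinearPMap.mem_graph_iff _).2 ⟨_, rfl, happ⟩
    rw [LinearPMap.isSelfAdjoint_def.1 hL.selfAdjoint] at hg
    obtain ⟨w, hw, hLw⟩ := (LinearPMap.mem_graph_iff L).1 hg
    have hb := hL.bound w
    rw [hLw] at hb
    have : ‖(w : H)‖ ≤ 0 := by
      have h4 : ℓL * ‖(w : H)‖ ≤ ℓL * 0 := by simpa using hb
      exact le_of_mul_le_mul_left h4 hc
    exact hw.symm.trans (norm_le_zero_iff.1 this)
  have hsurj : ∀ y : H, ∃ x : L.domain, L x = y := by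
    intro y
    have : (LinearMap.range L.toFun) = ⊤ := by
      have h := Submodule.topologicalClosure_eq_top_iff.2 horth
      rwa [IsClosed.submodule_topologicalClosure_eq hrange_closed] at h
    exact LinearMap.mem_range.1 (this ▸ Submodule.mem_top : y ∈ LinearMap.range L.toFun)
  have hinj : ∀ x x' : L.domain, L x = L x' → x = x' := by
    intro x x' h
    have hb := hL.bound (x - x')
    have h5 : L (x - x') = 0 := by rw [LinearPMap.map_sub, h, sub_self]
    rw [h5] at hb
    have h6 : ℓL * ‖((x - x' : L.domain) : H)‖ ≤ ℓL * 0 := by simpa using hb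
    have h7 := norm_le_zero_iff.1 (le_of_mul_le_mul_left h6 hc)
    exact sub_eq_zero.1 (Subtype.ext h7)
  choose T hT using hsurj
  have hadd : ∀ a b, T (a + b) = T a + T b := fun a b => hinj _ _ (by
    rw [hT, LinearPMap.map_add, hT, hT])
  have hsmul : ∀ (c : ℝ) a, T (c • a) = c • T a := fun c a => hinj _ _ (by
    rw [hT, LinearPMap.map_smul, hT])
  let B₀ : H →ₗ[ℝ] H :=
    { toFun := fun y => (T y : H)
      map_add' := fun a b => by rw [hadd]; rfl
      map_smul' := fun c a => by rw [hsmul]; rfl }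
  refine ⟨B₀.mkContinuous ℓL⁻¹ fun y => ?_, fun y => ⟨(T y).2, hT y⟩, fun f => ?_⟩
  · have h8 := hL.bound (T y)
    rw [hT] at h8
    change ‖(T y : H)‖ ≤ ℓL⁻¹ * ‖y‖
    rw [inv_mul_eq_div, le_div_iff₀ hc, mul_comm]
    exact h8
  · change ((T (L f) : L.domain) : H) = f
    rw [hinj _ _ (hT (L f))]

open Classical in
/-- The bounded operator `L⁻¹`. -/
def inv (L : H →ₗ.[ℝ] H) : H →L[ℝ] H :=
  if h : ∃ B : H →L[ℝ] H, IsBoundedInverse L B then h.choose else 0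

/-- The power `B ^ a`, `a ≥ 0`, of a bounded positive self-adjoint operator `B`, through the
binomial series `t ^ a = ‖B‖ ^ a * ∑ₖ (a choose k) (-1) ^ k (1 - t / ‖B‖) ^ k` on the spectrum
`[0, ‖B‖]` of `B`; the series converges in operator norm because `‖1 - B / ‖B‖‖ ≤ 1` and
`∑ₖ |a choose k| < ∞`. -/
def opPow (B : H →L[ℝ] H) (a : ℝ) : H →L[ℝ] H :=
  ‖B‖ ^ a • ∑' k : ℕ, ((-1 : ℝ) ^ k * Ring.choose a k) • (1 - ‖B‖⁻¹ • B) ^ k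

/-- The bounded operator `L ^ (-a)` for `a ≥ 0`. Its range is the space `H_a = D(L ^ a)`, and the
norm of `L ^ (-a) w` in `H_a` is `‖w‖`. -/
def invPow (L : H →ₗ.[ℝ] H) (a : ℝ) : H →L[ℝ] H :=
  opPow (inv L) a

/-- The norm of `f` in `H_{-a}` for `a ≥ 0`, that is `‖L ^ (-a) f‖`. -/
def negNorm (L : H →ₗ.[ℝ] H) (a : ℝ) (f : H) : ℝ :=
  ‖invPow L a f‖

/-- The closed ball of radius `d` around `f₀` in the norm of `H_a`, `a ≥ 0`. -/
def scaleBall (L : H →ₗ.[ℝ] H) (a : ℝ) (f₀ : H) (d : ℝ) : Set H :=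
  {f | ∃ w : H, f - f₀ = invPow L a w ∧ ‖w‖ ≤ d}

/-- The benchmark class `{f : f - fbar = L ^ (-q) v, ‖v‖ ≤ R}`. -/
def benchmarkSet (L : H →ₗ.[ℝ] H) (q : ℝ) (fbar : H) (R : ℝ) : Set H :=
  scaleBall L q fbar R

/-- `g` attains the distance `d(R) = inf {‖f - fhat‖ : f ∈ benchmarkSet L q fbar R}`. -/
def IsBenchmarkMinimizer (L : H →ₗ.[ℝ] H) (q : ℝ) (fbar fhat : H) (R : ℝ) (g : H) : Prop :=
  g ∈ benchmarkSet L q fbar R ∧ ∀ f ∈ benchmarkSet L q fbar R, ‖g - fhat‖ ≤ ‖f - fhat‖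

end Scale

/-! ### The vector-valued reproducing kernel Hilbert space -/

section Kernel

variable {X Y H' : Type*}
  [MeasurableSpace X]
  [NormedAddCommGroup Y] [InnerProductSpace ℝ Y] [CompleteSpace Y]
  [NormedAddCommGroup H'] [InnerProductSpace ℝ H'] [CompleteSpace H'] [RKHS ℝ H' X Y]

/-- The kernel sections `K_x : Y → H'` are Hilbert–Schmidt with `‖K_x‖²_HS ≤ κ²` for all `x`, and
`(x, t) ↦ ⟪K_t v, K_x w⟫` is measurable for all `v, w`. -/
structure KernelCondition (X Y H' : Type*) [MeasurableSpace X]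
    [NormedAddCommGroup Y] [InnerProductSpace ℝ Y] [CompleteSpace Y]
    [NormedAddCommGroup H'] [InnerProductSpace ℝ H'] [CompleteSpace H'] [RKHS ℝ H' X Y]
    (κ : ℝ) : Prop where
  nonneg : 0 ≤ κ
  hilbertSchmidt : ∀ x : X, hsNormSq (RKHS.kerFun H' x) ≤ ENNReal.ofReal (κ ^ 2)
  measurable : ∀ v w : Y,
    Measurable fun z : X × X => ⟪RKHS.kerFun H' z.2 v, RKHS.kerFun H' z.1 w⟫_ℝ

lemma KernelCondition.norm_apply_le {κ : ℝ} (hK : KernelCondition X Y H' κ) (g : H') (x : X) :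
    ‖g x‖ ≤ κ * ‖g‖ := by
  have h1 : ‖RKHS.kerFun H' x‖ ≤ κ := by
    refine ContinuousLinearMap.opNorm_le_bound _ hK.nonneg fun y => ?_
    have h := norm_apply_sq_le_of_hsNormSq_le (sq_nonneg κ) (hK.hilbertSchmidt x) y
    rw [← mul_pow] at h
    exact le_of_sq_le_sq h (mul_nonneg hK.nonneg (norm_nonneg y))
  rw [← RKHS.adjoint_kerFun]
  calc _ ≤ ‖(RKHS.kerFun H' x).adjoint‖ * ‖g‖ := ContinuousLinearMap.le_opNorm _ _
    _ ≤ κ * ‖g‖ := by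
      rw [LinearIsometryEquiv.norm_map]
      gcongr

lemma KernelCondition.stronglyMeasurable [MeasurableSpace Y] [BorelSpace Y]
    [TopologicalSpace.SeparableSpace Y] {κ : ℝ} (hK : KernelCondition X Y H' κ) (g : H') :
    StronglyMeasurable fun x => g x := by
  have hweak : ∀ (g : H') (w : Y), Measurable fun x => ⟪g x, w⟫_ℝ := by
    intro g w
    have hg : g ∈ (Submodule.span ℝ {RKHS.kerFun H' x v | (x) (v)}).topologicalClosure := by
      rw [RKHS.kerFun_dense]; trivial
    obtain ⟨f, hf, hlim⟩ := mem_closure_iff_seq_limit.1 hg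
    have hmeas : ∀ h ∈ Submodule.span ℝ {RKHS.kerFun H' x v | (x) (v)},
        Measurable fun x => ⟪(h : H') x, w⟫_ℝ := by
      intro h hh
      induction hh using Submodule.span_induction with
      | mem h hh =>
        obtain ⟨t, v, rfl⟩ := hh
        have h1 := (hK.measurable v w).comp (measurable_prodMk_right (y := t))
        have h2 : (fun x => ⟪(RKHS.kerFun H' t v) x, w⟫_ℝ) =
            (fun z : X × X => ⟪RKHS.kerFun H' z.2 v, RKHS.kerFun H' z.1 w⟫_ℝ) ∘
              fun x => (x, t) := by
          funext x
          simp only [Function.comp_apply, RKHS.inner_kerFun]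
        rw [h2]
        exact h1
      | zero => simp
      | add a b _ _ ha hb =>
        simp only [RKHS.coe_add, Pi.add_apply, inner_add_left]
        exact ha.add hb
      | smul c a _ ha =>
        simp only [RKHS.coe_smul, Pi.smul_apply, inner_smul_left]
        exact ha.const_mul _
    refine measurable_of_tendsto_metrizable (fun n => hmeas (f n) (hf n)) ?_
    refine tendsto_pi_nhds.2 fun x => ?_
    exact (((RKHS.continuous_eval x).tendsto g).comp hlim).inner tendsto_const_nhds
  have hcount : Countable (basisIndex Y) := countable_basisIndex
  refine stronglyMeasurable_of_tendsto (u := (atTop : Filter (Finset (basisIndex Y))))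
    (f := fun t x => ∑ i ∈ t, ⟪g x, basis Y i⟫_ℝ • basis Y i) (fun t => ?_) ?_
  · exact Finset.stronglyMeasurable_fun_sum t fun i _ =>
      (hweak g _).stronglyMeasurable.smul_const _
  · refine tendsto_pi_nhds.2 fun x => ?_
    have h := (basis Y).hasSum_repr (g x)
    simp only [HilbertBasis.repr_apply_apply, real_inner_comm] at h
    simpa [HasSum, SummationFilter.unconditional_filter] using h

variable [MeasurableSpace Y] [BorelSpace Y] [TopologicalSpace.SeparableSpace Y]

lemma KernelCondition.memLp {κ : ℝ} (hK : KernelCondition X Y H' κ)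
    (ν : Measure X) [IsProbabilityMeasure ν] (g : H') : MemLp (fun x => g x) 2 ν :=
  MemLp.of_bound (hK.stronglyMeasurable g).aestronglyMeasurable (κ * ‖g‖)
    (Eventually.of_forall fun x => hK.norm_apply_le g x)

/-- The canonical injection `I_ν : H' → L²(X, ν; Y)`. -/
def inclusion {κ : ℝ} (hK : KernelCondition X Y H' κ)
    (ν : Measure X) [IsProbabilityMeasure ν] : H' →L[ℝ] Lp Y 2 ν :=
  LinearMap.mkContinuous
    { toFun := fun g => (hK.memLp ν g).toLp _
      map_add' := fun f g => by
        rw [← MemLp.toLp_add]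
        exact MemLp.toLp_congr _ _ (Eventually.of_forall fun x => by simp)
      map_smul' := fun c g => by
        rw [RingHom.id_apply, ← MemLp.toLp_const_smul]
        exact MemLp.toLp_congr _ _ (Eventually.of_forall fun x => by simp) }
    κ (fun g => by
      have h := Lp.norm_le_of_ae_bound (f := (hK.memLp ν g).toLp _)
        (mul_nonneg hK.nonneg (norm_nonneg g))
        ((hK.memLp ν g).coeFn_toLp.mono fun x hx => by
          rw [hx]; exact hK.norm_apply_le g x)
      simpa [measureUnivNNReal] using h)

/-- The covariance operator `T_ν = I_ν* I_ν`. -/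
def covariance {κ : ℝ} (hK : KernelCondition X Y H' κ)
    (ν : Measure X) [IsProbabilityMeasure ν] : H' →L[ℝ] H' :=
  (inclusion hK ν).adjoint ∘L inclusion hK ν

/-- The effective dimension `N(t) = Tr ((T_ν + t I)⁻¹ T_ν)` for `t > 0`. -/
def effDim {κ : ℝ} (hK : KernelCondition X Y H' κ)
    (ν : Measure X) [IsProbabilityMeasure ν] (t : ℝ) : ℝ :=
  opTrace (Ring.inverse (covariance hK ν + t • (1 : H' →L[ℝ] H')) * covariance hK ν)

/-- The function `Θ_{N,u}(t) = t ^ u / √N(t)`. -/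
def thetaFun {κ : ℝ} (hK : KernelCondition X Y H' κ)
    (ν : Measure X) [IsProbabilityMeasure ν] (u t : ℝ) : ℝ :=
  t ^ u / √(effDim hK ν t)

end Kernel

/-! ### The statistical inverse problem -/

section Problem

variable {X Y H H' : Type*}
  [NormedAddCommGroup Y] [InnerProductSpace ℝ Y] [CompleteSpace Y]
  [NormedAddCommGroup H] [InnerProductSpace ℝ H] [CompleteSpace H]
  [NormedAddCommGroup H'] [InnerProductSpace ℝ H'] [CompleteSpace H'] [RKHS ℝ H' X Y]

/-- The Tikhonov functional
`(1/m) ∑ᵢ ‖A(f)(xᵢ) - yᵢ‖² + lam ‖L (f - fbar)‖²` on the domain of `L`. -/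
def tikhonov (A : H → H') (L : H →ₗ.[ℝ] H) (fbar : L.domain) (lam : ℝ) {m : ℕ}
    (z : Fin m → X × Y) (f : L.domain) : ℝ :=
  (1 / (m : ℝ)) * ∑ i, ‖A f (z i).1 - (z i).2‖ ^ 2 + lam * ‖L (f - fbar)‖ ^ 2

/-- `f` is a global minimizer of the Tikhonov functional over `D(A) ∩ D(L)`. -/
def IsTikhonovMinimizer (A : H → H') (DA : Set H) (L : H →ₗ.[ℝ] H) (fbar : L.domain) (lam : ℝ)
    {m : ℕ} (z : Fin m → X × Y) (f : L.domain) : Prop :=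
  (f : H) ∈ DA ∧
    ∀ g : L.domain, (g : H) ∈ DA → tikhonov A L fbar lam z f ≤ tikhonov A L fbar lam z g

/-- Weak convergence of a sequence in a Hilbert space. -/
def WeakTendsto {E : Type*} [NormedAddCommGroup E] [InnerProductSpace ℝ E]
    (f : ℕ → E) (f₀ : E) : Prop :=
  ∀ h : E, Tendsto (fun n => ⟪f n, h⟫_ℝ) atTop (𝓝 ⟪f₀, h⟫_ℝ)

/-- `A : D(A) → H'` (given as a function of which only the values on `D(A)` matter) has a convex
closed domain, is weak-to-weak sequentially continuous, and is Lipschitz continuous with constant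
`ℓA` on the part of `D(A)` in the ball of radius `d₀` around `fhat`. -/
structure OperatorCondition (A : H → H') (DA : Set H) (fhat : H) (ℓA d₀ : ℝ) : Prop where
  convex : Convex ℝ DA
  closed : IsClosed DA
  weakCont : ∀ (f : ℕ → H) (f₀ : H), (∀ n, f n ∈ DA) → f₀ ∈ DA → WeakTendsto f f₀ →
    WeakTendsto (fun n => A (f n)) (A f₀)
  lipschitz : ∀ f ∈ Metric.closedBall fhat d₀ ∩ DA, ∀ g ∈ Metric.closedBall fhat d₀ ∩ DA,
    ‖A f - A g‖ ≤ ℓA * ‖f - g‖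

variable [MeasurableSpace X] [MeasurableSpace Y] [BorelSpace Y]
  [TopologicalSpace.SeparableSpace Y]

/-- `fhat` is the true solution: an interior point of `D(A)` with
`∫ y dρ(y|x) = A(fhat)(x)` for almost all `x`. -/
structure TrueSolution (ρ : Measure (X × Y)) [IsProbabilityMeasure ρ]
    (A : H → H') (DA : Set H) (fhat : H) : Prop where
  mem_interior : fhat ∈ interior DA
  condMean : ∀ᵐ x ∂ρ.fst, ∫ y, y ∂(ρ.condKernel x) = A fhat x

/-- The Bernstein type condition
`∫ (exp (‖ε‖/M) - ‖ε‖/M - 1) dρ(y|x) ≤ Σ²/(2M²)` for `ε = y - A(fhat)(x)` and almost all `x`. -/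
def NoiseCondition (ρ : Measure (X × Y)) [IsProbabilityMeasure ρ]
    (A : H → H') (fhat : H) (M S : ℝ) : Prop :=
  ∀ᵐ x ∂ρ.fst,
    ∫⁻ y, ENNReal.ofReal (Real.exp (‖y - A fhat x‖ / M) - ‖y - A fhat x‖ / M - 1)
      ∂(ρ.condKernel x) ≤ ENNReal.ofReal (S ^ 2 / (2 * M ^ 2))

end Problem

end

end HilbertScale

/-! The minimizer `f` is not compared with `fhat` directly but with a benchmark element `g`, the
closest point to `fhat` in a smoother class, of radius proportional to `λ^(-e)` with `e = s(q -
r)/D`. Smoothness makes `L(g - fbar) = L^(-(q-1)) w` available. With `h = L(f - g)` and `x`, `b` the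
`L²` errors of `A f` and `A g`, minimality and polarization (`energy_inequality`) give `x² + λ‖h‖² ≤
b² + 2λ‖w‖‖L^(-(q-1)) h‖ + noise`.

The cross term is interpolated between `‖h‖` and `‖L^(-(p+1)) h‖`. The latter is the `H_{-p}` norm
of `f - g`, which conditional stability bounds by `α(x^s + b^s)`. The opposite half of the stability
estimate, with the approximation rate of `norm_opPow_benchmark_le`, bounds `b` by a multiple of
`λ^u`.

The noise and the deviation of the empirical covariance are tested against `A f - A g`, which
depends on the sample, so they are bounded uniformly over test vectors. Duality with the weight `T_ν
+ λ` reduces this to two means of independent centred vectors, preconditioned by `(T_ν + λ)^(-1/2)`,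
with second moments governed by the effective dimension. A Bernstein inequality
(`measure_norm_mean_gt_le_of_le`) bounds them by `(1/(√λ m) + √(N/m)) log(4/η)` up to constants. The
parameter rule says exactly `√(N/m) = λ^u`, and the lower bound on `mλN` absorbs the first summand.

After the substitution `x = λ^u ξ`, `‖h‖ = λ^(u-1/2) t` every power of `λ` cancels, and a scalar
inequality (`normalized_error_le`) bounds `ξ` and `t` by a constant times the logarithm.
Interpolating `‖f - g‖` between `‖h‖` and the `H_{-p}` norm, and adding `‖g - fhat‖`, gives the rate
in `H`.

The semigroup law, injectivity and interpolation for the powers of `L⁻¹` all come from the binomial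
series: Vandermonde's identity gives the semigroup law, and Cauchy–Schwarz with midpoint convexity
gives interpolation. -/

namespace HilbertScale

/-! ### Binomial coefficients of the power function -/

section Binomial

/-- The coefficient of `(1 - t) ^ k` in the binomial expansion of `t ^ a`. -/
noncomputable def binCoeff (a : ℝ) (k : ℕ) : ℝ := (-1) ^ k * Ring.choose a k

lemma binCoeff_zero_right (a : ℝ) : binCoeff a 0 = 1 := by
  simp [binCoeff]

lemma binCoeff_succ (a : ℝ) (k : ℕ) :
    (k + 1) * binCoeff a (k + 1) = (k - a) * binCoeff a k := by
  have h := Ring.choose_smul_choose a (Nat.le_succ k)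
  simp only [Nat.succ_eq_add_one, Nat.choose_succ_self_right, nsmul_eq_mul,
    Nat.add_sub_cancel_left, Ring.choose_one_right', pow_one] at h
  push_cast at h
  simp only [binCoeff, pow_succ]
  linear_combination (-1 : ℝ) ^ k * (-1) * h

lemma binCoeff_zero_left_succ (k : ℕ) : binCoeff 0 (k + 1) = 0 := by
  simp [binCoeff]

lemma binCoeff_one_add_two (k : ℕ) : binCoeff 1 (k + 2) = 0 := by
  have h := Ring.choose_natCast (R := ℝ) 1 (k + 2)
  rw [Nat.choose_eq_zero_of_lt (by omega)] at h
  simp only [Nat.cast_one, Nat.cast_zero] at h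
  simp [binCoeff, h]

lemma binCoeff_add (a b : ℝ) (k : ℕ) :
    binCoeff (a + b) k = ∑ ij ∈ Finset.HasAntidiagonal.antidiagonal k, binCoeff a ij.1 * binCoeff b ij.2 := by
  rw [binCoeff, Ring.add_choose_eq k (Commute.all a b), Finset.mul_sum]
  refine Finset.sum_congr rfl fun ij hij => ?_
  rw [← Finset.HasAntidiagonal.mem_antidiagonal.1 hij, pow_add, binCoeff, binCoeff]
  ring

lemma binCoeff_succ_nonpos {a : ℝ} (h0 : 0 ≤ a) (h1 : a ≤ 1) (k : ℕ) :
    binCoeff a (k + 1) ≤ 0 := by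
  induction k with
  | zero =>
    have h := binCoeff_succ a 0
    rw [binCoeff_zero_right] at h
    norm_num at h ⊢
    linarith
  | succ k ih =>
    have h := binCoeff_succ a (k + 1)
    push_cast at h
    have h2 : (0 : ℝ) ≤ k + 1 - a := by
      have : (0 : ℝ) ≤ k := k.cast_nonneg
      linarith
    have h3 : ((k : ℝ) + 1 + 1) * binCoeff a (k + 1 + 1) ≤ 0 := by
      rw [h]; exact mul_nonpos_of_nonneg_of_nonpos h2 ih
    have h4 : (0 : ℝ) < (k : ℝ) + 1 + 1 := by positivity
    by_contra hc
    push Not at hc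
    exact absurd h3 (not_le.2 (mul_pos h4 hc))

lemma sum_binCoeff (a : ℝ) (n : ℕ) :
    a * ∑ k ∈ Finset.range (n + 1), binCoeff a k = -((n + 1) * binCoeff a (n + 1)) := by
  induction n with
  | zero =>
    have h := binCoeff_succ a 0
    rw [binCoeff_zero_right] at h
    simp only [zero_add, Finset.range_one, Finset.sum_singleton, binCoeff_zero_right]
    norm_num at h ⊢
    linarith
  | succ n ih =>
    rw [Finset.sum_range_succ, mul_add, ih]
    have h := binCoeff_succ a (n + 1)
    push_cast at h ⊢
    linarith

/-- All coefficients after the leading `1` are nonpositive, and by `sum_binCoeff` the partial sums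
stay nonnegative. The absolute values of the tail therefore add up to at most `1`. -/
lemma sum_abs_binCoeff_le {a : ℝ} (h0 : 0 ≤ a) (h1 : a ≤ 1) (n : ℕ) :
    ∑ k ∈ Finset.range n, |binCoeff a k| ≤ 2 := by
  have hS : ∀ n : ℕ, 0 ≤ ∑ k ∈ Finset.range n, binCoeff a k := by
    intro n
    rcases h0.eq_or_lt with rfl | ha
    · rcases n with _ | n
      · simp
      · rw [Finset.sum_range_succ']
        simp [binCoeff_zero_left_succ, binCoeff_zero_right]
    · rcases n with _ | n
      · simp
      · have h := sum_binCoeff a n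
        have h2 := binCoeff_succ_nonpos h0 h1 n
        have h3 : 0 ≤ a * ∑ k ∈ Finset.range (n + 1), binCoeff a k := by
          rw [h, neg_nonneg]
          exact mul_nonpos_of_nonneg_of_nonpos (by positivity) h2
        exact nonneg_of_mul_nonneg_right h3 ha
  rcases n with _ | n
  · simp
  · have h := hS (n + 1)
    rw [Finset.sum_range_succ'] at h ⊢
    rw [binCoeff_zero_right] at h ⊢
    have h3 : ∑ k ∈ Finset.range n, |binCoeff a (k + 1)|
        = -∑ k ∈ Finset.range n, binCoeff a (k + 1) := by
      rw [← Finset.sum_neg_distrib]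
      exact Finset.sum_congr rfl fun k _ => abs_of_nonpos (binCoeff_succ_nonpos h0 h1 k)
    rw [h3, abs_one]
    linarith

/-- By Vandermonde the coefficients for `a` are the Cauchy product of those for `a - 1` and `1`, so
absolute summability climbs from `[0, 1]` in unit steps. -/
lemma summable_abs_binCoeff {a : ℝ} (h0 : 0 ≤ a) : Summable fun k => |binCoeff a k| := by
  have hsmall : ∀ a : ℝ, 0 ≤ a → a ≤ 1 → Summable fun k => |binCoeff a k| := fun a h0 h1 =>
    summable_of_sum_range_le (fun k => abs_nonneg _) (sum_abs_binCoeff_le h0 h1)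
  have key : ∀ (n : ℕ) (a : ℝ), 0 ≤ a → a ≤ n → Summable fun k => |binCoeff a k| := by
    intro n
    induction n with
    | zero => exact fun a h0 h1 => hsmall a h0 (h1.trans (by simp))
    | succ n ih =>
      intro a h0 h1
      rcases le_total a 1 with h | h
      · exact hsmall a h0 h
      · have hs := summable_norm_sum_mul_antidiagonal_of_summable_norm
          (f := binCoeff (a - 1)) (g := binCoeff 1)
          (ih (a - 1) (by linarith) (by push_cast at h1; linarith)) (hsmall 1 (by simp) le_rfl)
        refine hs.congr fun k => ?_
        rw [← binCoeff_add, sub_add_cancel, Real.norm_eq_abs]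
  obtain ⟨n, hn⟩ := exists_nat_ge a
  exact key n a h0 hn

lemma tsum_abs_binCoeff_le {a : ℝ} (h0 : 0 ≤ a) (h1 : a ≤ 1) : ∑' k, |binCoeff a k| ≤ 2 :=
  Real.tsum_le_of_sum_range_le (fun _ => abs_nonneg _) (sum_abs_binCoeff_le h0 h1)

end Binomial

/-! ### Powers of bounded positive operators -/

section OpPow

variable {H : Type*} [NormedAddCommGroup H] [InnerProductSpace ℝ H] [CompleteSpace H]
  {B : H →L[ℝ] H}

lemma opPow_eq (B : H →L[ℝ] H) (a : ℝ) :
    opPow B a = ‖B‖ ^ a • ∑' k : ℕ, binCoeff a k • (1 - ‖B‖⁻¹ • B) ^ k := rfl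

/-- With `C = B / ‖B‖`, positivity of `C` at `x - C x` and `‖C‖ ≤ 1` give `⟪C x, x⟫ ≥ ‖C x‖²`;
expanding `‖x - C x‖²` finishes. -/
lemma norm_one_sub_le_one (hB : B.IsPositive) : ‖1 - ‖B‖⁻¹ • B‖ ≤ 1 := by
  refine ContinuousLinearMap.opNorm_le_bound _ zero_le_one fun x => ?_
  set C : H →L[ℝ] H := ‖B‖⁻¹ • B with hC
  have hCpos : C.IsPositive := hB.smul_of_nonneg (by simp)
  have hCn : ‖C‖ ≤ 1 := by
    rw [hC, norm_smul, norm_inv, norm_norm]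
    exact inv_mul_le_one
  have hCx : ∀ x, ‖C x‖ ≤ ‖x‖ := fun x =>
    (C.le_opNorm x).trans (mul_le_of_le_one_left (norm_nonneg _) hCn)
  have h1 : 0 ≤ ⟪C (x - C x), x - C x⟫_ℝ := by
    simpa using hCpos.inner_nonneg_left (x - C x)
  have h2 : ⟪C (C x), C x⟫_ℝ ≤ ‖C x‖ ^ 2 := by
    refine (real_inner_le_norm _ _).trans ?_
    rw [sq]
    exact mul_le_mul_of_nonneg_right (hCx _) (norm_nonneg _)
  have h3 : ⟪C (C x), x⟫_ℝ = ‖C x‖ ^ 2 := by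
    rw [hCpos.inner_left_eq_inner_right, real_inner_self_eq_norm_sq]
  rw [map_sub, inner_sub_left, inner_sub_right, inner_sub_right, h3,
    real_inner_self_eq_norm_sq] at h1
  have h4 : ‖x - C x‖ ^ 2 ≤ ‖x‖ ^ 2 := by
    rw [@norm_sub_sq_real, real_inner_comm]
    nlinarith [sq_nonneg ‖C x‖]
  rw [one_mul]
  exact (sq_le_sq₀ (norm_nonneg _) (norm_nonneg _)).1 h4

lemma norm_binTerm_le (hB : B.IsPositive) (a : ℝ) (k : ℕ) :
    ‖binCoeff a k • (1 - ‖B‖⁻¹ • B) ^ k‖ ≤ |binCoeff a k| := by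
  rw [norm_smul, Real.norm_eq_abs]
  refine mul_le_of_le_one_right (abs_nonneg _) ?_
  rcases subsingleton_or_nontrivial H with h | h
  · have : ((1 - ‖B‖⁻¹ • B) ^ k : H →L[ℝ] H) = 0 := Subsingleton.elim _ _
    simp [this]
  · exact (norm_pow_le _ k).trans (pow_le_one₀ (norm_nonneg _) (norm_one_sub_le_one hB))

lemma summable_norm_binTerm (hB : B.IsPositive) {a : ℝ} (ha : 0 ≤ a) :
    Summable fun k => ‖binCoeff a k • (1 - ‖B‖⁻¹ • B) ^ k‖ :=
  (summable_abs_binCoeff ha).of_nonneg_of_le (fun _ => norm_nonneg _) (norm_binTerm_le hB a)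

lemma opPow_zero (B : H →L[ℝ] H) : opPow B 0 = 1 := by
  rw [opPow_eq, tsum_eq_single 0, binCoeff_zero_right]
  · simp
  · intro k hk
    obtain ⟨k, rfl⟩ := Nat.exists_eq_succ_of_ne_zero hk
    rw [Nat.succ_eq_add_one, binCoeff_zero_left_succ, zero_smul]

lemma opPow_one (B : H →L[ℝ] H) : opPow B 1 = B := by
  rw [opPow_eq, tsum_eq_sum (s := Finset.range 2)]
  · have h1 : binCoeff 1 1 = -1 := by simp [binCoeff]
    rw [Finset.sum_range_succ, Finset.sum_range_one, binCoeff_zero_right, h1]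
    rcases eq_or_ne ‖B‖ 0 with h | h
    · rw [norm_eq_zero.1 h]; simp
    · simp [smul_smul, h]
  · intro k hk
    obtain ⟨k, rfl⟩ := Nat.exists_eq_add_of_le (show 2 ≤ k by simpa [Nat.lt_iff_add_one_le] using hk)
    rw [add_comm, binCoeff_one_add_two, zero_smul]

lemma opPow_add (hB : B.IsPositive) {a b : ℝ} (ha : 0 ≤ a) (hb : 0 ≤ b) :
    opPow B (a + b) = opPow B a * opPow B b := by
  simp only [opPow_eq]
  rw [Real.rpow_add_of_nonneg (norm_nonneg _) ha hb, smul_mul_smul_comm,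
    tsum_mul_tsum_eq_tsum_sum_antidiagonal_of_summable_norm (summable_norm_binTerm hB ha)
      (summable_norm_binTerm hB hb)]
  congr 1
  refine tsum_congr fun k => ?_
  rw [binCoeff_add, Finset.sum_smul]
  refine Finset.sum_congr rfl fun ij hij => ?_
  rw [smul_mul_smul_comm, ← pow_add, Finset.HasAntidiagonal.mem_antidiagonal.1 hij]

lemma opPow_add_apply (hB : B.IsPositive) {a b : ℝ} (ha : 0 ≤ a) (hb : 0 ≤ b) (x : H) :
    opPow B (a + b) x = opPow B a (opPow B b x) := by
  rw [opPow_add hB ha hb]; rfl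

lemma norm_opPow_le (hB : B.IsPositive) {a : ℝ} (h0 : 0 ≤ a) (h1 : a ≤ 1) :
    ‖opPow B a‖ ≤ 2 * max 1 ‖B‖ := by
  rw [opPow_eq, norm_smul, mul_comm]
  refine mul_le_mul ?_ ?_ (norm_nonneg _) zero_le_two
  · refine (tsum_of_norm_bounded (summable_abs_binCoeff h0).hasSum (norm_binTerm_le hB a)).trans ?_
    exact tsum_abs_binCoeff_le h0 h1
  · rw [Real.norm_of_nonneg (by positivity)]
    rcases le_total ‖B‖ 1 with h | h
    · exact (Real.rpow_le_one (norm_nonneg _) h h0).trans (le_max_left _ _)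
    · refine (Real.rpow_le_rpow_of_exponent_le h h1).trans ?_
      rw [Real.rpow_one]
      exact le_max_right _ _

/-- Boundedness on compact ranges of exponents is the only regularity in the exponent that the
interpolation inequality requires; continuity is avoided. -/
lemma exists_norm_opPow_le (hB : B.IsPositive) (c : ℝ) :
    ∃ K : ℝ, ∀ a, 0 ≤ a → a ≤ c → ‖opPow B a‖ ≤ K := by
  obtain ⟨n, hn⟩ := exists_nat_ge c
  suffices h : ∀ n : ℕ, ∃ K : ℝ, ∀ a : ℝ, 0 ≤ a → a ≤ n → ‖opPow B a‖ ≤ K by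
    obtain ⟨K, hK⟩ := h n
    exact ⟨K, fun a h0 h1 => hK a h0 (h1.trans hn)⟩
  intro n
  induction n with
  | zero => exact ⟨_, fun a h0 h1 => norm_opPow_le hB h0 (h1.trans (by simp))⟩
  | succ n ih =>
    obtain ⟨K, hK⟩ := ih
    refine ⟨max (2 * max 1 ‖B‖) (K * ‖B‖), fun a h0 h1 => ?_⟩
    rcases le_total a 1 with h | h
    · exact (norm_opPow_le hB h0 h).trans (le_max_left _ _)
    · refine le_trans ?_ (le_max_right _ _)
      have h2 := opPow_add hB (sub_nonneg.2 h) zero_le_one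
      rw [sub_add_cancel, opPow_one] at h2
      rw [h2]
      refine (norm_mul_le _ _).trans (mul_le_mul_of_nonneg_right ?_ (norm_nonneg _))
      exact hK _ (by linarith) (by push_cast at h1; linarith)

lemma isSelfAdjoint_opPow (hB : B.IsPositive) (a : ℝ) : IsSelfAdjoint (opPow B a) := by
  rw [IsSelfAdjoint, opPow_eq, star_smul, tsum_star]
  simp only [star_smul, star_pow, star_sub, star_one, star_trivial, hB.isSelfAdjoint.star_eq]

lemma inner_opPow_left (hB : B.IsPositive) (a : ℝ) (x y : H) :
    ⟪opPow B a x, y⟫_ℝ = ⟪x, opPow B a y⟫_ℝ := by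
  rw [← ContinuousLinearMap.adjoint_inner_right,
    ContinuousLinearMap.isSelfAdjoint_iff'.1 (isSelfAdjoint_opPow hB a)]

lemma inner_opPow_two_mul (hB : B.IsPositive) {a : ℝ} (ha : 0 ≤ a) (x : H) :
    ⟪opPow B (2 * a) x, x⟫_ℝ = ‖opPow B a x‖ ^ 2 := by
  rw [two_mul, opPow_add_apply hB ha ha, inner_opPow_left hB, real_inner_self_eq_norm_sq]

lemma commute_opPow (hB : B.IsPositive) {a : ℝ} (ha : 0 ≤ a) {S : H →L[ℝ] H}
    (h : Commute S B) : Commute S (opPow B a) := by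
  rw [opPow_eq]
  refine Commute.smul_right ?_ _
  have hs : Summable fun k => binCoeff a k • (1 - ‖B‖⁻¹ • B) ^ k :=
    (summable_norm_binTerm hB ha).of_norm
  have hk : ∀ k, Commute S (binCoeff a k • (1 - ‖B‖⁻¹ • B) ^ k) := fun k =>
    (((Commute.one_right S).sub_right (h.smul_right _)).pow_right k).smul_right _
  rw [Commute, SemiconjBy, ← hs.tsum_mul_left, ← hs.tsum_mul_right]
  exact tsum_congr fun k => hk k

/-- For an integer `n ≥ a` the injective `B ^ n` factors as `B ^ (n - a) * B ^ a`, so the inner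
factor is injective. -/
lemma opPow_injective (hB : B.IsPositive) (hinj : Function.Injective B) {a : ℝ} (ha : 0 ≤ a) :
    Function.Injective (opPow B a) := by
  have hn : ∀ n : ℕ, Function.Injective (opPow B n) := by
    intro n
    induction n with
    | zero => simpa [opPow_zero] using Function.injective_id
    | succ n ih =>
      have h := opPow_add hB n.cast_nonneg zero_le_one
      rw [opPow_one] at h
      push_cast
      rw [h]
      exact ih.comp hinj
  obtain ⟨n, hna⟩ := exists_nat_ge a
  have h := opPow_add hB (sub_nonneg.2 hna) ha
  rw [sub_add_cancel] at h
  have h2 := hn n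
  rw [h] at h2
  exact Function.Injective.of_comp (f := opPow B (n - a)) h2

/-- A bounded above midpoint convex function on `[0, 1]` that is nonpositive at the end points is
nonpositive. -/
lemma nonpos_of_midpoint_convex {φ : ℝ → ℝ} {K : ℝ} (h0 : φ 0 ≤ 0) (h1 : φ 1 ≤ 0)
    (hbd : ∀ t ∈ Set.Icc (0 : ℝ) 1, φ t ≤ K)
    (hmid : ∀ s ∈ Set.Icc (0 : ℝ) 1, ∀ t ∈ Set.Icc (0 : ℝ) 1,
      φ ((s + t) / 2) ≤ (φ s + φ t) / 2) :
    ∀ t ∈ Set.Icc (0 : ℝ) 1, φ t ≤ 0 := by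
  -- Every point is the midpoint of an end point and another point of the interval, so any upper
  -- bound can be halved repeatedly.
  have key : ∀ n : ℕ, ∀ t ∈ Set.Icc (0 : ℝ) 1, φ t ≤ |K| * (1 / 2) ^ n := by
    intro n
    induction n with
    | zero => exact fun t ht => (hbd t ht).trans (by simpa using le_abs_self K)
    | succ n ih =>
      intro t ht
      rcases le_total t (1 / 2) with h | h
      · have h2 := hmid 0 (by simp) (2 * t) ⟨by linarith [ht.1], by linarith⟩
        have h3 := ih (2 * t) ⟨by linarith [ht.1], by linarith⟩
        rw [show (0 + 2 * t) / 2 = t by ring] at h2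
        rw [pow_succ]
        linarith
      · have h2 := hmid 1 (by simp) (2 * t - 1) ⟨by linarith, by linarith [ht.2]⟩
        have h3 := ih (2 * t - 1) ⟨by linarith, by linarith [ht.2]⟩
        rw [show (1 + (2 * t - 1)) / 2 = t by ring] at h2
        rw [pow_succ]
        linarith
  intro t ht
  have hlim : Tendsto (fun n : ℕ => |K| * (1 / 2 : ℝ) ^ n) atTop (𝓝 0) := by
    simpa using (tendsto_pow_atTop_nhds_zero_of_lt_one (r := (1 / 2 : ℝ)) (by norm_num)
      (by norm_num)).const_mul |K|
  exact ge_of_tendsto' hlim fun n => key n t ht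

/-- Interpolation inequality in the Hilbert scale. -/
lemma norm_opPow_interpolation (hB : B.IsPositive) (hinj : Function.Injective B) {a c θ : ℝ}
    (ha : 0 ≤ a) (hc : 0 ≤ c) (h0 : 0 ≤ θ) (h1 : θ ≤ 1) (x : H) :
    ‖opPow B ((1 - θ) * a + θ * c) x‖ ≤ ‖opPow B a x‖ ^ (1 - θ) * ‖opPow B c x‖ ^ θ := by
  rcases eq_or_ne x 0 with rfl | hx
  · simp only [map_zero, norm_zero]
    positivity
  have hpos : ∀ t, 0 ≤ t → 0 < ‖opPow B t x‖ := fun t ht =>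
    norm_pos_iff.2 fun h => hx (opPow_injective hB hinj ht (by rw [h, map_zero]))
  obtain ⟨K, hK⟩ := exists_norm_opPow_le hB (max a c)
  set m : ℝ → ℝ := fun t => (1 - t) * a + t * c with hm
  have hm0 : ∀ t ∈ Set.Icc (0 : ℝ) 1, 0 ≤ m t := fun t ht =>
    add_nonneg (mul_nonneg (by linarith [ht.2]) ha) (mul_nonneg ht.1 hc)
  have hm1 : ∀ t ∈ Set.Icc (0 : ℝ) 1, m t ≤ max a c := fun t ht => by
    have h2 := mul_le_mul_of_nonneg_left (le_max_left a c) (show 0 ≤ 1 - t by linarith [ht.2])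
    have h3 := mul_le_mul_of_nonneg_left (le_max_right a c) ht.1
    simp only [hm]
    linarith
  set A := Real.log ‖opPow B a x‖
  set C := Real.log ‖opPow B c x‖
  -- Applied to the logarithm of the norm minus its chord. Midpoint convexity is Cauchy–Schwarz:
  -- `‖B^((s+t)/2) x‖² = ⟪B^s x, B^t x⟫`.
  have main := nonpos_of_midpoint_convex
    (φ := fun t => Real.log ‖opPow B (m t) x‖ - ((1 - t) * A + t * C))
    (K := Real.log (K * ‖x‖) + (|A| + |C|)) (by simp [hm, A]) (by simp [hm, C])
    (fun t ht => by
      have h2 : Real.log ‖opPow B (m t) x‖ ≤ Real.log (K * ‖x‖) :=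
        Real.log_le_log (hpos _ (hm0 t ht)) (((opPow B (m t)).le_opNorm x).trans
          (mul_le_mul_of_nonneg_right (hK _ (hm0 t ht) (hm1 t ht)) (norm_nonneg _)))
      have h3 : -((1 - t) * A) ≤ |A| := by
        refine (neg_le_abs _).trans ?_
        rw [abs_mul, abs_of_nonneg (by linarith [ht.2] : 0 ≤ 1 - t)]
        exact mul_le_of_le_one_left (abs_nonneg _) (by linarith [ht.1])
      have h4 : -(t * C) ≤ |C| := by
        refine (neg_le_abs _).trans ?_
        rw [abs_mul, abs_of_nonneg ht.1]
        exact mul_le_of_le_one_left (abs_nonneg _) ht.2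
      linarith)
    (fun s hs t ht => by
      have hst : m ((s + t) / 2) = (m s + m t) / 2 := by simp only [hm]; ring
      have h5 : 0 ≤ (m s + m t) / 2 := by linarith [hm0 s hs, hm0 t ht]
      have h2 : ‖opPow B ((m s + m t) / 2) x‖ ^ 2 ≤ ‖opPow B (m s) x‖ * ‖opPow B (m t) x‖ := by
        rw [← inner_opPow_two_mul hB h5, mul_div_cancel₀ _ (two_ne_zero' ℝ), add_comm,
          opPow_add_apply hB (hm0 t ht) (hm0 s hs), inner_opPow_left hB]
        exact real_inner_le_norm _ _
      have h3 := Real.log_le_log (pow_pos (hpos _ h5) 2) h2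
      rw [Real.log_pow, Real.log_mul (hpos _ (hm0 s hs)).ne' (hpos _ (hm0 t ht)).ne'] at h3
      push_cast at h3
      rw [hst]
      linarith)
    θ ⟨h0, h1⟩
  have h2 : Real.log ‖opPow B (m θ) x‖ ≤
      Real.log (‖opPow B a x‖ ^ (1 - θ) * ‖opPow B c x‖ ^ θ) := by
    rw [Real.log_mul (Real.rpow_pos_of_pos (hpos a ha) _).ne'
      (Real.rpow_pos_of_pos (hpos c hc) _).ne', Real.log_rpow (hpos a ha),
      Real.log_rpow (hpos c hc)]
    linarith
  exact (Real.log_le_log_iff (hpos _ (hm0 θ ⟨h0, h1⟩)) (mul_pos (Real.rpow_pos_of_pos (hpos a ha) _)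
    (Real.rpow_pos_of_pos (hpos c hc) _))).1 h2

end OpPow

/-! ### The inverse of the generator -/

section Generator

variable {H : Type*} [NormedAddCommGroup H] [InnerProductSpace ℝ H] [CompleteSpace H]
  {L : H →ₗ.[ℝ] H} {ℓL : ℝ}

lemma IsGenerator.isBoundedInverse_inv (hL : IsGenerator L ℓL) : IsBoundedInverse L (inv L) := by
  have h := hL.exists_isBoundedInverse
  rw [inv, dif_pos h]
  exact h.choose_spec

lemma IsGenerator.inner_map_left (hL : IsGenerator L ℓL) (f g : L.domain) :
    ⟪L f, (g : H)⟫_ℝ = ⟪(f : H), L g⟫_ℝ := by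
  have h := LinearPMap.adjoint_isFormalAdjoint (T := L) hL.dense
  rw [LinearPMap.isSelfAdjoint_def.1 hL.selfAdjoint] at h
  exact h f g

lemma IsGenerator.inv_injective (hL : IsGenerator L ℓL) : Function.Injective (inv L) := by
  intro x y hxy
  obtain ⟨h1, h2⟩ := hL.isBoundedInverse_inv.1 x
  obtain ⟨h3, h4⟩ := hL.isBoundedInverse_inv.1 y
  rw [← h2, ← h4]
  congr 1
  exact Subtype.ext hxy

lemma IsGenerator.inv_isPositive (hL : IsGenerator L ℓL) : (inv L).IsPositive := by
  refine (ContinuousLinearMap.isPositive_iff _).2 ⟨fun x y => ?_, fun x => ?_⟩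
  · obtain ⟨h1, h2⟩ := hL.isBoundedInverse_inv.1 x
    obtain ⟨h3, h4⟩ := hL.isBoundedInverse_inv.1 y
    have h := hL.inner_map_left ⟨_, h1⟩ ⟨_, h3⟩
    rw [h2, h4] at h
    exact h.symm
  · obtain ⟨h1, h2⟩ := hL.isBoundedInverse_inv.1 x
    rcases eq_or_ne (⟨_, h1⟩ : L.domain) 0 with h | h
    · rw [show inv L x = 0 from congrArg Subtype.val h, inner_zero_left]
    · have h5 := hL.pos _ h
      rw [h2, real_inner_comm] at h5
      exact h5.le

end Generator

/-! ### Benchmark elements -/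

section Benchmark

variable {H : Type*} [NormedAddCommGroup H] [InnerProductSpace ℝ H] [CompleteSpace H]

/-- Preimages in the ball have a weak limit along an ultrafilter by Banach–Alaoglu, and `S`
preserves weak limits, so this limit is mapped to the limit of the images. -/
lemma isClosed_image_closedBall (S : H →L[ℝ] H) (R : ℝ) :
    IsClosed (S '' Metric.closedBall 0 R) := by
  refine IsSeqClosed.isClosed fun y z hy hlim => ?_
  choose w hw hwy using hy
  have hK := WeakDual.isCompact_closedBall (0 : StrongDual ℝ H) R
  set φ : ℕ → WeakDual ℝ H := fun n => StrongDual.toWeakDual (InnerProductSpace.toDual ℝ H (w n))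
  have hφ : ∀ n, φ n ∈ WeakDual.toStrongDual ⁻¹' Metric.closedBall (0 : StrongDual ℝ H) R := by
    intro n
    have h := hw n
    rw [mem_closedBall_zero_iff] at h
    simp only [Set.mem_preimage, mem_closedBall_zero_iff, φ]
    exact ((InnerProductSpace.toDual ℝ H).norm_map (w n)).le.trans h
  obtain ⟨ψ, hψ, hle⟩ := hK.ultrafilter_le_nhds ((hyperfilter ℕ).map φ)
    (le_principal_iff.2 (Eventually.of_forall (f := (hyperfilter ℕ : Filter ℕ)) hφ))
  have ht : Tendsto φ (hyperfilter ℕ) (𝓝 ψ) := hle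
  set w₀ : H := (InnerProductSpace.toDual ℝ H).symm (WeakDual.toStrongDual ψ)
  have hw₀ : ∀ x, Tendsto (fun n => ⟪w n, x⟫_ℝ) (hyperfilter ℕ) (𝓝 ⟪w₀, x⟫_ℝ) := by
    intro x
    have h := ((WeakDual.eval_continuous x).tendsto ψ).comp ht
    have h2 : ⟪w₀, x⟫_ℝ = ψ x := InnerProductSpace.toDual_symm_apply
    rw [h2]
    exact h
  refine ⟨w₀, ?_, ?_⟩
  · rw [mem_closedBall_zero_iff]
    simp only [w₀, LinearIsometryEquiv.norm_map]
    simpa using hψ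
  · refine ext_inner_right ℝ fun x => ?_
    have h1 : Tendsto (fun n => ⟪y n, x⟫_ℝ) (hyperfilter ℕ) (𝓝 ⟪z, x⟫_ℝ) :=
      (hlim.mono_left Nat.hyperfilter_le_atTop).inner tendsto_const_nhds
    have h2 := hw₀ (S.adjoint x)
    refine tendsto_nhds_unique ?_ h1
    refine (h2.congr fun n => ?_).trans_eq ?_
    · rw [ContinuousLinearMap.adjoint_inner_right, hwy]
    · rw [ContinuousLinearMap.adjoint_inner_right]

variable {B : H →L[ℝ] H}

lemma exists_closest_in_image (S : H →L[ℝ] H) {R : ℝ} (hR : 0 ≤ R) (h : H) :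
    ∃ w : H, ‖w‖ ≤ R ∧ (∀ w', ‖w'‖ ≤ R → ‖h - S w‖ ≤ ‖h - S w'‖) ∧
      ∀ w', ‖w'‖ ≤ R → ⟪h - S w, S w' - S w⟫_ℝ ≤ 0 := by
  have hconv : Convex ℝ (S '' Metric.closedBall 0 R) :=
    (convex_closedBall 0 R).linear_image S.toLinearMap
  obtain ⟨y, ⟨w, hw, rfl⟩, hy⟩ := exists_norm_eq_iInf_of_complete_convex
    (K := S '' Metric.closedBall 0 R) ⟨S 0, 0, by simpa using hR, rfl⟩
    (isClosed_image_closedBall S R).isComplete hconv h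
  have hmem : ∀ w', ‖w'‖ ≤ R → S w' ∈ S '' Metric.closedBall 0 R := fun w' hw' =>
    ⟨w', by simpa using hw', rfl⟩
  refine ⟨w, by simpa using hw, fun w' hw' => ?_, fun w' hw' => ?_⟩
  · rw [hy]
    exact ciInf_le ⟨0, by rintro _ ⟨x, rfl⟩; exact norm_nonneg _⟩
      (⟨S w', hmem w' hw'⟩ : S '' Metric.closedBall 0 R)
  · exact (norm_eq_iInf_iff_real_inner_le_zero hconv (hmem w (by simpa using hw))).1 hy _
      (hmem w' hw')

/-- The approximation error of the closest element of the benchmark class, in the norms of the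
negative part of the scale. -/
lemma norm_opPow_benchmark_le (hB : B.IsPositive) (hinj : Function.Injective B)
    {q r k R : ℝ} (hr : 0 ≤ r) (hrq : r < q) (hk : 0 ≤ k) (hrk : r + k ≤ 2 * q) (hR : 0 < R)
    {v w : H} (hw : ‖w‖ ≤ R)
    (hvar : ∀ w', ‖w'‖ ≤ R →
      ⟪opPow B r v - opPow B q w, opPow B q w' - opPow B q w⟫_ℝ ≤ 0) :
    ‖opPow B k (opPow B r v - opPow B q w)‖ ≤ ‖v‖ * (‖v‖ / R) ^ ((r + k) / (q - r)) := by
  have hq : 0 < q := hr.trans_lt hrq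
  set e := opPow B r v - opPow B q w with he
  rcases eq_or_ne e 0 with h0 | h0
  · rw [h0, map_zero, norm_zero]
    positivity
  set g := opPow B q e with hg
  have hg0 : 0 < ‖g‖ := norm_pos_iff.2 fun h =>
    h0 (opPow_injective hB hinj hq.le (by rw [← hg, h, map_zero]))
  have hvar2 : ∀ w', ‖w'‖ ≤ R → ⟪g, w'⟫_ℝ ≤ ⟪g, w⟫_ℝ := fun w' hw' => by
    have h := hvar w' hw'
    rw [inner_sub_right, ← inner_opPow_left hB, ← inner_opPow_left hB] at h
    linarith
  -- The test vector is the point of the ball in the direction of `g`. With Cauchy–Schwarz it shows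
  -- that the constraint is active.
  have hRg : R * ‖g‖ ≤ ⟪g, w⟫_ℝ := by
    have h := hvar2 ((R / ‖g‖) • g) (by
      rw [norm_smul, norm_div, norm_norm, div_mul_cancel₀ _ hg0.ne', Real.norm_of_nonneg hR.le])
    rw [inner_smul_right, real_inner_self_eq_norm_sq] at h
    calc R * ‖g‖ = R / ‖g‖ * ‖g‖ ^ 2 := by field_simp
      _ ≤ _ := h
  have hRw : R ≤ ‖w‖ := by
    have h := hRg.trans (real_inner_le_norm g w)
    rw [mul_comm] at h
    exact le_of_mul_le_mul_left h hg0
  set μ := ‖g‖ / R with hμ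
  have hμ0 : 0 < μ := by positivity
  -- Equality in Cauchy–Schwarz: `g` is normal to the ball at `w`, and `μ` is the Lagrange
  -- multiplier.
  have hgw : g = μ • w := by
    have h : ‖R • g - ‖g‖ • w‖ ^ 2 ≤ 0 := by
      rw [@norm_sub_sq_real, norm_smul, norm_smul, inner_smul_left, inner_smul_right,
        Real.norm_of_nonneg hR.le, norm_norm]
      simp only [conj_trivial]
      have h1 : R * (‖g‖ * (R * ‖g‖)) ≤ R * (‖g‖ * ⟪g, w⟫_ℝ) := by gcongr
      have h2 : (‖g‖ * ‖w‖) ^ 2 ≤ (‖g‖ * R) ^ 2 := by gcongr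
      nlinarith
    have h2 : R • g = ‖g‖ • w := by
      rw [← sub_eq_zero, ← norm_eq_zero]
      exact pow_eq_zero_iff two_ne_zero |>.1 (le_antisymm h (sq_nonneg _))
    rw [hμ, div_eq_inv_mul, mul_smul, ← h2, smul_smul, inv_mul_cancel₀ hR.ne', one_smul]
  set y := v - opPow B (q - r) w with hy
  have hry : opPow B r y = e := by
    rw [hy, map_sub, ← opPow_add_apply hB hr (sub_nonneg.2 hrq.le), add_sub_cancel]
  have hq2 : 0 ≤ 2 * q := by linarith
  -- So `y = μ (B^(2q) + μ)⁻¹ v` is a Tikhonov residual. Pairing this equation with `y` and with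
  -- `B^(2q) y` gives the bounds `‖v‖` and `μ‖v‖` at the exponents `0` and `2q`, between which one
  -- interpolates; hence the restriction on `r + k`.
  have heq : opPow B (2 * q) y + μ • y = μ • v := by
    refine opPow_injective hB hinj hr ?_
    rw [map_add, ← opPow_add_apply hB hr hq2, add_comm r, opPow_add_apply hB hq2 hr, map_smul,
      map_smul, hry, two_mul, opPow_add_apply hB hq.le hq.le, ← hg, hgw, map_smul, ← smul_add, he,
      add_sub_cancel]
  have hD : 0 ≤ ⟪opPow B (2 * q) y, y⟫_ℝ := by
    rw [inner_opPow_two_mul hB hq.le]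
    positivity
  have hyv : ‖y‖ ≤ ‖v‖ := by
    have h : ⟪μ • v, y⟫_ℝ = ⟪opPow B (2 * q) y, y⟫_ℝ + μ * ‖y‖ ^ 2 := by
      rw [← heq, inner_add_left, inner_smul_left, real_inner_self_eq_norm_sq]
      rfl
    rw [inner_smul_left, conj_trivial] at h
    have h2 : μ * ‖y‖ ^ 2 ≤ μ * (‖v‖ * ‖y‖) := by
      have := mul_le_mul_of_nonneg_left (real_inner_le_norm v y) hμ0.le
      linarith
    have h3 := le_of_mul_le_mul_left h2 hμ0
    by_contra hc
    push Not at hc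
    nlinarith [norm_nonneg v]
  have hDv : ‖opPow B (2 * q) y‖ ≤ μ * ‖v‖ := by
    have h : ⟪μ • v, opPow B (2 * q) y⟫_ℝ
        = ‖opPow B (2 * q) y‖ ^ 2 + μ * ⟪opPow B (2 * q) y, y⟫_ℝ := by
      rw [← heq, inner_add_left, inner_smul_left, real_inner_self_eq_norm_sq,
        real_inner_comm]
      rfl
    have h2 := real_inner_le_norm (μ • v) (opPow B (2 * q) y)
    rw [norm_smul, Real.norm_of_nonneg hμ0.le, h] at h2
    have h4 := mul_nonneg hμ0.le hD
    by_contra hc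
    push Not at hc
    nlinarith [mul_nonneg hμ0.le (norm_nonneg v)]
  have hint : ∀ t, 0 ≤ t → t ≤ 2 * q → ‖opPow B t y‖ ≤ ‖v‖ * μ ^ (t / (2 * q)) := by
    intro t ht0 ht1
    have hθ0 : 0 ≤ t / (2 * q) := by positivity
    have hθ1 : t / (2 * q) ≤ 1 := div_le_one_of_le₀ ht1 hq2
    have h := norm_opPow_interpolation hB hinj le_rfl hq2 hθ0 hθ1 y
    rw [mul_zero, zero_add, div_mul_cancel₀ _ (by positivity : 2 * q ≠ 0), opPow_zero] at h
    refine h.trans ?_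
    calc _ ≤ ‖v‖ ^ (1 - t / (2 * q)) * (μ * ‖v‖) ^ (t / (2 * q)) := by
          refine mul_le_mul (Real.rpow_le_rpow (norm_nonneg _) hyv (by linarith))
            (Real.rpow_le_rpow (norm_nonneg _) hDv hθ0) (by positivity) (by positivity)
      _ = ‖v‖ * μ ^ (t / (2 * q)) := by
          rw [Real.mul_rpow hμ0.le (norm_nonneg _), mul_left_comm,
            ← Real.rpow_add_of_nonneg (norm_nonneg _) (by linarith) hθ0, sub_add_cancel,
            Real.rpow_one, mul_comm]
  -- The multiplier is eliminated in favour of the radius: `μ R ≤ ‖g‖ = ‖B^(q+r) y‖`, and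
  -- interpolation bounds the right side by `‖v‖ μ^((q+r)/(2q))`.
  have hμR : μ ^ ((q - r) / (2 * q)) ≤ ‖v‖ / R := by
    have h := hint (q + r) (by linarith) (by linarith)
    rw [opPow_add_apply hB hq.le hr, hry, ← hg, hgw, norm_smul, Real.norm_of_nonneg hμ0.le] at h
    have h2 : μ * R ≤ ‖v‖ * μ ^ ((q + r) / (2 * q)) :=
      (mul_le_mul_of_nonneg_left hRw hμ0.le).trans h
    have h3 : μ ^ ((q - r) / (2 * q)) * μ ^ ((q + r) / (2 * q)) = μ := by
      rw [← Real.rpow_add hμ0, ← add_div, show (q - r + (q + r)) / (2 * q) = 1 by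
        field_simp; ring, Real.rpow_one]
    rw [le_div_iff₀ hR]
    have h4 : 0 < μ ^ ((q + r) / (2 * q)) := Real.rpow_pos_of_pos hμ0 _
    nth_rewrite 1 [← h3] at h2
    refine le_of_mul_le_mul_right ?_ h4
    linarith
  calc ‖opPow B k e‖ = ‖opPow B (r + k) y‖ := by
        rw [← hry, ← opPow_add_apply hB hk hr, add_comm]
    _ ≤ ‖v‖ * μ ^ ((r + k) / (2 * q)) := hint _ (by linarith) hrk
    _ = ‖v‖ * (μ ^ ((q - r) / (2 * q))) ^ ((r + k) / (q - r)) := by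
        rw [← Real.rpow_mul hμ0.le]
        congr 2
        have : q - r ≠ 0 := by linarith
        field_simp
    _ ≤ _ := by
        gcongr

end Benchmark

/-! ### A Bernstein inequality in Hilbert spaces -/

section Bernstein

/-- The remainder `exp z - z - 1`. -/
noncomputable def expRem (z : ℝ) : ℝ := Real.exp z - z - 1

lemma expRem_nonneg (z : ℝ) : 0 ≤ expRem z := by
  have := Real.add_one_le_exp z
  rw [expRem]; linarith

@[fun_prop]
lemma continuous_expRem : Continuous expRem := by
  unfold expRem; fun_prop

lemma hasSum_expRem (z : ℝ) :
    HasSum (fun n : ℕ => z ^ (n + 2) / (n + 2).factorial) (expRem z) := by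
  have h := NormedSpace.expSeries_div_hasSum_exp z
  rw [← Real.exp_eq_exp_ℝ] at h
  have h2 := (hasSum_nat_add_iff' 2).2 h
  simp only [Finset.sum_range_succ, Finset.range_zero, Finset.sum_empty, pow_zero, pow_one,
    Nat.factorial, Nat.cast_one, mul_one, zero_add, div_one] at h2
  rwa [expRem, sub_sub, add_comm z 1]

/-- The power series starts in degree two, so a factor `c ≤ 1` in the argument contributes at least
`c²` to every term. -/
lemma expRem_mul_le {c z : ℝ} (hc : 0 ≤ c) (hc1 : c ≤ 1) (hz : 0 ≤ z) :
    expRem (c * z) ≤ c ^ 2 * expRem z := by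
  refine hasSum_le (fun n => ?_) (hasSum_expRem (c * z)) ((hasSum_expRem z).mul_left (c ^ 2))
  rw [mul_pow, mul_div_assoc]
  refine mul_le_mul_of_nonneg_right ?_ (by positivity)
  exact pow_le_pow_of_le_one hc hc1 (by omega)

lemma expRem_mono {a b : ℝ} (ha : 0 ≤ a) (hab : a ≤ b) : expRem a ≤ expRem b :=
  hasSum_le (fun n => by gcongr) (hasSum_expRem a) (hasSum_expRem b)

lemma expRem_le_sq {z : ℝ} (h0 : 0 ≤ z) (h1 : z ≤ 1) : expRem z ≤ z ^ 2 := by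
  have h := Real.abs_exp_sub_one_sub_id_le (x := z) (by rwa [abs_of_nonneg h0])
  have h2 := (le_abs_self _).trans h
  rw [expRem]; linarith

variable {E : Type*} [NormedAddCommGroup E] [InnerProductSpace ℝ E]

/-- With `c` the cosine of the angle, `‖s + x‖²` is the convex combination of `(a + b)²` and `(a -
b)²` with weights `(1 ± c)/2`. The series of `cosh` contains only powers of the square, so convexity
of `t ↦ t^n` reduces the claim to the scalar addition formulas. The last term is kept linear in `x`
so that it vanishes for centred vectors. -/
lemma cosh_norm_add_le (s x : E) :
    Real.cosh ‖s + x‖ ≤ Real.cosh ‖s‖ * (1 + expRem ‖x‖)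
      + Real.sinh ‖s‖ / ‖s‖ * ⟪s, x⟫_ℝ := by
  set a := ‖s‖ with ha
  set b := ‖x‖ with hb
  have ha0 : 0 ≤ a := norm_nonneg _
  have hb0 : 0 ≤ b := norm_nonneg _
  set c := ⟪s, x⟫_ℝ / (a * b) with hc
  have habs : |c| ≤ 1 := abs_real_inner_div_norm_mul_norm_le_one s x
  obtain ⟨hc1, hc2⟩ := abs_le.1 habs
  have hin : ⟪s, x⟫_ℝ = a * b * c := by
    rcases eq_or_ne (a * b) 0 with h | h
    · have := abs_real_inner_le_norm s x
      rw [← ha, ← hb, h] at this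
      rw [h, zero_mul]
      exact abs_eq_zero.1 (le_antisymm this (abs_nonneg _))
    · rw [hc, mul_div_cancel₀ _ h]
  have hsq : ‖s + x‖ ^ 2 = (1 + c) / 2 * (a + b) ^ 2 + (1 - c) / 2 * (a - b) ^ 2 := by
    rw [@norm_add_sq_real, hin]; ring
  have h1 : Real.cosh ‖s + x‖
      ≤ (1 + c) / 2 * Real.cosh (a + b) + (1 - c) / 2 * Real.cosh (a - b) := by
    refine hasSum_le (fun n => ?_) (Real.hasSum_cosh _)
      (((Real.hasSum_cosh (a + b)).mul_left _).add ((Real.hasSum_cosh (a - b)).mul_left _))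
    rw [← mul_div_assoc, ← mul_div_assoc, ← add_div, pow_mul, pow_mul, pow_mul, hsq]
    refine div_le_div_of_nonneg_right ?_ (by positivity)
    exact (convexOn_pow n).2 (Set.mem_Ici.2 (sq_nonneg _)) (Set.mem_Ici.2 (sq_nonneg _))
      (by linarith) (by linarith) (by ring)
  have hsa : 0 ≤ Real.sinh a := Real.sinh_nonneg_iff.2 ha0
  have hsb : b ≤ Real.sinh b := Real.self_le_sinh_iff.2 hb0
  have hlin : Real.sinh a / a * ⟪s, x⟫_ℝ = c * Real.sinh a * b := by
    rw [hin]
    rcases eq_or_ne a 0 with h | h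
    · simp [h]
    · field_simp
  have h2 : c * Real.sinh a * (Real.sinh b - b) ≤ Real.cosh a * (Real.sinh b - b) := by
    refine mul_le_mul_of_nonneg_right ?_ (by linarith)
    exact (mul_le_of_le_one_left hsa hc2).trans (Real.sinh_lt_cosh a).le
  rw [hlin]
  refine h1.trans ?_
  rw [Real.cosh_add, Real.cosh_sub, expRem, ← Real.cosh_add_sinh b]
  linarith

variable [CompleteSpace E] {Ω : Type*} [MeasurableSpace Ω] {μ : Measure Ω} [IsProbabilityMeasure μ]

lemma lintegral_cosh_norm_add_le {X : Ω → E} (hX : StronglyMeasurable X) (hint : Integrable X μ)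
    (hmean : ∫ ω, X ω ∂μ = 0) {K : ℝ} (hK : 0 ≤ K)
    (hrem : ∫⁻ ω, ENNReal.ofReal (expRem ‖X ω‖) ∂μ ≤ ENNReal.ofReal K) (s : E) :
    ∫⁻ ω, ENNReal.ofReal (Real.cosh ‖X ω + s‖) ∂μ
      ≤ ENNReal.ofReal (1 + K) * ENNReal.ofReal (Real.cosh ‖s‖) := by
  have hremi : Integrable (fun ω => expRem ‖X ω‖) μ := by
    refine ⟨(continuous_expRem.comp_stronglyMeasurable hX.norm).aestronglyMeasurable, ?_⟩
    rw [hasFiniteIntegral_iff_ofReal (Eventually.of_forall fun ω => expRem_nonneg _)]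
    exact hrem.trans_lt ENNReal.ofReal_lt_top
  have hremK : ∫ ω, expRem ‖X ω‖ ∂μ ≤ K := by
    rw [integral_eq_lintegral_of_nonneg_ae (Eventually.of_forall fun ω => expRem_nonneg _)
      hremi.aestronglyMeasurable]
    exact ENNReal.toReal_le_of_le_ofReal hK hrem
  have hini : Integrable (fun ω => ⟪s, X ω⟫_ℝ) μ := hint.const_inner s
  have h0 : Integrable (fun ω => 1 + expRem ‖X ω‖) μ := (integrable_const 1).add hremi
  have h1 : Integrable (fun ω => Real.cosh ‖s‖ * (1 + expRem ‖X ω‖)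
      + Real.sinh ‖s‖ / ‖s‖ * ⟪s, X ω⟫_ℝ) μ :=
    (h0.const_mul _).add (hini.const_mul _)
  calc ∫⁻ ω, ENNReal.ofReal (Real.cosh ‖X ω + s‖) ∂μ
      ≤ ∫⁻ ω, ENNReal.ofReal (Real.cosh ‖s‖ * (1 + expRem ‖X ω‖)
          + Real.sinh ‖s‖ / ‖s‖ * ⟪s, X ω⟫_ℝ) ∂μ := by
        refine lintegral_mono fun ω => ENNReal.ofReal_le_ofReal ?_
        rw [add_comm]
        exact cosh_norm_add_le s (X ω)
    _ = ENNReal.ofReal (Real.cosh ‖s‖ * (1 + ∫ ω, expRem ‖X ω‖ ∂μ)) := by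
        rw [← ofReal_integral_eq_lintegral_ofReal h1 (Eventually.of_forall fun ω =>
          (Real.cosh_pos _).le.trans (cosh_norm_add_le s (X ω)))]
        congr 1
        rw [integral_add (h0.const_mul _) (hini.const_mul _),
          integral_const_mul, integral_const_mul, integral_add (integrable_const 1) hremi,
          integral_inner hint, hmean]
        simp
    _ ≤ _ := by
        rw [← ENNReal.ofReal_mul (by linarith), mul_comm]
        refine ENNReal.ofReal_le_ofReal ?_
        have := Real.cosh_pos ‖s‖
        gcongr

/-- Induction by integrating out one coordinate while the other summands are frozen as `s`; each
integration costs a factor `1 + K`. -/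
lemma lintegral_cosh_norm_sum_le {X : Ω → E} (hX : StronglyMeasurable X) (hint : Integrable X μ)
    (hmean : ∫ ω, X ω ∂μ = 0) {K : ℝ} (hK : 0 ≤ K)
    (hrem : ∫⁻ ω, ENNReal.ofReal (expRem ‖X ω‖) ∂μ ≤ ENNReal.ofReal K) (m : ℕ) :
    ∫⁻ z, ENNReal.ofReal (Real.cosh ‖∑ i, X (z i)‖) ∂(Measure.pi fun _ : Fin m => μ)
      ≤ ENNReal.ofReal (1 + K) ^ m := by
  induction m with
  | zero => simp
  | succ m ih =>
    have hmeas : ∀ n : ℕ, StronglyMeasurable fun z : Fin n → Ω => ∑ i, X (z i) := fun n =>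
      Finset.stronglyMeasurable_fun_sum _ fun i _ => hX.comp_measurable (measurable_pi_apply i)
    have hmp := (measurePreserving_piFinSuccAbove (fun _ : Fin (m + 1) => μ) 0).symm
    rw [← hmp.lintegral_comp_emb (MeasurableEquiv.measurableEmbedding _)]
    have hcongr : ∀ p : Ω × (Fin m → Ω),
        ∑ i, X ((MeasurableEquiv.piFinSuccAbove (fun _ : Fin (m + 1) => Ω) 0).symm p i)
          = X p.1 + ∑ i, X (p.2 i) := by
      intro p
      rw [Fin.sum_univ_succ]
      rfl
    simp_rw [hcongr]
    rw [lintegral_prod_symm]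
    · calc _ ≤ ∫⁻ z, ENNReal.ofReal (1 + K) * ENNReal.ofReal (Real.cosh ‖∑ i, X (z i)‖)
            ∂(Measure.pi fun _ : Fin m => μ) :=
            lintegral_mono fun z => lintegral_cosh_norm_add_le hX hint hmean hK hrem _
        _ ≤ ENNReal.ofReal (1 + K) ^ (m + 1) := by
            rw [lintegral_const_mul' _ _ ENNReal.ofReal_ne_top, pow_succ']
            gcongr
    · refine (ENNReal.measurable_ofReal.comp ?_).aemeasurable
      refine Real.continuous_cosh.measurable.comp ?_
      exact ((hX.comp_measurable measurable_fst).add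
        ((hmeas m).comp_measurable measurable_snd)).norm.measurable

/-- Markov's inequality for `cosh ‖∑ X‖`, with `cosh r ≥ exp r / 2` and `1 + K ≤ exp K`. -/
lemma measure_norm_sum_ge_le {X : Ω → E} (hX : StronglyMeasurable X) (hint : Integrable X μ)
    (hmean : ∫ ω, X ω ∂μ = 0) {K : ℝ} (hK : 0 ≤ K)
    (hrem : ∫⁻ ω, ENNReal.ofReal (expRem ‖X ω‖) ∂μ ≤ ENNReal.ofReal K) (m : ℕ) {r : ℝ}
    (hr : 0 ≤ r) :
    (Measure.pi fun _ : Fin m => μ) {z | r ≤ ‖∑ i, X (z i)‖}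
      ≤ ENNReal.ofReal (2 * Real.exp (m * K - r)) := by
  set P := Measure.pi fun _ : Fin m => μ
  have h1 : ENNReal.ofReal (Real.exp r / 2) * P {z | r ≤ ‖∑ i, X (z i)‖}
      ≤ ENNReal.ofReal (Real.exp (m * K)) := by
    calc _ ≤ ENNReal.ofReal (Real.exp r / 2) * P {z | ENNReal.ofReal (Real.exp r / 2)
            ≤ ENNReal.ofReal (Real.cosh ‖∑ i, X (z i)‖)} := by
          gcongr with z
          intro hz
          refine ENNReal.ofReal_le_ofReal ?_
          have h2 : Real.cosh r ≤ Real.cosh ‖∑ i, X (z i)‖ := by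
            rw [Real.cosh_le_cosh, abs_of_nonneg hr, abs_of_nonneg (norm_nonneg _)]
            exact hz
          refine le_trans ?_ h2
          rw [Real.cosh_eq]
          have := Real.exp_pos (-r)
          linarith
      _ ≤ ∫⁻ z, ENNReal.ofReal (Real.cosh ‖∑ i, X (z i)‖) ∂P := by
          refine mul_meas_ge_le_lintegral₀ ?_ _
          refine (ENNReal.measurable_ofReal.comp
            (Real.continuous_cosh.measurable.comp ?_)).aemeasurable
          exact (Finset.stronglyMeasurable_fun_sum _ fun i _ =>
            hX.comp_measurable (measurable_pi_apply i)).norm.measurable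
      _ ≤ ENNReal.ofReal (1 + K) ^ m := lintegral_cosh_norm_sum_le hX hint hmean hK hrem m
      _ ≤ ENNReal.ofReal (Real.exp (m * K)) := by
          rw [← ENNReal.ofReal_pow (by linarith), Real.exp_nat_mul]
          refine ENNReal.ofReal_le_ofReal (pow_le_pow_left₀ (by linarith) ?_ m)
          rw [add_comm]
          exact Real.add_one_le_exp K
  have h3 : (0 : ℝ) < Real.exp r / 2 := by positivity
  rw [mul_comm, ← ENNReal.le_div_iff_mul_le (Or.inl (by simpa using h3))
    (Or.inl ENNReal.ofReal_ne_top), ← ENNReal.ofReal_div_of_pos h3] at h1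
  refine h1.trans (ENNReal.ofReal_le_ofReal (le_of_eq ?_))
  rw [Real.exp_sub]
  field_simp

/-- Bernstein's inequality for the mean of independent copies of a centred random vector. -/
lemma measure_norm_mean_gt_le {X : Ω → E} (hX : StronglyMeasurable X) (hint : Integrable X μ)
    (hmean : ∫ ω, X ω ∂μ = 0) {t V : ℝ} (ht : 0 < t) (hV : 0 ≤ V)
    (hrem : ∫⁻ ω, ENNReal.ofReal (expRem (t * ‖X ω‖)) ∂μ ≤ ENNReal.ofReal (t ^ 2 * V))
    {m : ℕ} (hm : 0 < m) {η : ℝ} (hη : 0 < η) (hη1 : η < 1) :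
    (Measure.pi fun _ : Fin m => μ)
        {z | Real.log (4 / η) / (t * m) + t * V < ‖(1 / (m : ℝ)) • ∑ i, X (z i)‖}
      ≤ ENNReal.ofReal (η / 2) := by
  have hm0 : (0 : ℝ) < m := by exact_mod_cast hm
  have hlog : 0 ≤ Real.log (4 / η) := Real.log_nonneg (by rw [le_div_iff₀ hη]; linarith)
  -- The threshold cancels `m * K` in the exponent and leaves `2 exp (-log (4/η)) = η/2`, half of
  -- the failure probability for each of the two events used later.
  have h := measure_norm_sum_ge_le (μ := μ) (X := fun ω => t • X ω) (hX.const_smul t)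
    (hint.smul t) (by rw [integral_smul, hmean, smul_zero]) (K := t ^ 2 * V) (by positivity)
    (by simpa only [norm_smul, Real.norm_of_nonneg ht.le] using hrem) m
    (r := Real.log (4 / η) + m * (t ^ 2 * V)) (by positivity)
  refine (measure_mono fun z hz => ?_).trans (h.trans (ENNReal.ofReal_le_ofReal (le_of_eq ?_)))
  · simp only [Set.mem_ofPred_eq] at hz ⊢
    rw [← Finset.smul_sum, norm_smul, Real.norm_of_nonneg ht.le]
    rw [norm_smul, Real.norm_of_nonneg (by positivity), one_div, inv_mul_eq_div,
      lt_div_iff₀ hm0] at hz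
    have h2 := mul_lt_mul_of_pos_left hz ht
    refine le_of_eq_of_le ?_ h2.le
    field_simp
  · rw [sub_add_cancel_right, Real.exp_neg, Real.exp_log (by positivity)]
    field_simp
    norm_num

end Bernstein

/-! ### The square root of the resolvent -/

section Resolvent

variable {E : Type*} [NormedAddCommGroup E] [InnerProductSpace ℝ E] [CompleteSpace E]
  {T : E →L[ℝ] E} {lam : ℝ}

lemma isUnit_add_smul_one (hT : T.IsPositive) (hlam : 0 < lam) :
    IsUnit (T + lam • (1 : E →L[ℝ] E)) := by
  refine ContinuousLinearMap.isUnit_of_forall_le_norm_inner_map _ (c := ⟨lam, hlam.le⟩) hlam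
    fun x => ?_
  have h : ⟪(T + lam • (1 : E →L[ℝ] E)) x, x⟫_ℝ = ⟪T x, x⟫_ℝ + lam * ‖x‖ ^ 2 := by
    simp [inner_add_left, inner_smul_left]
  have h2 := hT.inner_nonneg_left x
  rw [h, Real.norm_of_nonneg (by positivity)]
  change ‖x‖ ^ 2 * lam ≤ _
  linarith

/-- The operator `(T + lam I)⁻¹`. -/
noncomputable def resolvent (T : E →L[ℝ] E) (lam : ℝ) : E →L[ℝ] E :=
  Ring.inverse (T + lam • (1 : E →L[ℝ] E))

lemma add_resolvent (hT : T.IsPositive) (hlam : 0 < lam) (x : E) :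
    T (resolvent T lam x) + lam • resolvent T lam x = x := by
  have h := Ring.mul_inverse_cancel _ (isUnit_add_smul_one hT hlam)
  exact DFunLike.congr_fun h x

lemma commute_resolvent (hT : T.IsPositive) (hlam : 0 < lam) : Commute T (resolvent T lam) := by
  have hu := isUnit_add_smul_one hT hlam
  have h1 := Ring.mul_inverse_cancel _ hu
  have h2 := Ring.inverse_mul_cancel _ hu
  rw [add_mul, smul_mul_assoc, one_mul] at h1
  rw [mul_add, mul_smul_comm, mul_one] at h2
  exact add_right_cancel (h1.trans h2.symm)

lemma resolvent_isPositive (hT : T.IsPositive) (hlam : 0 < lam) :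
    (resolvent T lam).IsPositive := by
  refine (ContinuousLinearMap.isPositive_iff _).2 ⟨fun x y => ?_, fun x => ?_⟩
  · change ⟪resolvent T lam x, y⟫_ℝ = ⟪x, resolvent T lam y⟫_ℝ
    conv_lhs => rw [← add_resolvent hT hlam y]
    conv_rhs => rw [← add_resolvent hT hlam x]
    rw [inner_add_left, inner_add_right, inner_smul_left, inner_smul_right,
      hT.inner_left_eq_inner_right]
    rfl
  · have h : ⟪resolvent T lam x, x⟫_ℝ
        = ⟪T (resolvent T lam x), resolvent T lam x⟫_ℝ + lam * ‖resolvent T lam x‖ ^ 2 := by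
      nth_rewrite 2 [← add_resolvent hT hlam x]
      rw [inner_add_right, inner_smul_right, real_inner_self_eq_norm_sq, real_inner_comm]
    have h2 := hT.inner_nonneg_left (resolvent T lam x)
    rw [h]
    positivity

lemma norm_resolvent_apply_le (hT : T.IsPositive) (hlam : 0 < lam) (x : E) :
    lam * ‖resolvent T lam x‖ ≤ ‖x‖ := by
  have h : ⟪x, resolvent T lam x⟫_ℝ
      = ⟪T (resolvent T lam x), resolvent T lam x⟫_ℝ + lam * ‖resolvent T lam x‖ ^ 2 := by
    nth_rewrite 1 [← add_resolvent hT hlam x]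
    rw [inner_add_left, inner_smul_left, real_inner_self_eq_norm_sq]
    rfl
  have h2 : 0 ≤ ⟪T (resolvent T lam x), resolvent T lam x⟫_ℝ := by
    simpa using hT.inner_nonneg_left (resolvent T lam x)
  have h3 := real_inner_le_norm x (resolvent T lam x)
  by_contra hc
  push Not at hc
  nlinarith [norm_nonneg (resolvent T lam x), norm_nonneg x]

/-- The operator `(T + lam I) ^ (-1/2)`. -/
noncomputable def resolventSqrt (T : E →L[ℝ] E) (lam : ℝ) : E →L[ℝ] E :=
  opPow (resolvent T lam) (1 / 2)

lemma resolventSqrt_mul_self (hT : T.IsPositive) (hlam : 0 < lam) (x : E) :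
    resolventSqrt T lam (resolventSqrt T lam x) = resolvent T lam x := by
  rw [resolventSqrt, ← opPow_add_apply (resolvent_isPositive hT hlam) (by norm_num) (by norm_num),
    add_halves, opPow_one]

lemma inner_resolventSqrt_left (hT : T.IsPositive) (hlam : 0 < lam) (x y : E) :
    ⟪resolventSqrt T lam x, y⟫_ℝ = ⟪x, resolventSqrt T lam y⟫_ℝ :=
  inner_opPow_left (resolvent_isPositive hT hlam) _ x y

lemma resolventSqrt_comm (hT : T.IsPositive) (hlam : 0 < lam) (x : E) :
    T (resolventSqrt T lam x) = resolventSqrt T lam (T x) :=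
  DFunLike.congr_fun (commute_opPow (resolvent_isPositive hT hlam) (by norm_num)
    (commute_resolvent hT hlam) : T * _ = _ * T) x

lemma norm_resolventSqrt_sq (hT : T.IsPositive) (hlam : 0 < lam) (x : E) :
    ‖resolventSqrt T lam x‖ ^ 2 = ⟪x, resolvent T lam x⟫_ℝ := by
  rw [← real_inner_self_eq_norm_sq, inner_resolventSqrt_left hT hlam,
    resolventSqrt_mul_self hT hlam]

lemma norm_resolventSqrt_sq_le (hT : T.IsPositive) (hlam : 0 < lam) (x : E) :
    ‖resolventSqrt T lam x‖ ^ 2 ≤ ‖x‖ ^ 2 / lam := by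
  rw [norm_resolventSqrt_sq hT hlam, le_div_iff₀ hlam]
  have h := mul_le_mul_of_nonneg_right (real_inner_le_norm x (resolvent T lam x)) hlam.le
  have h2 := mul_le_mul_of_nonneg_left (norm_resolvent_apply_le hT hlam x) (norm_nonneg x)
  nlinarith

/-- Cauchy–Schwarz with the weight `T + lam I`. -/
lemma abs_inner_le_resolventSqrt (hT : T.IsPositive) (hlam : 0 < lam) (c z : E) :
    ⟪c, z⟫_ℝ ≤ √(⟪T c, c⟫_ℝ + lam * ‖c‖ ^ 2) * ‖resolventSqrt T lam z‖ := by
  set W := resolventSqrt T lam with hW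
  -- The vector `d = (T + lam) W c` plays the role of `(T + lam)^(1/2) c`, so no square root of `T +
  -- lam` itself has to be constructed.
  set d := T (W c) + lam • W c with hd
  have hWd : W d = c := by
    rw [hd, map_add, map_smul, ← resolventSqrt_comm hT hlam, ← hW, resolventSqrt_mul_self hT hlam,
      add_resolvent hT hlam]
  have hdW : d = W (T c + lam • c) := by
    rw [hd, map_add, map_smul, resolventSqrt_comm hT hlam]
  have hdn : ‖d‖ ^ 2 = ⟪T c, c⟫_ℝ + lam * ‖c‖ ^ 2 := by
    rw [← real_inner_self_eq_norm_sq]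
    nth_rewrite 1 [hdW]
    rw [inner_resolventSqrt_left hT hlam, ← hW, hWd, inner_add_left, inner_smul_left,
      real_inner_self_eq_norm_sq]
    rfl
  rw [← hdn, Real.sqrt_sq (norm_nonneg _)]
  nth_rewrite 1 [← hWd]
  rw [inner_resolventSqrt_left hT hlam]
  exact real_inner_le_norm _ _

lemma inner_resolvent_mul (hT : T.IsPositive) (hlam : 0 < lam) (x : E) :
    ⟪x, (resolvent T lam * T) x⟫_ℝ = ⟪T (resolventSqrt T lam x), resolventSqrt T lam x⟫_ℝ := by
  change ⟪x, resolvent T lam (T x)⟫_ℝ = _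
  rw [← resolventSqrt_mul_self hT hlam, ← inner_resolventSqrt_left hT hlam,
    ← resolventSqrt_comm hT hlam, real_inner_comm]

end Resolvent

/-! ### Hilbert–Schmidt operators -/

section HilbertSchmidt

variable {E F G : Type*} [NormedAddCommGroup E] [InnerProductSpace ℝ E] [CompleteSpace E]
  [NormedAddCommGroup F] [InnerProductSpace ℝ F] [CompleteSpace F]
  [NormedAddCommGroup G] [InnerProductSpace ℝ G] [CompleteSpace G]

lemma ofReal_norm_sq_eq_tsum (x : E) :
    ENNReal.ofReal (‖x‖ ^ 2) = ∑' i, ENNReal.ofReal (⟪x, basis E i⟫_ℝ ^ 2) := by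
  have h := (basis E).hasSum_inner_mul_inner x x
  simp only [real_inner_self_eq_norm_sq] at h
  have h2 : HasSum (fun i => ⟪x, basis E i⟫_ℝ ^ 2) (‖x‖ ^ 2) := by
    refine h.congr_fun fun i => ?_
    rw [real_inner_comm (basis E i : E) x, sq]
  rw [← h2.tsum_eq, ENNReal.ofReal_tsum_of_nonneg (fun i => sq_nonneg _) h2.summable]

lemma hsNormSq_adjoint (S : E →L[ℝ] F) : hsNormSq S.adjoint = hsNormSq S := by
  simp only [hsNormSq, ofReal_norm_sq_eq_tsum]
  rw [ENNReal.tsum_comm]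
  refine tsum_congr fun i => tsum_congr fun j => ?_
  rw [ContinuousLinearMap.adjoint_inner_left, real_inner_comm]

lemma hsNormSq_comp_le {S : F →L[ℝ] G} {c : ℝ} (hc : 0 ≤ c)
    (hS : ∀ x, ‖S x‖ ^ 2 ≤ c * ‖x‖ ^ 2) (R : E →L[ℝ] F) :
    hsNormSq (S ∘L R) ≤ ENNReal.ofReal c * hsNormSq R := by
  rw [hsNormSq, hsNormSq, ← ENNReal.tsum_mul_left]
  refine ENNReal.tsum_le_tsum fun i => ?_
  rw [← ENNReal.ofReal_mul hc]
  exact ENNReal.ofReal_le_ofReal (hS _)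

lemma norm_apply_sq_le_hsNormSq_toReal {S : E →L[ℝ] F} (hS : hsNormSq S ≠ ∞) (x : E) :
    ‖S x‖ ^ 2 ≤ (hsNormSq S).toReal * ‖x‖ ^ 2 :=
  norm_apply_sq_le_of_hsNormSq_le ENNReal.toReal_nonneg (ENNReal.ofReal_toReal hS).ge x

lemma memℓp_of_hsNormSq {S : E →L[ℝ] F} (hS : hsNormSq S ≠ ∞) :
    Memℓp (fun i : basisIndex E => S (basis E i)) 2 := by
  refine memℓp_gen ?_
  have h := ENNReal.summable_toReal hS
  refine h.congr fun i => ?_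
  rw [ENNReal.toReal_ofReal (by positivity)]
  simp

/-- A Hilbert–Schmidt operator as the square summable family of its values on the basis. -/
noncomputable def hsVec (S : E →L[ℝ] F) (hS : hsNormSq S ≠ ∞) :
    lp (fun _ : basisIndex E => F) 2 :=
  ⟨fun i => S (basis E i), memℓp_of_hsNormSq hS⟩

lemma hsVec_apply (S : E →L[ℝ] F) (hS : hsNormSq S ≠ ∞) (i : basisIndex E) :
    (hsVec S hS : ∀ _ : basisIndex E, F) i = S (basis E i) := rfl

lemma ofReal_norm_lp_sq (f : lp (fun _ : basisIndex E => F) 2) :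
    ENNReal.ofReal (‖f‖ ^ 2) = ∑' i, ENNReal.ofReal (‖f i‖ ^ 2) := by
  have h := lp.hasSum_norm (p := 2) (by norm_num) f
  simp only [ENNReal.toReal_ofNat, Real.rpow_ofNat] at h
  rw [← h.tsum_eq, ENNReal.ofReal_tsum_of_nonneg (fun i => by positivity) h.summable]

lemma ofReal_norm_hsVec_sq (S : E →L[ℝ] F) (hS : hsNormSq S ≠ ∞) :
    ENNReal.ofReal (‖hsVec S hS‖ ^ 2) = hsNormSq S :=
  ofReal_norm_lp_sq _

/-- Random operators are handled as elements of the Hilbert space `lp`, where Bernstein's inequality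
applies; this converts the resulting Hilbert–Schmidt bound back to an operator bound. -/
lemma norm_apply_le_norm_lp {S : E →L[ℝ] F} {f : lp (fun _ : basisIndex E => F) 2}
    (hf : ∀ i, f i = S (basis E i)) (x : E) : ‖S x‖ ≤ ‖f‖ * ‖x‖ := by
  have h : hsNormSq S ≤ ENNReal.ofReal (‖f‖ ^ 2) := by
    rw [ofReal_norm_lp_sq, hsNormSq]
    simp only [hf, le_refl]
  have h2 := norm_apply_sq_le_of_hsNormSq_le (sq_nonneg _) h x
  rw [← mul_pow] at h2
  exact (sq_le_sq₀ (norm_nonneg _) (by positivity)).1 h2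

variable {Ω : Type*} [MeasurableSpace Ω]

lemma stronglyMeasurable_of_inner [TopologicalSpace.SeparableSpace E] {f : Ω → E}
    (hf : ∀ w, Measurable fun x => ⟪f x, w⟫_ℝ) : StronglyMeasurable f := by
  have hcount : Countable (basisIndex E) := countable_basisIndex
  refine stronglyMeasurable_of_tendsto (u := (atTop : Filter (Finset (basisIndex E))))
    (f := fun t x => ∑ i ∈ t, ⟪f x, basis E i⟫_ℝ • basis E i) (fun t => ?_) ?_
  · exact Finset.stronglyMeasurable_fun_sum t fun i _ =>
      (hf _).stronglyMeasurable.smul_const _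
  · refine tendsto_pi_nhds.2 fun x => ?_
    have h := (basis E).hasSum_repr (f x)
    simp only [HilbertBasis.repr_apply_apply, real_inner_comm] at h
    simpa [HasSum, SummationFilter.unconditional_filter] using h

lemma stronglyMeasurable_lp [TopologicalSpace.SeparableSpace E]
    {f : Ω → lp (fun _ : basisIndex E => F) 2}
    (hf : ∀ i, StronglyMeasurable fun x => f x i) : StronglyMeasurable f := by
  classical
  have hcount : Countable (basisIndex E) := countable_basisIndex
  refine stronglyMeasurable_of_tendsto (u := (atTop : Filter (Finset (basisIndex E))))
    (f := fun t x => ∑ i ∈ t, lp.single 2 i (f x i)) (fun t => ?_) ?_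
  · exact Finset.stronglyMeasurable_fun_sum t fun i _ =>
      (lp.isometry_single i).continuous.comp_stronglyMeasurable (hf i)
  · refine tendsto_pi_nhds.2 fun x => ?_
    have h := lp.hasSum_single (by norm_num) (f x)
    simpa [HasSum, SummationFilter.unconditional_filter] using h

end HilbertSchmidt

/-! ### The covariance operator and the effective dimension -/

section Covariance

lemma KernelCondition.integrable_inner {X Y H' : Type*} [MeasurableSpace X]
    [NormedAddCommGroup Y] [InnerProductSpace ℝ Y] [CompleteSpace Y]
    [NormedAddCommGroup H'] [InnerProductSpace ℝ H'] [CompleteSpace H'] [RKHS ℝ H' X Y]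
    [MeasurableSpace Y] [BorelSpace Y] [TopologicalSpace.SeparableSpace Y]
    {κ : ℝ} (hK : KernelCondition X Y H' κ) (ν : Measure X) [IsProbabilityMeasure ν] (f g : H') :
    Integrable (fun x => ⟪f x, g x⟫_ℝ) ν :=
  (L2.integrable_inner (𝕜 := ℝ) (inclusion hK ν f) (inclusion hK ν g)).congr (by
    filter_upwards [(hK.memLp ν f).coeFn_toLp, (hK.memLp ν g).coeFn_toLp] with x h1 h2
    exact congrArg₂ _ h1 h2)

variable {X Y H' : Type*} [MeasurableSpace X]
  [NormedAddCommGroup Y] [InnerProductSpace ℝ Y] [CompleteSpace Y]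
  [NormedAddCommGroup H'] [InnerProductSpace ℝ H'] [CompleteSpace H'] [RKHS ℝ H' X Y]
  [MeasurableSpace Y] [BorelSpace Y] [TopologicalSpace.SeparableSpace Y]
  {κ : ℝ} (hK : KernelCondition X Y H' κ) (ν : Measure X) [IsProbabilityMeasure ν]

lemma inclusion_coeFn (g : H') : inclusion hK ν g =ᵐ[ν] fun x => g x :=
  (hK.memLp ν g).coeFn_toLp

lemma inner_inclusion (f g : H') :
    ⟪inclusion hK ν f, inclusion hK ν g⟫_ℝ = ∫ x, ⟪f x, g x⟫_ℝ ∂ν := by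
  rw [L2.inner_def]
  refine integral_congr_ae ?_
  filter_upwards [inclusion_coeFn hK ν f, inclusion_coeFn hK ν g] with x h1 h2
  rw [h1, h2]

lemma lintegral_norm_apply_sq (g : H') :
    ∫⁻ x, ENNReal.ofReal (‖g x‖ ^ 2) ∂ν = ENNReal.ofReal (‖inclusion hK ν g‖ ^ 2) := by
  have h := hK.integrable_inner ν g g
  rw [← real_inner_self_eq_norm_sq, inner_inclusion]
  simp only [real_inner_self_eq_norm_sq] at h ⊢
  rw [ofReal_integral_eq_lintegral_ofReal h (Eventually.of_forall fun x => sq_nonneg _)]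

lemma covariance_isPositive : (covariance hK ν).IsPositive :=
  ContinuousLinearMap.isPositive_adjoint_comp_self _

lemma inner_covariance_left (f g : H') :
    ⟪covariance hK ν f, g⟫_ℝ = ⟪inclusion hK ν f, inclusion hK ν g⟫_ℝ := by
  rw [covariance, ContinuousLinearMap.comp_apply, ContinuousLinearMap.adjoint_inner_left]

variable {ν} {lam : ℝ}

/-- The preconditioned kernel section `(T_ν + lam I) ^ (-1/2) K_x`. -/
noncomputable def preKernel (ν : Measure X) [IsProbabilityMeasure ν] (lam : ℝ) (x : X) :
    Y →L[ℝ] H' :=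
  resolventSqrt (covariance hK ν) lam ∘L RKHS.kerFun H' x

lemma inner_preKernel (hlam : 0 < lam) (x : X) (y : Y) (w : H') :
    ⟪preKernel hK ν lam x y, w⟫_ℝ = ⟪y, (resolventSqrt (covariance hK ν) lam w) x⟫_ℝ := by
  rw [preKernel, ContinuousLinearMap.comp_apply,
    inner_resolventSqrt_left (covariance_isPositive hK ν) hlam, RKHS.kerFun_inner]

lemma hsNormSq_preKernel_eq (hlam : 0 < lam) (x : X) :
    hsNormSq (preKernel hK ν lam x) = ∑' j : basisIndex H',
      ENNReal.ofReal (‖(resolventSqrt (covariance hK ν) lam (basis H' j)) x‖ ^ 2) := by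
  rw [← hsNormSq_adjoint, hsNormSq]
  refine tsum_congr fun j => ?_
  congr 3
  refine ext_inner_left ℝ fun y => ?_
  rw [ContinuousLinearMap.adjoint_inner_right, inner_preKernel hK hlam]

/-- The uniform bound supplies the boundedness scale in Bernstein's inequality; its average over
`x`, the effective dimension, supplies the variance. -/
lemma hsNormSq_preKernel_le (hlam : 0 < lam) (x : X) :
    hsNormSq (preKernel hK ν lam x) ≤ ENNReal.ofReal (κ ^ 2 / lam) := by
  have h := hsNormSq_comp_le (S := resolventSqrt (covariance hK ν) lam) (c := 1 / lam)
    (by positivity) (fun y => by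
      have := norm_resolventSqrt_sq_le (covariance_isPositive hK ν) hlam y
      rwa [one_div, inv_mul_eq_div]) (RKHS.kerFun H' x)
  refine h.trans ?_
  calc _ ≤ ENNReal.ofReal (1 / lam) * ENNReal.ofReal (κ ^ 2) := by
        gcongr
        exact hK.hilbertSchmidt x
    _ = _ := by
        rw [← ENNReal.ofReal_mul (by positivity), one_div, inv_mul_eq_div]

lemma hsNormSq_preKernel_ne_top (hlam : 0 < lam) (x : X) :
    hsNormSq (preKernel hK ν lam x) ≠ ∞ :=
  ne_top_of_le_ne_top ENNReal.ofReal_ne_top (hsNormSq_preKernel_le hK hlam x)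

variable [TopologicalSpace.SeparableSpace H']

lemma lintegral_hsNormSq_preKernel_eq_tsum (hlam : 0 < lam) :
    ∫⁻ x, hsNormSq (preKernel hK ν lam x) ∂ν = ∑' j : basisIndex H', ENNReal.ofReal
      (‖inclusion hK ν (resolventSqrt (covariance hK ν) lam (basis H' j))‖ ^ 2) := by
  have hcount : Countable (basisIndex H') := countable_basisIndex
  simp only [hsNormSq_preKernel_eq hK hlam]
  rw [lintegral_tsum fun j =>
    ((hK.stronglyMeasurable _).norm.measurable.pow_const 2).ennreal_ofReal.aemeasurable]
  simp only [lintegral_norm_apply_sq hK ν]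

lemma lintegral_hsNormSq_preKernel_le (hlam : 0 < lam) :
    ∫⁻ x, hsNormSq (preKernel hK ν lam x) ∂ν ≤ ENNReal.ofReal (κ ^ 2 / lam) := by
  calc _ ≤ ∫⁻ _, ENNReal.ofReal (κ ^ 2 / lam) ∂ν :=
        lintegral_mono fun x => hsNormSq_preKernel_le hK hlam x
    _ = _ := by simp

lemma effDim_eq_tsum (hlam : 0 < lam) :
    effDim hK ν lam = ∑' j : basisIndex H',
      ‖inclusion hK ν (resolventSqrt (covariance hK ν) lam (basis H' j))‖ ^ 2 := by
  refine tsum_congr fun j => ?_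
  rw [← real_inner_self_eq_norm_sq, ← inner_covariance_left]
  exact inner_resolvent_mul (covariance_isPositive hK ν) hlam _

/-- The effective dimension is the mean squared Hilbert–Schmidt norm of the preconditioned kernel
sections. -/
lemma lintegral_hsNormSq_preKernel (hlam : 0 < lam) :
    ∫⁻ x, hsNormSq (preKernel hK ν lam x) ∂ν = ENNReal.ofReal (effDim hK ν lam) := by
  have hfin := ne_top_of_le_ne_top ENNReal.ofReal_ne_top
    (lintegral_hsNormSq_preKernel_le (ν := ν) hK hlam)
  rw [lintegral_hsNormSq_preKernel_eq_tsum hK hlam] at hfin ⊢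
  have hs := ENNReal.summable_toReal hfin
  simp only [ENNReal.toReal_ofReal (sq_nonneg _)] at hs
  rw [effDim_eq_tsum hK hlam, ENNReal.ofReal_tsum_of_nonneg (fun _ => sq_nonneg _) hs]

lemma effDim_nonneg (hlam : 0 < lam) : 0 ≤ effDim hK ν lam := by
  rw [effDim_eq_tsum hK hlam]
  exact tsum_nonneg fun j => sq_nonneg _

lemma effDim_le (hlam : 0 < lam) : effDim hK ν lam ≤ κ ^ 2 / lam := by
  have h := lintegral_hsNormSq_preKernel_le (ν := ν) hK hlam
  rw [lintegral_hsNormSq_preKernel hK hlam] at h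
  exact (ENNReal.ofReal_le_ofReal_iff (by positivity)).1 h

/-- The squared Hilbert–Schmidt norm of `I_ν (T_ν + lam)^(-1/2)` is the effective dimension and
dominates the operator norm. It is evaluated at the vector that `(T_ν + lam)^(-1/2)` maps to `c`. -/
lemma norm_inclusion_sq_le_effDim (hlam : 0 < lam) (c : H') :
    ‖inclusion hK ν c‖ ^ 2
      ≤ effDim hK ν lam * (‖inclusion hK ν c‖ ^ 2 + lam * ‖c‖ ^ 2) := by
  set T := covariance hK ν with hTdef
  have hT : T.IsPositive := covariance_isPositive hK ν
  set W := resolventSqrt T lam with hW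
  have hS : hsNormSq (inclusion hK ν ∘L W) ≤ ENNReal.ofReal (effDim hK ν lam) := by
    rw [← lintegral_hsNormSq_preKernel hK hlam, lintegral_hsNormSq_preKernel_eq_tsum hK hlam]
    rfl
  have h := norm_apply_sq_le_of_hsNormSq_le (effDim_nonneg hK hlam) hS (T (W c) + lam • W c)
  have h1 : W (T (W c) + lam • W c) = c := by
    rw [map_add, map_smul, ← resolventSqrt_comm hT hlam, ← hW, resolventSqrt_mul_self hT hlam,
      add_resolvent hT hlam]
  have h2 : ‖T (W c) + lam • W c‖ ^ 2 = ‖inclusion hK ν c‖ ^ 2 + lam * ‖c‖ ^ 2 := by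
    have h3 : T (W c) + lam • W c = W (T c + lam • c) := by
      rw [map_add, map_smul, resolventSqrt_comm hT hlam]
    rw [← real_inner_self_eq_norm_sq]
    nth_rewrite 1 [h3]
    rw [inner_resolventSqrt_left hT hlam, ← hW, h1, inner_add_left, inner_smul_left,
      inner_covariance_left, real_inner_self_eq_norm_sq, real_inner_self_eq_norm_sq]
    rfl
  rwa [ContinuousLinearMap.comp_apply, h1, h2] at h

end Covariance

/-! ### Concentration of the noise and of the empirical covariance -/

section Concentration

lemma one_le_log_four_div {η : ℝ} (hη : 0 < η) (hη1 : η < 1) : 1 ≤ Real.log (4 / η) := by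
  rw [Real.le_log_iff_exp_le (by positivity), le_div_iff₀ hη]
  nlinarith [Real.exp_one_lt_d9, Real.exp_pos 1]

/-- Bernstein's inequality in terms of an effective dimension. -/
lemma measure_norm_mean_gt_le_of_le {E : Type*} [NormedAddCommGroup E] [InnerProductSpace ℝ E]
    [CompleteSpace E] {Ω : Type*} [MeasurableSpace Ω] {μ : Measure Ω} [IsProbabilityMeasure μ]
    {X : Ω → E} (hX : StronglyMeasurable X) (hint : Integrable X μ)
    (hmean : ∫ ω, X ω ∂μ = 0) {t₁ v N : ℝ} (ht₁ : 0 < t₁) (hv : 0 ≤ v) (hN : 0 < N)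
    (hrem : ∀ t, 0 < t → t ≤ t₁ →
      ∫⁻ ω, ENNReal.ofReal (expRem (t * ‖X ω‖)) ∂μ ≤ ENNReal.ofReal (t ^ 2 * (v * N)))
    {m : ℕ} (hm : 0 < m) {η : ℝ} (hη : 0 < η) (hη1 : η < 1) :
    (Measure.pi fun _ : Fin m => μ)
        {z | (1 / (t₁ * m) + (1 + v) * √(N / m)) * Real.log (4 / η)
          < ‖(1 / (m : ℝ)) • ∑ i, X (z i)‖}
      ≤ ENNReal.ofReal (η / 2) := by
  have hm0 : (0 : ℝ) < m := by exact_mod_cast hm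
  have hlog := one_le_log_four_div hη hη1
  have hs : 0 < √(m * N) := Real.sqrt_pos.2 (by positivity)
  have hs2 : √(m * N) ^ 2 = m * N := Real.sq_sqrt (by positivity)
  have hNm : √(N / m) = √(m * N) / m := by
    rw [show N / m = m * N / (m : ℝ) ^ 2 by field_simp, Real.sqrt_div (by positivity),
      Real.sqrt_sq hm0.le]
  -- The unconstrained value balances `1/(t m)` against `t N`; leaving `v` out of it allows `v = 0`.
  set t := min t₁ (1 / √(m * N)) with ht
  have ht0 : 0 < t := lt_min ht₁ (by positivity)
  have h1 : 1 / (t * m) ≤ 1 / (t₁ * m) + √(N / m) := by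
    rw [hNm]
    rcases min_choice t₁ (1 / √(m * N)) with h | h
    · rw [ht, h]
      have : 0 ≤ √(m * N) / m := by positivity
      linarith
    · rw [ht, h]
      have : 0 ≤ 1 / (t₁ * m) := by positivity
      have h3 : 1 / (1 / √(m * N) * m) = √(m * N) / m := by field_simp
      linarith
  have h2 : t * (v * N) ≤ v * √(N / m) := by
    have h3 : t * (v * N) ≤ 1 / √(m * N) * (v * N) := by
      gcongr
      exact min_le_right _ _
    refine h3.trans (le_of_eq ?_)
    rw [hNm]
    field_simp
    rw [hs2]
  refine (measure_mono fun z hz => ?_).trans (measure_norm_mean_gt_le hX hint hmean ht0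
    (by positivity : 0 ≤ v * N) (hrem t ht0 (min_le_left _ _)) hm hη hη1)
  simp only [Set.mem_ofPred_eq] at hz ⊢
  refine lt_of_le_of_lt ?_ hz
  have h5 : 0 ≤ v * √(N / m) := by positivity
  calc Real.log (4 / η) / (t * m) + t * (v * N)
      = 1 / (t * m) * Real.log (4 / η) + t * (v * N) := by ring
    _ ≤ (1 / (t₁ * m) + √(N / m)) * Real.log (4 / η) + v * √(N / m) * Real.log (4 / η) := by
        refine add_le_add (by gcongr) (h2.trans ?_)
        exact le_mul_of_one_le_right h5 hlog
    _ = _ := by ring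

variable {X Y H' : Type*} [MeasurableSpace X]
  [NormedAddCommGroup Y] [InnerProductSpace ℝ Y] [CompleteSpace Y]
  [NormedAddCommGroup H'] [InnerProductSpace ℝ H'] [CompleteSpace H'] [RKHS ℝ H' X Y]
  [MeasurableSpace Y] [BorelSpace Y] [TopologicalSpace.SeparableSpace Y]
  {κ : ℝ} (hK : KernelCondition X Y H' κ)

lemma norm_preKernel_apply_sq_le {ν : Measure X} [IsProbabilityMeasure ν] {lam : ℝ}
    (hlam : 0 < lam) (x : X) (y : Y) :
    ‖preKernel hK ν lam x y‖ ^ 2 ≤ κ ^ 2 / lam * ‖y‖ ^ 2 :=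
  norm_apply_sq_le_of_hsNormSq_le (by positivity) (hsNormSq_preKernel_le hK hlam x) y

lemma norm_preKernel_apply_le {ν : Measure X} [IsProbabilityMeasure ν] {lam : ℝ}
    (hlam : 0 < lam) (x : X) (y : Y) :
    ‖preKernel hK ν lam x y‖ ≤ √(κ ^ 2 / lam) * ‖y‖ := by
  have h := Real.sqrt_le_sqrt (norm_preKernel_apply_sq_le (ν := ν) hK hlam x y)
  rwa [Real.sqrt_sq (norm_nonneg _), Real.sqrt_mul (by positivity), Real.sqrt_sq (norm_nonneg _)]
    at h

variable [TopologicalSpace.SeparableSpace H'] (ρ : Measure (X × Y)) [IsProbabilityMeasure ρ]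
  {lam : ℝ}

/-- The preconditioned noise `(T_ν + lam I) ^ (-1/2) K_x (y - g(x))`. -/
noncomputable def noiseVec (lam : ℝ) (g : H') (z : X × Y) : H' :=
  preKernel hK ρ.fst lam z.1 (z.2 - g z.1)

lemma stronglyMeasurable_residual (hK : KernelCondition X Y H' κ) (g : H') :
    StronglyMeasurable fun z : X × Y => z.2 - g z.1 :=
  measurable_snd.stronglyMeasurable.sub ((hK.stronglyMeasurable g).comp_measurable measurable_fst)

lemma integrable_residual (hK : KernelCondition X Y H' κ) (ρ : Measure (X × Y))
    [IsProbabilityMeasure ρ] (hmem : MemLp (fun z : X × Y => z.2) 2 ρ) (g : H') :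
    Integrable (fun z : X × Y => z.2 - g z.1) ρ := by
  refine (hmem.integrable one_le_two).sub ?_
  exact Integrable.of_bound
    ((hK.stronglyMeasurable g).comp_measurable measurable_fst).aestronglyMeasurable (κ * ‖g‖)
    (Eventually.of_forall fun z => hK.norm_apply_le g z.1)

lemma stronglyMeasurable_noiseVec (hlam : 0 < lam) (g : H') :
    StronglyMeasurable (noiseVec hK ρ lam g) := by
  refine stronglyMeasurable_of_inner fun w => ?_
  simp only [noiseVec, inner_preKernel hK hlam]
  exact ((stronglyMeasurable_residual hK g).inner
    ((hK.stronglyMeasurable _).comp_measurable measurable_fst)).measurable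

lemma integrable_noiseVec (hlam : 0 < lam) (hmem : MemLp (fun z : X × Y => z.2) 2 ρ) (g : H') :
    Integrable (noiseVec hK ρ lam g) ρ :=
  ((integrable_residual hK ρ hmem g).norm.const_mul (√(κ ^ 2 / lam))).mono'
    (stronglyMeasurable_noiseVec hK ρ hlam g).aestronglyMeasurable
    (Eventually.of_forall fun _ => norm_preKernel_apply_le hK hlam _ _)

/-- Against a fixed vector, the integral over `y` for given `x` already vanishes, since the residual
has zero conditional mean. -/
lemma integral_noiseVec (hlam : 0 < lam) (hmem : MemLp (fun z : X × Y => z.2) 2 ρ) {g : H'}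
    (hmean : ∀ᵐ x ∂ρ.fst, ∫ y, y ∂(ρ.condKernel x) = g x) :
    ∫ z, noiseVec hK ρ lam g z ∂ρ = 0 := by
  refine ext_inner_left ℝ fun w => ?_
  have hi := integrable_noiseVec hK ρ hlam hmem g
  rw [← integral_inner hi, inner_zero_right, ← Measure.integral_condKernel (hi.const_inner w)]
  refine integral_eq_zero_of_ae ?_
  filter_upwards [hmean, (hmem.integrable one_le_two).condKernel_ae] with x hx hxi
  simp only [noiseVec, real_inner_comm _ w]
  simp only [inner_preKernel hK hlam, Pi.zero_apply]
  simp only [real_inner_comm _ (_ - g x)]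
  have hsub : Integrable (fun y : Y => y - g x) (ρ.condKernel x) :=
    hxi.sub (integrable_const _)
  rw [integral_inner hsub, integral_sub hxi (integrable_const _), hx]
  simp

lemma lintegral_expRem_noiseVec_le (hlam : 0 < lam) {g : H'} {M S : ℝ} (hM : 0 < M)
    (hnoise : ∀ᵐ x ∂ρ.fst, ∫⁻ y, ENNReal.ofReal (expRem (‖y - g x‖ / M)) ∂(ρ.condKernel x)
      ≤ ENNReal.ofReal (S ^ 2 / (2 * M ^ 2)))
    {t : ℝ} (ht : 0 < t) (ht1 : (t * M) ^ 2 * (κ ^ 2 / lam) ≤ 1) :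
    ∫⁻ z, ENNReal.ofReal (expRem (t * ‖noiseVec hK ρ lam g z‖)) ∂ρ
      ≤ ENNReal.ofReal (t ^ 2 * (S ^ 2 / 2 * effDim hK ρ.fst lam)) := by
  set D : X → ℝ := fun x => (hsNormSq (preKernel hK ρ.fst lam x)).toReal with hD
  have hD0 : ∀ x, 0 ≤ D x := fun x => ENNReal.toReal_nonneg
  have hDtop : ∀ x, ENNReal.ofReal (D x) = hsNormSq (preKernel hK ρ.fst lam x) := fun x =>
    ENNReal.ofReal_toReal (hsNormSq_preKernel_ne_top hK hlam x)
  have hDle : ∀ x, D x ≤ κ ^ 2 / lam := fun x =>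
    ENNReal.toReal_le_of_le_ofReal (by positivity) (hsNormSq_preKernel_le hK hlam x)
  -- Quadratic scaling of `expRem` pulls out `D x`, the squared Hilbert–Schmidt norm of the
  -- preconditioned kernel section. Integrating over `y` uses the noise condition, and integrating
  -- `D` over `x` produces the effective dimension.
  have hpt : ∀ x y, expRem (t * ‖noiseVec hK ρ lam g (x, y)‖)
      ≤ (t * M) ^ 2 * D x * expRem (‖y - g x‖ / M) := by
    intro x y
    have h1 : ‖noiseVec hK ρ lam g (x, y)‖ ≤ √(D x) * ‖y - g x‖ := by
      have h := Real.sqrt_le_sqrt (norm_apply_sq_le_hsNormSq_toReal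
        (hsNormSq_preKernel_ne_top (ν := ρ.fst) hK hlam x) (y - g x))
      rwa [Real.sqrt_sq (norm_nonneg _), Real.sqrt_mul (hD0 x), Real.sqrt_sq (norm_nonneg _)] at h
    have h2 : t * ‖noiseVec hK ρ lam g (x, y)‖ ≤ t * M * √(D x) * (‖y - g x‖ / M) := by
      calc _ ≤ t * (√(D x) * ‖y - g x‖) := by gcongr
        _ = _ := by field_simp
    have h3 : (t * M * √(D x)) ^ 2 = (t * M) ^ 2 * D x := by
      rw [mul_pow, Real.sq_sqrt (hD0 x)]
    have h4 : t * M * √(D x) ≤ 1 := by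
      refine (sq_le_one_iff₀ (by positivity)).1 ?_
      rw [h3]
      exact le_trans (by gcongr; exact hDle x) ht1
    rw [← h3]
    exact (expRem_mono (by positivity) h2).trans (expRem_mul_le (by positivity) h4 (by positivity))
  have hmeas : Measurable fun z : X × Y => ENNReal.ofReal (expRem (t * ‖noiseVec hK ρ lam g z‖)) :=
    (continuous_expRem.measurable.comp
      ((stronglyMeasurable_noiseVec hK ρ hlam g).norm.measurable.const_mul t)).ennreal_ofReal
  rw [← Measure.lintegral_condKernel hmeas]
  calc _ ≤ ∫⁻ x, ENNReal.ofReal ((t * M) ^ 2 * (S ^ 2 / (2 * M ^ 2)))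
            * hsNormSq (preKernel hK ρ.fst lam x) ∂ρ.fst := by
        refine lintegral_mono_ae ?_
        filter_upwards [hnoise] with x hx
        calc _ ≤ ∫⁻ y, ENNReal.ofReal ((t * M) ^ 2 * D x)
                * ENNReal.ofReal (expRem (‖y - g x‖ / M)) ∂(ρ.condKernel x) := by
              refine lintegral_mono fun y => ?_
              have := hD0 x
              rw [← ENNReal.ofReal_mul (by positivity)]
              exact ENNReal.ofReal_le_ofReal (hpt x y)
          _ ≤ ENNReal.ofReal ((t * M) ^ 2 * D x) * ENNReal.ofReal (S ^ 2 / (2 * M ^ 2)) := by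
              rw [lintegral_const_mul' _ _ ENNReal.ofReal_ne_top]
              gcongr
          _ = _ := by
              rw [← hDtop, ← ENNReal.ofReal_mul (mul_nonneg (by positivity) (hD0 x)),
                ← ENNReal.ofReal_mul (by positivity)]
              congr 1
              ring
    _ = _ := by
        rw [lintegral_const_mul' _ _ ENNReal.ofReal_ne_top, lintegral_hsNormSq_preKernel hK hlam,
          ← ENNReal.ofReal_mul (by positivity)]
        congr 1
        field_simp

lemma measure_norm_noise_gt_le (hlam : 0 < lam) (hκ : 0 < κ)
    (hmem : MemLp (fun z : X × Y => z.2) 2 ρ) {g : H'}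
    (hmean : ∀ᵐ x ∂ρ.fst, ∫ y, y ∂(ρ.condKernel x) = g x) {M S : ℝ} (hM : 0 < M)
    (hnoise : ∀ᵐ x ∂ρ.fst, ∫⁻ y, ENNReal.ofReal (expRem (‖y - g x‖ / M)) ∂(ρ.condKernel x)
      ≤ ENNReal.ofReal (S ^ 2 / (2 * M ^ 2)))
    (hN : 0 < effDim hK ρ.fst lam) {m : ℕ} (hm : 0 < m) {η : ℝ} (hη : 0 < η) (hη1 : η < 1) :
    (Measure.pi fun _ : Fin m => ρ)
        {z | (1 / (√lam / (κ * M) * m) + (1 + S ^ 2 / 2) * √(effDim hK ρ.fst lam / m))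
            * Real.log (4 / η)
          < ‖(1 / (m : ℝ)) • ∑ i, noiseVec hK ρ lam g (z i)‖}
      ≤ ENNReal.ofReal (η / 2) := by
  have hsl : 0 < √lam := Real.sqrt_pos.2 hlam
  refine measure_norm_mean_gt_le_of_le (stronglyMeasurable_noiseVec hK ρ hlam g)
    (integrable_noiseVec hK ρ hlam hmem g) (integral_noiseVec hK ρ hlam hmem hmean)
    (by positivity) (by positivity) hN (fun t ht ht1 => ?_) hm hη hη1
  refine lintegral_expRem_noiseVec_le hK ρ hlam hM hnoise ht ?_
  rw [le_div_iff₀ (by positivity)] at ht1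
  have h : (t * (κ * M)) ^ 2 ≤ lam := by
    rw [← Real.sq_sqrt hlam.le]
    gcongr
  rw [← mul_div_assoc, div_le_one hlam]
  calc _ = (t * (κ * M)) ^ 2 := by ring
    _ ≤ _ := h

/-! The random operators `(T_ν + lam I) ^ (-1/2) K_x K_x*`. -/

lemma hsNormSq_preKernel_adjoint_le {ν : Measure X} [IsProbabilityMeasure ν] (hlam : 0 < lam)
    (x : X) : hsNormSq (preKernel hK ν lam x ∘L (RKHS.kerFun H' x).adjoint)
      ≤ ENNReal.ofReal (κ ^ 2) * hsNormSq (preKernel hK ν lam x) := by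
  have htop := hsNormSq_preKernel_ne_top (ν := ν) hK hlam x
  refine (hsNormSq_comp_le ENNReal.toReal_nonneg (norm_apply_sq_le_hsNormSq_toReal htop) _).trans ?_
  rw [ENNReal.ofReal_toReal htop, hsNormSq_adjoint, mul_comm]
  gcongr
  exact hK.hilbertSchmidt x

lemma hsNormSq_preKernel_adjoint_ne_top {ν : Measure X} [IsProbabilityMeasure ν] (hlam : 0 < lam)
    (x : X) : hsNormSq (preKernel hK ν lam x ∘L (RKHS.kerFun H' x).adjoint) ≠ ∞ :=
  ne_top_of_le_ne_top (ENNReal.mul_ne_top ENNReal.ofReal_ne_top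
    (hsNormSq_preKernel_ne_top hK hlam x)) (hsNormSq_preKernel_adjoint_le hK hlam x)

/-- The random Hilbert–Schmidt operator `(T_ν + lam I) ^ (-1/2) K_x K_x*`. -/
noncomputable def opVec (ν : Measure X) [IsProbabilityMeasure ν] (hlam : 0 < lam) (x : X) :
    lp (fun _ : basisIndex H' => H') 2 :=
  hsVec _ (hsNormSq_preKernel_adjoint_ne_top (ν := ν) hK hlam x)

variable (ν : Measure X) [IsProbabilityMeasure ν]

lemma opVec_apply (hlam : 0 < lam) (x : X) (i : basisIndex H') :
    opVec hK ν hlam x i = preKernel hK ν lam x ((basis H' i : H') x) := by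
  rw [opVec, hsVec_apply, ContinuousLinearMap.comp_apply, RKHS.adjoint_kerFun]

lemma stronglyMeasurable_opVec (hlam : 0 < lam) : StronglyMeasurable (opVec hK ν hlam) := by
  refine stronglyMeasurable_lp fun i => stronglyMeasurable_of_inner fun w => ?_
  simp only [opVec_apply, inner_preKernel hK hlam]
  exact ((hK.stronglyMeasurable _).inner (hK.stronglyMeasurable _)).measurable

lemma ofReal_norm_opVec_sq_le (hlam : 0 < lam) (x : X) :
    ENNReal.ofReal (‖opVec hK ν hlam x‖ ^ 2)
      ≤ ENNReal.ofReal (κ ^ 2) * hsNormSq (preKernel hK ν lam x) := by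
  rw [opVec, ofReal_norm_hsVec_sq]
  exact hsNormSq_preKernel_adjoint_le hK hlam x

lemma norm_opVec_le (hlam : 0 < lam) (x : X) : ‖opVec hK ν hlam x‖ ≤ κ ^ 2 / √lam := by
  have h := ofReal_norm_opVec_sq_le hK ν hlam x
  have h2 : ENNReal.ofReal (‖opVec hK ν hlam x‖ ^ 2)
      ≤ ENNReal.ofReal (κ ^ 2 * (κ ^ 2 / lam)) := by
    rw [ENNReal.ofReal_mul (by positivity)]
    refine h.trans ?_
    gcongr
    exact hsNormSq_preKernel_le hK hlam x
  rw [ENNReal.ofReal_le_ofReal_iff (by positivity)] at h2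
  refine (sq_le_sq₀ (norm_nonneg _) (by positivity)).1 (h2.trans (le_of_eq ?_))
  rw [div_pow, Real.sq_sqrt hlam.le]
  ring

lemma integrable_opVec (hlam : 0 < lam) : Integrable (opVec hK ν hlam) ν :=
  Integrable.of_bound (stronglyMeasurable_opVec hK ν hlam).aestronglyMeasurable _
    (Eventually.of_forall (norm_opVec_le hK ν hlam))

lemma integral_norm_opVec_sq_le (hlam : 0 < lam) :
    ∫ x, ‖opVec hK ν hlam x‖ ^ 2 ∂ν ≤ κ ^ 2 * effDim hK ν lam := by
  rw [integral_eq_lintegral_of_nonneg_ae (Eventually.of_forall fun x => sq_nonneg _)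
    ((stronglyMeasurable_opVec hK ν hlam).norm.pow 2).aestronglyMeasurable]
  refine ENNReal.toReal_le_of_le_ofReal (mul_nonneg (sq_nonneg _) (effDim_nonneg hK hlam)) ?_
  calc _ ≤ ∫⁻ x, ENNReal.ofReal (κ ^ 2) * hsNormSq (preKernel hK ν lam x) ∂ν :=
        lintegral_mono fun x => ofReal_norm_opVec_sq_le hK ν hlam x
    _ = _ := by
        rw [lintegral_const_mul' _ _ ENNReal.ofReal_ne_top, lintegral_hsNormSq_preKernel hK hlam,
          ← ENNReal.ofReal_mul (by positivity)]

/-- The mean operator is `(T_ν + lam)^(-1/2) T_ν`: coordinates commute with the Bochner integral,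
and weakly the integrand is an inner product in `L²`. -/
lemma integral_opVec_apply (hlam : 0 < lam) (i : basisIndex H') :
    (∫ x, opVec hK ν hlam x ∂ν : lp (fun _ : basisIndex H' => H') 2) i
      = resolventSqrt (covariance hK ν) lam (covariance hK ν (basis H' i)) := by
  have h := (lp.evalCLM ℝ (fun _ : basisIndex H' => H') 2 i).integral_comp_comm
    (integrable_opVec hK ν hlam)
  change ∫ x, opVec hK ν hlam x i ∂ν = (∫ x, opVec hK ν hlam x ∂ν :
    lp (fun _ : basisIndex H' => H') 2) i at h
  have hi : Integrable (fun x => opVec hK ν hlam x i) ν :=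
    (lp.evalCLM ℝ (fun _ : basisIndex H' => H') 2 i).integrable_comp (integrable_opVec hK ν hlam)
  rw [← h]
  refine ext_inner_left ℝ fun w => ?_
  rw [← integral_inner hi, ← inner_resolventSqrt_left (covariance_isPositive hK ν) hlam,
    real_inner_comm, inner_covariance_left, inner_inclusion]
  refine integral_congr_ae (Eventually.of_forall fun x => ?_)
  simp only [opVec_apply]
  rw [real_inner_comm, inner_preKernel hK hlam]

/-- The centred random operator. -/
noncomputable def opVecCentred (hlam : 0 < lam) (x : X) : lp (fun _ : basisIndex H' => H') 2 :=
  opVec hK ν hlam x - ∫ x', opVec hK ν hlam x' ∂ν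

lemma stronglyMeasurable_opVecCentred (hlam : 0 < lam) :
    StronglyMeasurable (opVecCentred hK ν hlam) :=
  (stronglyMeasurable_opVec hK ν hlam).sub stronglyMeasurable_const

lemma norm_opVecCentred_le (hlam : 0 < lam) (x : X) :
    ‖opVecCentred hK ν hlam x‖ ≤ 2 * κ ^ 2 / √lam := by
  have h := norm_integral_le_of_norm_le_const (μ := ν)
    (Eventually.of_forall (norm_opVec_le hK ν hlam))
  rw [probReal_univ, mul_one] at h
  refine (norm_sub_le _ _).trans ((add_le_add (norm_opVec_le hK ν hlam x) h).trans (le_of_eq ?_))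
  ring

/-- Centring subtracts the squared norm of the mean from the second moment, so the uncentred bound
survives. -/
lemma integral_norm_opVecCentred_sq_le (hlam : 0 < lam) :
    ∫ x, ‖opVecCentred hK ν hlam x‖ ^ 2 ∂ν ≤ κ ^ 2 * effDim hK ν lam := by
  set U := ∫ x', opVec hK ν hlam x' ∂ν with hU
  have hi := integrable_opVec hK ν hlam
  have hi2 : Integrable (fun x => ‖opVec hK ν hlam x‖ ^ 2) ν :=
    Integrable.of_bound ((stronglyMeasurable_opVec hK ν hlam).norm.pow 2).aestronglyMeasurable
      ((κ ^ 2 / √lam) ^ 2) (Eventually.of_forall fun x => by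
        rw [norm_pow, norm_norm]
        have := norm_opVec_le hK ν hlam x
        gcongr)
  have h : ∫ x, ‖opVecCentred hK ν hlam x‖ ^ 2 ∂ν
      = ∫ x, ‖opVec hK ν hlam x‖ ^ 2 ∂ν - ‖U‖ ^ 2 := by
    have h1 : ∀ x, ‖opVecCentred hK ν hlam x‖ ^ 2
        = ‖opVec hK ν hlam x‖ ^ 2 - 2 * ⟪U, opVec hK ν hlam x⟫_ℝ + ‖U‖ ^ 2 := fun x => by
      rw [opVecCentred, @norm_sub_sq_real, real_inner_comm]
    have hin : Integrable (fun x => 2 * ⟪U, opVec hK ν hlam x⟫_ℝ) ν :=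
      (hi.const_inner U).const_mul 2
    have hsub : Integrable (fun x => ‖opVec hK ν hlam x‖ ^ 2 - 2 * ⟪U, opVec hK ν hlam x⟫_ℝ) ν :=
      hi2.sub hin
    simp_rw [h1]
    rw [integral_add hsub (integrable_const _), integral_sub hi2 hin, integral_const_mul,
      integral_inner hi, ← hU, real_inner_self_eq_norm_sq]
    simp
    ring
  rw [h]
  have := integral_norm_opVec_sq_le hK ν hlam
  have := sq_nonneg ‖U‖
  linarith

lemma measure_norm_opVecCentred_gt_le (hlam : 0 < lam) (hκ : 0 < κ)
    (hN : 0 < effDim hK ρ.fst lam) {m : ℕ} (hm : 0 < m) {η : ℝ} (hη : 0 < η) (hη1 : η < 1) :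
    (Measure.pi fun _ : Fin m => ρ)
        {z | (1 / (√lam / (2 * κ ^ 2) * m) + (1 + κ ^ 2) * √(effDim hK ρ.fst lam / m))
            * Real.log (4 / η)
          < ‖(1 / (m : ℝ)) • ∑ i, opVecCentred hK ρ.fst hlam (z i).1‖}
      ≤ ENNReal.ofReal (η / 2) := by
  have hsl : 0 < √lam := Real.sqrt_pos.2 hlam
  have hmp : MeasurePreserving (Prod.fst : X × Y → X) ρ ρ.fst := ⟨measurable_fst, rfl⟩
  have hsm := stronglyMeasurable_opVecCentred hK ρ.fst hlam
  have hint : Integrable (opVecCentred hK ρ.fst hlam) ρ.fst :=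
    (integrable_opVec hK ρ.fst hlam).sub (integrable_const _)
  refine measure_norm_mean_gt_le_of_le (X := fun z : X × Y => opVecCentred hK ρ.fst hlam z.1)
    (hsm.comp_measurable measurable_fst) (hmp.integrable_comp_of_integrable hint) ?_
    (by positivity) (by positivity) hN (fun t ht ht1 => ?_) hm hη hη1
  · have h : ∫ x, opVecCentred hK ρ.fst hlam x ∂ρ.fst = 0 := by
      simp only [opVecCentred]
      rw [integral_sub (integrable_opVec hK ρ.fst hlam) (integrable_const _)]
      simp
    exact (integral_map (μ := ρ) (f := opVecCentred hK ρ.fst hlam)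
      measurable_fst.aemeasurable hsm.aestronglyMeasurable).symm.trans h
  -- The range of `t` is chosen for this bound: below `1` the remainder is at most the square, and
  -- only the variance matters.
  · have hle : ∀ x, t * ‖opVecCentred hK ρ.fst hlam x‖ ≤ 1 := fun x => by
      calc _ ≤ √lam / (2 * κ ^ 2) * (2 * κ ^ 2 / √lam) := by
            gcongr
            exact norm_opVecCentred_le hK ρ.fst hlam x
        _ = 1 := by field_simp
    have hi2 : Integrable (fun x => ‖opVecCentred hK ρ.fst hlam x‖ ^ 2) ρ.fst :=
      Integrable.of_bound (hsm.norm.pow 2).aestronglyMeasurable ((2 * κ ^ 2 / √lam) ^ 2)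
        (Eventually.of_forall fun x => by
          rw [norm_pow, norm_norm]
          have := norm_opVecCentred_le hK ρ.fst hlam x
          gcongr)
    calc _ ≤ ∫⁻ z : X × Y, ENNReal.ofReal (t ^ 2 * ‖opVecCentred hK ρ.fst hlam z.1‖ ^ 2) ∂ρ := by
          refine lintegral_mono fun z => ENNReal.ofReal_le_ofReal ?_
          rw [← mul_pow]
          exact expRem_le_sq (by positivity) (hle z.1)
      _ = ∫⁻ x, ENNReal.ofReal (t ^ 2 * ‖opVecCentred hK ρ.fst hlam x‖ ^ 2) ∂ρ.fst :=
          hmp.lintegral_comp ((hsm.norm.measurable.pow_const 2).const_mul _).ennreal_ofReal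
      _ = ENNReal.ofReal (t ^ 2 * ∫ x, ‖opVecCentred hK ρ.fst hlam x‖ ^ 2 ∂ρ.fst) := by
          rw [← integral_const_mul, ofReal_integral_eq_lintegral_ofReal (hi2.const_mul _)
            (Eventually.of_forall fun x => by positivity)]
      _ ≤ _ := by
          refine ENNReal.ofReal_le_ofReal ?_
          gcongr
          exact integral_norm_opVecCentred_sq_le hK ρ.fst hlam

end Concentration

/-! ### The good event -/

section GoodEvent

variable {X Y H' : Type*} [MeasurableSpace X]
  [NormedAddCommGroup Y] [InnerProductSpace ℝ Y] [CompleteSpace Y]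
  [NormedAddCommGroup H'] [InnerProductSpace ℝ H'] [CompleteSpace H'] [RKHS ℝ H' X Y]
  [MeasurableSpace Y] [BorelSpace Y] [TopologicalSpace.SeparableSpace Y]
  {κ : ℝ} (hK : KernelCondition X Y H' κ)

/-- The norm `‖(T_ν + lam I) ^ (1/2) c‖`. -/
noncomputable def weightedNorm (ν : Measure X) [IsProbabilityMeasure ν] (lam : ℝ) (c : H') : ℝ :=
  √(‖inclusion hK ν c‖ ^ 2 + lam * ‖c‖ ^ 2)

/-- The sample controls the noise with level `δ₁` and the empirical covariance with level `δ₂`. -/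
structure GoodSample (ν : Measure X) [IsProbabilityMeasure ν] (lam : ℝ) (g : H') (δ₁ δ₂ : ℝ)
    {m : ℕ} (z : Fin m → X × Y) : Prop where
  noise : ∀ c : H', (1 / (m : ℝ)) * ∑ i, ⟪c (z i).1, (z i).2 - g (z i).1⟫_ℝ
    ≤ weightedNorm hK ν lam c * δ₁
  covariance : ∀ c h : H', ⟪inclusion hK ν c, inclusion hK ν h⟫_ℝ
      - (1 / (m : ℝ)) * ∑ i, ⟪c (z i).1, h (z i).1⟫_ℝ
    ≤ weightedNorm hK ν lam c * (δ₂ * ‖h‖)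

lemma inner_le_weightedNorm (ν : Measure X) [IsProbabilityMeasure ν] {lam : ℝ} (hlam : 0 < lam)
    (c e : H') : ⟪c, e⟫_ℝ
      ≤ weightedNorm hK ν lam c * ‖resolventSqrt (covariance hK ν) lam e‖ := by
  have h := abs_inner_le_resolventSqrt (covariance_isPositive hK ν) hlam c e
  rwa [inner_covariance_left, real_inner_self_eq_norm_sq] at h

lemma weightedNorm_le (ν : Measure X) [IsProbabilityMeasure ν] {lam : ℝ} (hlam : 0 ≤ lam)
    (c : H') : weightedNorm hK ν lam c ≤ ‖inclusion hK ν c‖ + √lam * ‖c‖ := by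
  rw [weightedNorm]
  refine Real.sqrt_le_iff.2 ⟨by positivity, ?_⟩
  have h : (√lam * ‖c‖) ^ 2 = lam * ‖c‖ ^ 2 := by rw [mul_pow, Real.sq_sqrt hlam]
  have h2 : 0 ≤ ‖inclusion hK ν c‖ * (√lam * ‖c‖) := by positivity
  nlinarith

variable [TopologicalSpace.SeparableSpace H'] (ρ : Measure (X × Y)) [IsProbabilityMeasure ρ]
  {lam : ℝ}

/-- The reproducing property moves point evaluations onto kernel sections, so each expression
becomes an inner product of `c` with a single random vector. Weighted Cauchy–Schwarz then makes the
bound uniform in `c` and `h`. -/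
lemma goodSample_of_norm_le (hlam : 0 < lam) (g : H') {δ₁ δ₂ : ℝ} {m : ℕ} (hm : 0 < m)
    {z : Fin m → X × Y}
    (h1 : ‖(1 / (m : ℝ)) • ∑ i, noiseVec hK ρ lam g (z i)‖ ≤ δ₁)
    (h2 : ‖(1 / (m : ℝ)) • ∑ i, opVecCentred hK ρ.fst hlam (z i).1‖ ≤ δ₂) :
    GoodSample hK ρ.fst lam g δ₁ δ₂ z := by
  have hm0 : (m : ℝ) ≠ 0 := by exact_mod_cast hm.ne'
  set W := resolventSqrt (HilbertScale.covariance hK ρ.fst) lam with hW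
  refine ⟨fun c => ?_, fun c h => ?_⟩
  · have h3 : (1 / (m : ℝ)) * ∑ i, ⟪c (z i).1, (z i).2 - g (z i).1⟫_ℝ
        = ⟪c, (1 / (m : ℝ)) • ∑ i, RKHS.kerFun H' (z i).1 ((z i).2 - g (z i).1)⟫_ℝ := by
      rw [inner_smul_right, inner_sum]
      simp only [RKHS.inner_kerFun]
    rw [h3]
    refine (inner_le_weightedNorm hK ρ.fst hlam _ _).trans
      (mul_le_mul_of_nonneg_left ?_ (Real.sqrt_nonneg _))
    rw [map_smul, map_sum]
    exact h1
  · set S : H' →L[ℝ] H' := W ∘L (HilbertScale.covariance hK ρ.fst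
      - (1 / (m : ℝ)) • ∑ i, RKHS.kerFun H' (z i).1 ∘L (RKHS.kerFun H' (z i).1).adjoint) with hS
    have hSh : ∀ h, S h = W (HilbertScale.covariance hK ρ.fst h
        - (1 / (m : ℝ)) • ∑ i, RKHS.kerFun H' (z i).1 (h (z i).1)) := by
      intro h
      simp [hS]
    have h3 : ⟪inclusion hK ρ.fst c, inclusion hK ρ.fst h⟫_ℝ
        - (1 / (m : ℝ)) * ∑ i, ⟪c (z i).1, h (z i).1⟫_ℝ
        = ⟪c, HilbertScale.covariance hK ρ.fst h
            - (1 / (m : ℝ)) • ∑ i, RKHS.kerFun H' (z i).1 (h (z i).1)⟫_ℝ := by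
      rw [inner_sub_right, inner_smul_right, inner_sum, ← inner_covariance_left,
        (covariance_isPositive hK ρ.fst).inner_left_eq_inner_right]
      simp only [RKHS.inner_kerFun]
    rw [h3]
    refine (inner_le_weightedNorm hK ρ.fst hlam _ _).trans
      (mul_le_mul_of_nonneg_left ?_ (Real.sqrt_nonneg _))
    rw [← hW, ← hSh]
    -- The sign appears because `S` is population minus sample covariance, while the centred mean is
    -- sample minus population.
    have hf : ∀ i, (-((1 / (m : ℝ)) • ∑ i, opVecCentred hK ρ.fst hlam (z i).1) :
        lp (fun _ : basisIndex H' => H') 2) i = S (basis H' i) := by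
      intro j
      rw [hSh, map_sub, map_smul, map_sum]
      simp only [lp.coeFn_neg, lp.coeFn_smul, lp.coeFn_sum, Pi.neg_apply, Pi.smul_apply,
        Finset.sum_apply, opVecCentred, lp.coeFn_sub, Pi.sub_apply, opVec_apply,
        integral_opVec_apply hK ρ.fst hlam]
      rw [Finset.sum_sub_distrib, Finset.sum_const, Finset.card_univ, Fintype.card_fin, smul_sub,
        ← Nat.cast_smul_eq_nsmul ℝ, smul_smul, one_div_mul_cancel hm0, one_smul, neg_sub]
      rfl
    refine (norm_apply_le_norm_lp hf h).trans ?_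
    rw [norm_neg]
    gcongr

lemma measure_not_goodSample_le (hlam : 0 < lam) (hκ : 0 < κ)
    (hmem : MemLp (fun z : X × Y => z.2) 2 ρ) {g : H'}
    (hmean : ∀ᵐ x ∂ρ.fst, ∫ y, y ∂(ρ.condKernel x) = g x) {M S : ℝ} (hM : 0 < M)
    (hnoise : ∀ᵐ x ∂ρ.fst, ∫⁻ y, ENNReal.ofReal (expRem (‖y - g x‖ / M)) ∂(ρ.condKernel x)
      ≤ ENNReal.ofReal (S ^ 2 / (2 * M ^ 2)))
    (hN : 0 < effDim hK ρ.fst lam) {m : ℕ} (hm : 0 < m) {η : ℝ} (hη : 0 < η) (hη1 : η < 1)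
    {δ₁ δ₂ : ℝ}
    (h₁ : (1 / (√lam / (κ * M) * m) + (1 + S ^ 2 / 2) * √(effDim hK ρ.fst lam / m))
      * Real.log (4 / η) ≤ δ₁)
    (h₂ : (1 / (√lam / (2 * κ ^ 2) * m) + (1 + κ ^ 2) * √(effDim hK ρ.fst lam / m))
      * Real.log (4 / η) ≤ δ₂) :
    (Measure.pi fun _ : Fin m => ρ) {z | ¬ GoodSample hK ρ.fst lam g δ₁ δ₂ z}
      ≤ ENNReal.ofReal η := by
  calc _ ≤ _ := measure_mono (fun z hz => ?_)
    _ ≤ _ := measure_union_le _ _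
    _ ≤ _ := add_le_add
      (measure_norm_noise_gt_le hK ρ hlam hκ hmem hmean hM hnoise hN hm hη hη1)
      (measure_norm_opVecCentred_gt_le hK ρ hlam hκ hN hm hη hη1)
    _ = ENNReal.ofReal η := by
      rw [← ENNReal.ofReal_add (by positivity) (by positivity), add_halves]
  by_contra hc
  simp only [Set.mem_union, Set.mem_ofPred_eq, not_or, not_lt] at hc
  exact hz (goodSample_of_norm_le hK ρ hlam g hm (hc.1.trans h₁) (hc.2.trans h₂))

end GoodEvent

/-! ### The energy inequality for Tikhonov minimizers -/

section Energy

variable {X Y H H' : Type*} [MeasurableSpace X]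
  [NormedAddCommGroup Y] [InnerProductSpace ℝ Y] [CompleteSpace Y]
  [NormedAddCommGroup H] [InnerProductSpace ℝ H] [CompleteSpace H]
  [NormedAddCommGroup H'] [InnerProductSpace ℝ H'] [CompleteSpace H'] [RKHS ℝ H' X Y]
  [MeasurableSpace Y] [BorelSpace Y] [TopologicalSpace.SeparableSpace Y]
  {κ : ℝ} (hK : KernelCondition X Y H' κ) {ν : Measure X} [IsProbabilityMeasure ν]

/-- Comparison of a Tikhonov minimizer with another admissible element. -/
lemma energy_inequality {A : H → H'} {L : H →ₗ.[ℝ] H} {fhat : H} {fbar f g : L.domain}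
    {lam ℓ₁ δ₁ δ₂ : ℝ} (hδ₂ : 0 ≤ δ₂) {m : ℕ} {z : Fin m → X × Y}
    (hz : GoodSample hK ν lam (A fhat) δ₁ δ₂ z)
    (hmin : tikhonov A L fbar lam z f ≤ tikhonov A L fbar lam z g)
    (hℓ₁ : ‖A f - (2 : ℝ) • A fhat + A g‖ ≤ ℓ₁) :
    ‖inclusion hK ν (A f - A fhat)‖ ^ 2 + lam * ‖L (f - g)‖ ^ 2
      ≤ ‖inclusion hK ν (A g - A fhat)‖ ^ 2 - 2 * lam * ⟪L (g - fbar), L (f - g)⟫_ℝ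
        + weightedNorm hK ν lam (A f - A g) * (ℓ₁ * δ₂ + 2 * δ₁) := by
  set c := A f - A g with hc
  set e := A f - (2 : ℝ) • A fhat + A g with he
  have hca : c = (A f - A fhat) - (A g - A fhat) := by rw [hc]; abel
  have hea : e = (A f - A fhat) + (A g - A fhat) := by rw [he, two_smul]; abel
  have hI : ⟪inclusion hK ν c, inclusion hK ν e⟫_ℝ
      = ‖inclusion hK ν (A f - A fhat)‖ ^ 2 - ‖inclusion hK ν (A g - A fhat)‖ ^ 2 := by
    rw [hca, hea, map_sub, map_add, inner_sub_left, inner_add_right, inner_add_right,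
      real_inner_self_eq_norm_sq, real_inner_self_eq_norm_sq, real_inner_comm]
    ring
  -- The difference of squares factors as difference times sum, and the sum equals `e - 2ε`. Thus
  -- only the symmetric combination `e`, bounded by `ℓ₁`, meets the covariance deviation.
  have hpt : ∀ i, ‖A f (z i).1 - (z i).2‖ ^ 2 - ‖A g (z i).1 - (z i).2‖ ^ 2
      = ⟪c (z i).1, e (z i).1⟫_ℝ - 2 * ⟪c (z i).1, (z i).2 - A fhat (z i).1⟫_ℝ := by
    intro i
    have hcx : c (z i).1 = (A f (z i).1 - (z i).2) - (A g (z i).1 - (z i).2) := by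
      rw [hc, RKHS.coe_sub, Pi.sub_apply]; abel
    have hex : e (z i).1 - (2 : ℝ) • ((z i).2 - A fhat (z i).1)
        = (A f (z i).1 - (z i).2) + (A g (z i).1 - (z i).2) := by
      rw [he, RKHS.coe_add, RKHS.coe_sub, RKHS.coe_smul, Pi.add_apply, Pi.sub_apply, Pi.smul_apply,
        two_smul, two_smul]
      abel
    rw [← real_inner_smul_right, ← inner_sub_right, hex, hcx, inner_sub_left, inner_add_right,
      inner_add_right, real_inner_self_eq_norm_sq, real_inner_self_eq_norm_sq,
      real_inner_comm (A f (z i).1 - (z i).2)]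
    ring
  have hsum : (1 / (m : ℝ)) * ∑ i, ‖A f (z i).1 - (z i).2‖ ^ 2
        - (1 / (m : ℝ)) * ∑ i, ‖A g (z i).1 - (z i).2‖ ^ 2
      = (1 / (m : ℝ)) * ∑ i, ⟪c (z i).1, e (z i).1⟫_ℝ
        - 2 * ((1 / (m : ℝ)) * ∑ i, ⟪c (z i).1, (z i).2 - A fhat (z i).1⟫_ℝ) := by
    rw [← mul_sub, ← Finset.sum_sub_distrib, Finset.sum_congr rfl fun i _ => hpt i,
      Finset.sum_sub_distrib, ← Finset.mul_sum]
    ring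
  have hL : ‖L (f - fbar)‖ ^ 2
      = ‖L (g - fbar)‖ ^ 2 + 2 * ⟪L (g - fbar), L (f - g)⟫_ℝ + ‖L (f - g)‖ ^ 2 := by
    rw [← @norm_add_sq_real, ← LinearPMap.map_add]
    congr 3
    abel
  have h1 := hz.noise c
  have h2 := hz.covariance c e
  have h3 : weightedNorm hK ν lam c * (δ₂ * ‖e‖) ≤ weightedNorm hK ν lam c * (δ₂ * ℓ₁) := by
    have : 0 ≤ weightedNorm hK ν lam c := Real.sqrt_nonneg _
    gcongr
  rw [hI] at h2
  simp only [tikhonov] at hmin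
  rw [hL] at hmin
  linarith

end Energy

/-! ### Elementary inequalities for the error terms -/

section RealInequalities

/-- The constant in the bound for the normalized error terms. -/
noncomputable def errorConst (a s γ l Kb Kδ Kσ : ℝ) : ℝ :=
  2 * (1 + Kb ^ 2 + Kσ + a * Kb ^ (s * γ) + (1 + Kb + l) * Kδ)

/-- For `Z = max 1 (max ξ t)` the left side is at least `Z² - 1`. By `hσ` the superlinear term takes
at most `Z²/2`, and what remains is bounded by a multiple of `Z Λ`; dividing by `Z` gives a bound
linear in `Λ`. Absorbing `Z²/2` explains the factor `2` in `errorConst`. -/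
lemma normalized_error_le {ξ t b l Kb Kδ Kσ Λ a s γ : ℝ} (hξ : 0 ≤ ξ) (ht : 0 ≤ t) (hb : 0 ≤ b)
    (hbK : b ≤ Kb) (hl : 0 ≤ l) (hKδ : 0 ≤ Kδ) (hKσ : 0 ≤ Kσ) (hΛ : 1 ≤ Λ) (ha : 0 ≤ a)
    (hs : 0 < s) (hγ : 0 ≤ γ) (hγ1 : γ ≤ 1)
    (hσ : ∀ Z : ℝ, 1 ≤ Z → a * Z ^ (1 - γ + s * γ) ≤ Z ^ 2 / 2 + Kσ)
    (h : ξ ^ 2 + t ^ 2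
      ≤ b ^ 2 + a * (t ^ (1 - γ) * (ξ ^ s + b ^ s) ^ γ) + (ξ + b + l * t) * (Kδ * Λ)) :
    ξ ≤ errorConst a s γ l Kb Kδ Kσ * Λ ∧ t ≤ errorConst a s γ l Kb Kδ Kσ * Λ := by
  set Z := max 1 (max ξ t) with hZ
  have hZ1 : 1 ≤ Z := le_max_left _ _
  have hZ0 : 0 < Z := zero_lt_one.trans_le hZ1
  have hξZ : ξ ≤ Z := (le_max_left _ _).trans (le_max_right _ _)
  have htZ : t ≤ Z := (le_max_right _ _).trans (le_max_right _ _)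
  have hKb : 0 ≤ Kb := hb.trans hbK
  have hγ' : 0 ≤ 1 - γ := by linarith
  have hsγ : 0 ≤ s * γ := by positivity
  have h1 : (ξ ^ s + b ^ s) ^ γ ≤ Z ^ (s * γ) + Kb ^ (s * γ) := by
    refine (Real.rpow_add_le_add_rpow (by positivity) (by positivity) hγ hγ1).trans ?_
    rw [← Real.rpow_mul hξ, ← Real.rpow_mul hb]
    gcongr
  have h2 : t ^ (1 - γ) ≤ Z ^ (1 - γ) := by gcongr
  have h3 : Z ^ (1 - γ) ≤ Z := by
    nth_rewrite 2 [← Real.rpow_one Z]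
    exact Real.rpow_le_rpow_of_exponent_le hZ1 (by linarith)
  have h4 : a * (t ^ (1 - γ) * (ξ ^ s + b ^ s) ^ γ)
      ≤ a * Z ^ (1 - γ + s * γ) + a * Kb ^ (s * γ) * Z := by
    have hK0 : 0 ≤ Kb ^ (s * γ) := by positivity
    calc _ ≤ a * (Z ^ (1 - γ) * (Z ^ (s * γ) + Kb ^ (s * γ))) := by gcongr
      _ = a * Z ^ (1 - γ + s * γ) + a * Kb ^ (s * γ) * Z ^ (1 - γ) := by
          rw [Real.rpow_add hZ0]; ring
      _ ≤ _ := by gcongr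
  have h5 : (ξ + b + l * t) * (Kδ * Λ) ≤ (1 + Kb + l) * Kδ * (Z * Λ) := by
    calc _ ≤ (Z + Kb * Z + l * Z) * (Kδ * Λ) := by
          gcongr
          exact hbK.trans (le_mul_of_one_le_right hKb hZ1)
      _ = _ := by ring
  have hZsq : Z ^ 2 ≤ 1 + ξ ^ 2 + t ^ 2 := by
    rcases max_choice 1 (max ξ t) with hc | hc
    · rw [hZ, hc]; nlinarith [sq_nonneg ξ, sq_nonneg t]
    · rcases max_choice ξ t with hc2 | hc2
      · rw [hZ, hc, hc2]; nlinarith [sq_nonneg t]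
      · rw [hZ, hc, hc2]; nlinarith [sq_nonneg ξ]
  have hZΛ : 1 ≤ Z * Λ := one_le_mul_of_one_le_of_one_le hZ1 hΛ
  have hZle : Z ≤ Z * Λ := le_mul_of_one_le_right hZ0.le hΛ
  have hbb : b ^ 2 ≤ Kb ^ 2 := by gcongr
  have h6 : 1 + Kb ^ 2 + Kσ ≤ (1 + Kb ^ 2 + Kσ) * (Z * Λ) :=
    le_mul_of_one_le_right (by positivity) hZΛ
  have h7 : a * Kb ^ (s * γ) * Z ≤ a * Kb ^ (s * γ) * (Z * Λ) := by gcongr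
  have h8 : Z * Z ≤ Z * (errorConst a s γ l Kb Kδ Kσ * Λ) := by
    have := hσ Z hZ1
    rw [errorConst]
    nlinarith
  have h9 := le_of_mul_le_mul_left h8 hZ0
  exact ⟨hξZ.trans h9, htZ.trans h9⟩

lemma scaled_error_le {lam x τ b n k R δ l Kb Kδ Kσ Λ ρ₀ α s γ u e : ℝ} (hlam : 0 < lam)
    (hx : 0 ≤ x) (hτ : 0 ≤ τ) (hb : 0 ≤ b) (hn : 0 ≤ n) (hk : 0 ≤ k) (hl : 0 ≤ l) (hKδ : 0 ≤ Kδ)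
    (hKσ : 0 ≤ Kσ) (hΛ : 1 ≤ Λ) (hρ₀ : 0 ≤ ρ₀) (hα : 0 < α) (hs : 0 < s) (hγ : 0 ≤ γ)
    (hγ1 : γ ≤ 1)
    (hσ : ∀ Z : ℝ, 1 ≤ Z → 2 * ρ₀ * α ^ γ * Z ^ (1 - γ + s * γ) ≤ Z ^ 2 / 2 + Kσ)
    (he : 1 - e + (u - 1 / 2) * (1 - γ) + u * s * γ = 2 * u)
    (hmain : x ^ 2 + lam * τ ^ 2 ≤ b ^ 2 + 2 * lam * (R * k) + (x + b + √lam * (l * τ)) * δ)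
    (hkn : k ≤ τ ^ (1 - γ) * n ^ γ) (hnx : n ≤ α * (x ^ s + b ^ s))
    (hδ : δ ≤ Kδ * lam ^ u * Λ) (hbK : b ≤ Kb * lam ^ u) (hR : R ≤ ρ₀ * lam ^ (-e)) :
    x ≤ errorConst (2 * ρ₀ * α ^ γ) s γ l Kb Kδ Kσ * Λ * lam ^ u ∧
    τ ≤ errorConst (2 * ρ₀ * α ^ γ) s γ l Kb Kδ Kσ * Λ * lam ^ (u - 1 / 2) := by
  set P := lam ^ u with hP
  set Q := lam ^ (u - 1 / 2) with hQ
  have hP0 : 0 < P := Real.rpow_pos_of_pos hlam _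
  have hQ0 : 0 < Q := Real.rpow_pos_of_pos hlam _
  have hsq : √lam * Q = P := by
    rw [Real.sqrt_eq_rpow, hQ, ← Real.rpow_add hlam, add_sub_cancel]
  have hlQ : lam * Q ^ 2 = P ^ 2 := by
    rw [← hsq, mul_pow, Real.sq_sqrt hlam.le]
  obtain ⟨ξ, rfl⟩ : ∃ ξ, x = P * ξ := ⟨x / P, by field_simp⟩
  obtain ⟨t, rfl⟩ : ∃ t, τ = Q * t := ⟨τ / Q, by field_simp⟩
  obtain ⟨b, rfl⟩ : ∃ b', b = P * b' := ⟨b / P, by field_simp⟩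
  have hξ : 0 ≤ ξ := nonneg_of_mul_nonneg_right hx hP0
  have ht : 0 ≤ t := nonneg_of_mul_nonneg_right hτ hQ0
  have hb' : 0 ≤ b := nonneg_of_mul_nonneg_right hb hP0
  have hbK' : b ≤ Kb := by
    rw [mul_comm Kb] at hbK
    exact le_of_mul_le_mul_left hbK hP0
  have hγ' : 0 ≤ 1 - γ := by linarith
  -- The exponent balance `he` is used here: the cross term scales in `lam` exactly like the squared
  -- error.
  have hpow : lam * lam ^ (-e) * (Q ^ (1 - γ) * (P ^ s) ^ γ) = P ^ 2 := by
    rw [hQ, hP, ← Real.rpow_mul hlam.le, ← Real.rpow_mul hlam.le, ← Real.rpow_mul hlam.le,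
      ← Real.rpow_add hlam]
    nth_rewrite 1 [← Real.rpow_one lam]
    rw [← Real.rpow_add hlam, ← Real.rpow_add hlam, ← Real.rpow_natCast, ← Real.rpow_mul hlam.le]
    congr 1
    push_cast
    linarith
  have hRk : 2 * lam * (R * k)
      ≤ P ^ 2 * (2 * ρ₀ * α ^ γ * (t ^ (1 - γ) * (ξ ^ s + b ^ s) ^ γ)) := by
    have hn2 : n ^ γ ≤ α ^ γ * ((P ^ s) ^ γ * (ξ ^ s + b ^ s) ^ γ) := by
      rw [← Real.mul_rpow (by positivity) (by positivity),
        ← Real.mul_rpow (by positivity) (by positivity)]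
      refine Real.rpow_le_rpow hn (hnx.trans (le_of_eq ?_)) hγ
      rw [Real.mul_rpow hP0.le hξ, Real.mul_rpow hP0.le hb']
      ring
    calc 2 * lam * (R * k) ≤ 2 * lam * (ρ₀ * lam ^ (-e) * ((Q * t) ^ (1 - γ)
          * (α ^ γ * ((P ^ s) ^ γ * (ξ ^ s + b ^ s) ^ γ)))) := by
          gcongr
          refine hkn.trans ?_
          gcongr
      _ = (lam * lam ^ (-e) * (Q ^ (1 - γ) * (P ^ s) ^ γ))
          * (2 * ρ₀ * α ^ γ * (t ^ (1 - γ) * (ξ ^ s + b ^ s) ^ γ)) := by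
          rw [Real.mul_rpow hQ0.le ht]; ring
      _ = _ := by rw [hpow]
  have hδ2 : (P * ξ + P * b + √lam * (l * (Q * t))) * δ
      ≤ P ^ 2 * ((ξ + b + l * t) * (Kδ * Λ)) := by
    have h1 : P * ξ + P * b + √lam * (l * (Q * t)) = P * (ξ + b + l * t) := by
      rw [← hsq]; ring
    rw [h1]
    calc _ ≤ P * (ξ + b + l * t) * (Kδ * P * Λ) := by gcongr
      _ = _ := by ring
  have hnorm : ξ ^ 2 + t ^ 2 ≤ b ^ 2 + 2 * ρ₀ * α ^ γ * (t ^ (1 - γ) * (ξ ^ s + b ^ s) ^ γ)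
      + (ξ + b + l * t) * (Kδ * Λ) := by
    have h1 : lam * (Q * t) ^ 2 = P ^ 2 * t ^ 2 := by rw [← hlQ]; ring
    rw [h1] at hmain
    refine le_of_mul_le_mul_left ?_ (pow_pos hP0 2)
    linarith
  obtain ⟨h1, h2⟩ := normalized_error_le hξ ht hb' hbK' hl hKδ hKσ hΛ (by positivity) hs hγ hγ1 hσ
    hnorm
  constructor
  · rw [mul_comm P]; gcongr
  · rw [mul_comm Q]; gcongr

/-- The factor `τ` carries one power of `Λ` and `n` carries `Λ^s`; their geometric mean with weights
`p/(p+1)` and `1/(p+1)` determines the power of the logarithm in the final rate. -/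
lemma interpolated_error_le {lam x τ b n dist Kb Λ α s p u C : ℝ} (hlam : 0 < lam)
    (hx : 0 ≤ x) (hτ : 0 ≤ τ) (hb : 0 ≤ b) (hn : 0 ≤ n) (hΛ : 1 ≤ Λ) (hα : 0 < α) (hs : 0 < s)
    (hp : 0 ≤ p) (hC : 0 ≤ C) (hKb : 0 ≤ Kb)
    (hxC : x ≤ C * Λ * lam ^ u) (hτC : τ ≤ C * Λ * lam ^ (u - 1 / 2)) (hbK : b ≤ Kb * lam ^ u)
    (hnx : n ≤ α * (x ^ s + b ^ s))
    (hdist : dist ≤ τ ^ (p / (p + 1)) * n ^ (1 / (p + 1))) :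
    dist ≤ C ^ (p / (p + 1)) * (α * (C ^ s + Kb ^ s)) ^ (1 / (p + 1))
      * lam ^ (((u - 1 / 2) * p + u * s) / (p + 1)) * Λ ^ ((p + s) / (p + 1)) := by
  have hΛ0 : 0 < Λ := by linarith
  have hp1 : 0 < p + 1 := by linarith
  have hn2 : n ≤ α * (C ^ s + Kb ^ s) * (Λ ^ s * lam ^ (u * s)) := by
    have h1 : x ^ s ≤ C ^ s * (Λ ^ s * lam ^ (u * s)) := by
      refine (Real.rpow_le_rpow hx hxC hs.le).trans (le_of_eq ?_)
      rw [Real.mul_rpow (by positivity) (by positivity), Real.mul_rpow hC hΛ0.le,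
        ← Real.rpow_mul hlam.le, mul_assoc]
    have h2 : b ^ s ≤ Kb ^ s * (Λ ^ s * lam ^ (u * s)) := by
      refine (Real.rpow_le_rpow hb hbK hs.le).trans ?_
      rw [Real.mul_rpow hKb (by positivity), ← Real.rpow_mul hlam.le]
      gcongr
      exact le_mul_of_one_le_left (by positivity) (Real.one_le_rpow hΛ hs.le)
    refine hnx.trans ?_
    rw [mul_assoc, add_mul]
    gcongr
  refine hdist.trans ?_
  calc _ ≤ (C * Λ * lam ^ (u - 1 / 2)) ^ (p / (p + 1))
        * (α * (C ^ s + Kb ^ s) * (Λ ^ s * lam ^ (u * s))) ^ (1 / (p + 1)) := by gcongr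
    _ = C ^ (p / (p + 1)) * (α * (C ^ s + Kb ^ s)) ^ (1 / (p + 1))
        * ((lam ^ (u - 1 / 2)) ^ (p / (p + 1)) * (lam ^ (u * s)) ^ (1 / (p + 1)))
        * (Λ ^ (p / (p + 1)) * (Λ ^ s) ^ (1 / (p + 1))) := by
        rw [Real.mul_rpow (by positivity) (by positivity), Real.mul_rpow hC hΛ0.le,
          Real.mul_rpow (x := α * (C ^ s + Kb ^ s)) (by positivity) (by positivity),
          Real.mul_rpow (x := Λ ^ s) (by positivity) (by positivity)]
        ring
    _ = _ := by
        rw [← Real.rpow_mul hlam.le, ← Real.rpow_mul hlam.le, ← Real.rpow_add hlam,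
          ← Real.rpow_mul hΛ0.le, ← Real.rpow_add hΛ0]
        congr 2
        · congr 1
          field_simp
        · field_simp

/-- A power with exponent below `2` is dominated by the square. -/
lemma exists_const_mul_rpow_le {c σ : ℝ} (hc : 0 ≤ c) (hσ : σ < 2) :
    ∃ K : ℝ, 0 ≤ K ∧ ∀ Z : ℝ, 1 ≤ Z → c * Z ^ σ ≤ Z ^ 2 / 2 + K := by
  -- Beyond this threshold `2c ≤ Z^(2-σ)`, so half of the square already dominates; below it the
  -- power is bounded.
  set Z₀ : ℝ := max 1 ((2 * c) ^ (1 / (2 - σ))) with hZ₀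
  have hσ' : 0 < 2 - σ := by linarith
  refine ⟨c * Z₀ ^ max σ 0, by positivity, fun Z hZ => ?_⟩
  have hZ0 : 0 < Z := by linarith
  rcases le_total Z Z₀ with h | h
  · have h1 : Z ^ σ ≤ Z₀ ^ max σ 0 :=
      (Real.rpow_le_rpow_of_exponent_le hZ (le_max_left _ _)).trans
        (Real.rpow_le_rpow hZ0.le h (le_max_right _ _))
    have h2 : c * Z ^ σ ≤ c * Z₀ ^ max σ 0 := by gcongr
    have : 0 ≤ Z ^ 2 / 2 := by positivity
    linarith
  · have h1 : 2 * c ≤ Z ^ (2 - σ) := by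
      have h2 : (2 * c) ^ (1 / (2 - σ)) ≤ Z := (le_max_right _ _).trans h
      have h3 := Real.rpow_le_rpow (by positivity) h2 hσ'.le
      rwa [← Real.rpow_mul (by positivity), one_div_mul_cancel hσ'.ne', Real.rpow_one] at h3
    have h2 : Z ^ (2 - σ) * Z ^ σ = Z ^ 2 := by
      rw [← Real.rpow_add hZ0, sub_add_cancel]
      norm_num
    have h3 : 2 * c * Z ^ σ ≤ Z ^ 2 := by
      rw [← h2]
      gcongr
    have : 0 ≤ c * Z₀ ^ max σ 0 := by positivity
    linarith

end RealInequalities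

/-! ### Choice of the benchmark element -/

section BenchmarkChoice

variable {H : Type*} [NormedAddCommGroup H] [InnerProductSpace ℝ H] [CompleteSpace H]
  {L : H →ₗ.[ℝ] H} {ℓL : ℝ}

lemma exists_isBenchmarkMinimizer (hL : IsGenerator L ℓL) {q r R : ℝ} (hr : 0 ≤ r) (hrq : r < q)
    (hR : 0 < R) {fhat fbar v : H} (hv : fhat - fbar = invPow L r v) :
    ∃ g w : H, IsBenchmarkMinimizer L q fbar fhat R g ∧ g - fbar = invPow L q w ∧ ‖w‖ ≤ R ∧
      ∀ k, 0 ≤ k → r + k ≤ 2 * q →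
        negNorm L k (g - fhat) ≤ ‖v‖ * (‖v‖ / R) ^ ((r + k) / (q - r)) := by
  have hB := hL.inv_isPositive
  obtain ⟨w, hw, hmin, hvar⟩ := exists_closest_in_image (invPow L q) hR.le (invPow L r v)
  have hg : ∀ w, fbar + invPow L q w - fhat = -(invPow L r v - invPow L q w) := fun w => by
    rw [← hv]; abel
  refine ⟨fbar + invPow L q w, w, ⟨⟨w, by abel, hw⟩, ?_⟩, by abel, hw, fun k hk hrk => ?_⟩
  · rintro f ⟨w', hf, hw'⟩
    have hf2 : f = fbar + invPow L q w' := by rw [← hf]; abel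
    rw [hf2, hg, hg, norm_neg, norm_neg]
    exact hmin w' hw'
  · rw [negNorm, hg, map_neg, norm_neg]
    exact norm_opPow_benchmark_le hB hL.inv_injective hr hrq hk hrk hR hw hvar

/-- Since `r < q`, the radius tends to infinity as `lam → 0` for every positive `ρ₀`, so the
benchmark elements enter `Q` and `ρ₀` stays free to be chosen small. -/
lemma eventually_exists_benchmark_of_lt (hL : IsGenerator L ℓL) {p q r s D R₀ ρ₀ : ℝ}
    (hr : 0 ≤ r) (hrq : r < q) (hp : 0 ≤ p) (hrp : r + p ≤ 2 * q) (hs : 0 < s) (hD : 0 < D)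
    (hρ₀ : 0 < ρ₀) {fhat fbar v : H} (hv : fhat - fbar = invPow L r v) (hvR : ‖v‖ ≤ R₀) {Q : Set H}
    (hQ : ∀ᶠ R : ℝ in atTop, ∀ g : H, IsBenchmarkMinimizer L q fbar fhat R g → g ∈ Q) :
    ∀ᶠ lam in 𝓝[>] (0 : ℝ), ∃ g ∈ Q, ∃ w : H, g - fbar = invPow L q w ∧
      ‖w‖ ≤ ρ₀ * lam ^ (-(s * (q - r) / D)) ∧
      negNorm L p (g - fhat) ≤ R₀ * (R₀ / ρ₀) ^ ((r + p) / (q - r)) * lam ^ (s * (r + p) / D) ∧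
      ‖g - fhat‖ ≤ R₀ * (R₀ / ρ₀) ^ (r / (q - r)) * lam ^ (s * r / D) := by
  have hqr : 0 < q - r := by linarith
  have hR₀ : 0 ≤ R₀ := (norm_nonneg _).trans hvR
  have hlim : Tendsto (fun lam : ℝ => ρ₀ * lam ^ (-(s * (q - r) / D))) (𝓝[>] 0) atTop :=
    (tendsto_rpow_neg_nhdsGT_zero (neg_neg_of_pos (by positivity))).const_mul_atTop hρ₀
  filter_upwards [hlim.eventually hQ, self_mem_nhdsWithin] with lam hlamQ hlam
  have hlam0 : 0 < lam := hlam
  obtain ⟨g, w, hg, hgw, hw, hbd⟩ := exists_isBenchmarkMinimizer hL hr hrq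
    (by positivity : 0 < ρ₀ * lam ^ (-(s * (q - r) / D))) hv
  have hbd2 : ∀ k, 0 ≤ k → r + k ≤ 2 * q → negNorm L k (g - fhat)
      ≤ R₀ * (R₀ / ρ₀) ^ ((r + k) / (q - r)) * lam ^ (s * (r + k) / D) := by
    intro k hk hrk
    refine (hbd k hk hrk).trans ?_
    have hE : 0 ≤ (r + k) / (q - r) := by positivity
    calc _ ≤ R₀ * (R₀ / (ρ₀ * lam ^ (-(s * (q - r) / D)))) ^ ((r + k) / (q - r)) := by gcongr
      _ = R₀ * (R₀ / ρ₀ * lam ^ (s * (q - r) / D)) ^ ((r + k) / (q - r)) := by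
          rw [Real.rpow_neg hlam0.le]
          congr 2
          field_simp
      _ = _ := by
          rw [Real.mul_rpow (by positivity) (by positivity), ← Real.rpow_mul hlam0.le, ← mul_assoc]
          congr 2
          field_simp
  refine ⟨g, hlamQ g hg, w, hgw, hw, hbd2 p hp hrp, ?_⟩
  have h0 := hbd2 0 le_rfl (by linarith)
  simp only [negNorm, invPow, opPow_zero, add_zero] at h0
  exact h0

/-- When `q = r`, `fhat` itself belongs to every benchmark class of radius at least `‖v‖`, so it
serves as its own benchmark with no approximation error. -/
lemma eventually_exists_benchmark_of_eq {p r s D R₀ : ℝ} {fhat fbar v : H}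
    (hv : fhat - fbar = invPow L r v) (hvR : ‖v‖ ≤ R₀) {Q : Set H}
    (hQ : ∀ᶠ R : ℝ in atTop, ∀ g : H, IsBenchmarkMinimizer L r fbar fhat R g → g ∈ Q) :
    ∀ᶠ lam in 𝓝[>] (0 : ℝ), ∃ g ∈ Q, ∃ w : H, g - fbar = invPow L r w ∧
      ‖w‖ ≤ R₀ * lam ^ (-(s * (r - r) / D)) ∧
      negNorm L p (g - fhat) ≤ 0 * lam ^ (s * (r + p) / D) ∧
      ‖g - fhat‖ ≤ 0 * lam ^ (s * r / D) := by
  obtain ⟨R, hR, hRQ⟩ := (hQ.and (eventually_ge_atTop ‖v‖)).exists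
  refine Eventually.of_forall fun lam => ⟨fhat, hR fhat ⟨⟨v, hv, hRQ⟩, fun f _ => ?_⟩, v, hv, ?_, ?_, ?_⟩
  · rw [sub_self, norm_zero]; exact norm_nonneg _
  · simpa using hvR
  · simp [negNorm]
  · simp

/-- The constants that govern the approximation by benchmark elements depend on the parameters
only. -/
lemma exists_benchmark_constants {p q r s α D : ℝ} (R₀ : ℝ) (hp : 0 ≤ p) (hs : 0 < s) (hα : 0 < α)
    (hr : 0 ≤ r) (hrq : r ≤ q) (hrp : r + p ≤ 2 * q) (hq₁ : 1 ≤ q) (hqs : q * (s - 1) ≤ p + s)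
    (hden : 0 < (p + r) - s * (r - 1)) (hD : 0 < D) :
    ∃ ρ₀ Kp Kg Kσ : ℝ, 0 ≤ ρ₀ ∧ 0 ≤ Kp ∧ 0 ≤ Kg ∧ 0 ≤ Kσ ∧
      (∀ Z : ℝ, 1 ≤ Z → 2 * ρ₀ * α ^ ((q - 1) / (p + 1))
        * Z ^ (1 - (q - 1) / (p + 1) + s * ((q - 1) / (p + 1))) ≤ Z ^ 2 / 2 + Kσ) ∧
      ∀ {H : Type*} [NormedAddCommGroup H] [InnerProductSpace ℝ H] [CompleteSpace H]
        {L : H →ₗ.[ℝ] H} {ℓL : ℝ}, IsGenerator L ℓL → ∀ {fhat fbar v : H},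
        fhat - fbar = invPow L r v → ‖v‖ ≤ R₀ → ∀ {Q : Set H},
        (∀ᶠ R : ℝ in atTop, ∀ g : H, IsBenchmarkMinimizer L q fbar fhat R g → g ∈ Q) →
        ∀ᶠ lam in 𝓝[>] (0 : ℝ), ∃ g ∈ Q, ∃ w : H, g - fbar = invPow L q w ∧
          ‖w‖ ≤ ρ₀ * lam ^ (-(s * (q - r) / D)) ∧
          negNorm L p (g - fhat) ≤ Kp * lam ^ (s * (r + p) / D) ∧
          ‖g - fhat‖ ≤ Kg * lam ^ (s * r / D) := by
  have hp1 : 0 < p + 1 := by linarith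
  have hαγ : 0 < α ^ ((q - 1) / (p + 1)) := Real.rpow_pos_of_pos hα _
  have hexp : 1 - (q - 1) / (p + 1) + s * ((q - 1) / (p + 1))
      = 1 + (q - 1) * (s - 1) / (p + 1) := by ring
  rcases hrq.lt_or_eq with hlt | rfl
  -- For `r < q` the exponent of `Z` may equal `2`, so absorption relies on a small coefficient;
  -- this value makes it exactly `1/2`.
  · set ρ₀ := 1 / (4 * α ^ ((q - 1) / (p + 1))) with hρ₀
    have hρ₀0 : 0 < ρ₀ := by positivity
    refine ⟨ρ₀, |R₀| * (|R₀| / ρ₀) ^ ((r + p) / (q - r)), |R₀| * (|R₀| / ρ₀) ^ (r / (q - r)), 0,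
      hρ₀0.le, by positivity, by positivity, le_rfl, fun Z hZ => ?_,
      fun hL _ _ _ hv hvR _ hQ => eventually_exists_benchmark_of_lt hL hr hlt hp hrp hs hD hρ₀0 hv
        (hvR.trans (le_abs_self _)) hQ⟩
    have h1 : 2 * ρ₀ * α ^ ((q - 1) / (p + 1)) = 1 / 2 := by
      rw [hρ₀]; field_simp; norm_num
    have h2 : Z ^ (1 - (q - 1) / (p + 1) + s * ((q - 1) / (p + 1))) ≤ Z ^ (2 : ℝ) := by
      refine Real.rpow_le_rpow_of_exponent_le hZ ?_
      rw [hexp]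
      have : (q - 1) * (s - 1) / (p + 1) ≤ 1 := (div_le_one hp1).2 (by linarith)
      linarith
    rw [Real.rpow_two] at h2
    rw [h1]
    linarith
  -- For `r = q` the radius cannot be made small, but `hden` makes the exponent strictly
  -- subquadratic, at the price of an additive constant.
  · have hσ : 1 - (r - 1) / (p + 1) + s * ((r - 1) / (p + 1)) < 2 := by
      rw [hexp]
      have : (r - 1) * (s - 1) / (p + 1) < 1 := (div_lt_one hp1).2 (by linarith)
      linarith
    obtain ⟨K, hK0, hK⟩ := exists_const_mul_rpow_le
      (c := 2 * |R₀| * α ^ ((r - 1) / (p + 1))) (by positivity) hσ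
    exact ⟨|R₀|, 0, 0, K, abs_nonneg _, le_rfl, le_rfl, hK0, hK,
      fun _ _ _ _ hv hvR _ hQ => eventually_exists_benchmark_of_eq hv
        (hvR.trans (le_abs_self _)) hQ⟩

end BenchmarkChoice

/-! ### The regularization parameter -/

section Parameter

variable {X Y H' : Type*} [MeasurableSpace X]
  [NormedAddCommGroup Y] [InnerProductSpace ℝ Y] [CompleteSpace Y]
  [NormedAddCommGroup H'] [InnerProductSpace ℝ H'] [CompleteSpace H'] [RKHS ℝ H' X Y]
  [MeasurableSpace Y] [BorelSpace Y] [TopologicalSpace.SeparableSpace Y]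
  [TopologicalSpace.SeparableSpace H']
  {κ : ℝ} (hK : KernelCondition X Y H' κ) {ν : Measure X} [IsProbabilityMeasure ν]

lemma sqrt_effDim_div_of_thetaFun_eq {u lam : ℝ} (hlam : 0 < lam) {m : ℕ} (hm : 0 < m)
    (h : thetaFun hK ν u lam = 1 / √(m : ℝ)) :
    0 < effDim hK ν lam ∧ √(effDim hK ν lam / m) = lam ^ u := by
  have hm0 : (0 : ℝ) < m := by exact_mod_cast hm
  have hsm : 0 < √(m : ℝ) := Real.sqrt_pos.2 hm0
  rw [thetaFun] at h
  have hN : 0 < √(effDim hK ν lam) := by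
    refine (Real.sqrt_nonneg _).lt_of_ne fun h0 => ?_
    rw [← h0, div_zero] at h
    exact absurd h (by positivity)
  refine ⟨Real.sqrt_pos.1 hN, ?_⟩
  rw [div_eq_div_iff hN.ne' hsm.ne', one_mul] at h
  rw [Real.sqrt_div (Real.sqrt_pos.1 hN).le, ← h]
  field_simp

/-- The rule `lam^(2u) = N(lam)/m` and `N(lam) ≤ κ²/lam` together give `lam^(2u+1) ≤ κ²/m`. -/
lemma tendsto_parameter {u : ℝ} (hu : 0 ≤ u) {lam : ℕ → ℝ}
    (h : ∀ᶠ m : ℕ in atTop, 0 < lam m ∧ thetaFun hK ν u (lam m) = 1 / √(m : ℝ)) :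
    Tendsto lam atTop (𝓝[>] 0) := by
  have hu' : 0 < 2 * u + 1 := by linarith
  have hlim : Tendsto (fun m : ℕ => (κ ^ 2 / (m : ℝ)) ^ (1 / (2 * u + 1))) atTop (𝓝 0) := by
    have h1 : Tendsto (fun m : ℕ => κ ^ 2 / (m : ℝ)) atTop (𝓝 0) :=
      tendsto_const_div_atTop_nhds_zero_nat _
    have h2 := h1.rpow_const (p := 1 / (2 * u + 1)) (Or.inr (by positivity))
    rwa [Real.zero_rpow (by positivity)] at h2
  refine tendsto_nhdsWithin_iff.2 ⟨?_, h.mono fun m hm => hm.1⟩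
  refine tendsto_of_tendsto_of_tendsto_of_le_of_le' tendsto_const_nhds hlim
    (h.mono fun m hm => hm.1.le) ?_
  filter_upwards [h, eventually_gt_atTop 0] with m hm hm0
  have hm' : (0 : ℝ) < m := by exact_mod_cast hm0
  obtain ⟨hN, hsq⟩ := sqrt_effDim_div_of_thetaFun_eq hK hm.1 hm0 hm.2
  have h1 : (lam m ^ u) ^ 2 = effDim hK ν (lam m) / m := by
    rw [← hsq, Real.sq_sqrt (by positivity)]
  have h2 : lam m ^ (2 * u + 1) ≤ κ ^ 2 / m := by
    have h3 := effDim_le (ν := ν) hK hm.1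
    rw [le_div_iff₀ hm.1] at h3
    rw [Real.rpow_add hm.1, Real.rpow_one, mul_comm 2 u, Real.rpow_mul hm.1.le, Real.rpow_two, h1,
      div_mul_eq_mul_div]
    gcongr
  have h3 := Real.rpow_le_rpow (Real.rpow_nonneg hm.1.le _) h2
    (by positivity : 0 ≤ 1 / (2 * u + 1))
  rwa [← Real.rpow_mul hm.1.le, mul_one_div_cancel hu'.ne', Real.rpow_one] at h3

/-- Positivity at one parameter excludes `I_ν = 0`. A single `c` with nonzero image then bounds the
effective dimension below by `‖I_ν c‖² / (‖I_ν c‖² + lam ‖c‖²)`, which tends to `1`. -/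
lemma eventually_half_le_effDim {lam₀ : ℝ} (hlam₀ : 0 < lam₀) (hN : 0 < effDim hK ν lam₀) :
    ∀ᶠ lam in 𝓝[>] (0 : ℝ), 1 / 2 ≤ effDim hK ν lam := by
  obtain ⟨c, hc⟩ : ∃ c : H', inclusion hK ν c ≠ 0 := by
    by_contra hall
    push Not at hall
    rw [effDim_eq_tsum hK hlam₀] at hN
    simp [hall] at hN
  have hc0 : 0 < ‖inclusion hK ν c‖ ^ 2 := by positivity
  have hpos : 0 < ‖inclusion hK ν c‖ ^ 2 / (‖c‖ ^ 2 + 1) := by positivity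
  filter_upwards [Ioo_mem_nhdsGT hpos] with lam hlam
  have h1 := norm_inclusion_sq_le_effDim (ν := ν) hK hlam.1 c
  have h2 : lam * ‖c‖ ^ 2 ≤ ‖inclusion hK ν c‖ ^ 2 := by
    have h3 := hlam.2.le
    rw [le_div_iff₀ (by positivity)] at h3
    have := hlam.1
    nlinarith
  have h3 := effDim_nonneg (ν := ν) hK hlam.1
  have h4 : effDim hK ν lam * (‖inclusion hK ν c‖ ^ 2 + lam * ‖c‖ ^ 2)
      ≤ effDim hK ν lam * (2 * ‖inclusion hK ν c‖ ^ 2) := by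
    gcongr
    linarith
  by_contra hlt
  push Not at hlt
  nlinarith

end Parameter

lemma one_div_sqrt_mul_le {N lam m c : ℝ} (hlam : 0 < lam) (hm : 0 < m) (hc : 0 < c)
    (h : c ≤ m * lam * N) : 1 / (√lam * m) ≤ √(N / m) / √c := by
  have hsl : 0 < √lam := Real.sqrt_pos.2 hlam
  have hsc : 0 < √c := Real.sqrt_pos.2 hc
  rw [le_div_iff₀ hsc]
  have h1 : √(N / m) = √(m * lam * N) / (√lam * m) := by
    rw [show N / m = m * lam * N / (lam * m ^ 2) by field_simp, Real.sqrt_div' _ (by positivity),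
      Real.sqrt_mul hlam.le, Real.sqrt_sq hm.le]
  rw [h1, one_div_mul_eq_div]
  gcongr

/-! ### Error bounds for a good sample -/

lemma bernstein_radius_le {a b lam m P c Λ : ℝ} (ha : 0 < a) (hΛ : 0 ≤ Λ)
    (h : 1 / (√lam * m) ≤ P / c) :
    (1 / (√lam / a * m) + b * P) * Λ ≤ (a / c + b) * P * Λ := by
  have h1 : 1 / (√lam / a * m) = a * (1 / (√lam * m)) := by
    rw [div_mul_eq_mul_div, one_div_div, mul_one_div]
  have h2 := mul_le_mul_of_nonneg_left h ha.le
  refine mul_le_mul_of_nonneg_right ?_ hΛ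
  rw [h1, add_mul]
  refine add_le_add_left (h2.trans (le_of_eq ?_)) _
  ring

section SampleError

variable {X Y H H' : Type*} [MeasurableSpace X]
  [NormedAddCommGroup Y] [InnerProductSpace ℝ Y] [CompleteSpace Y]
  [NormedAddCommGroup H] [InnerProductSpace ℝ H] [CompleteSpace H]
  [NormedAddCommGroup H'] [InnerProductSpace ℝ H'] [CompleteSpace H'] [RKHS ℝ H' X Y]
  [MeasurableSpace Y] [BorelSpace Y] [TopologicalSpace.SeparableSpace Y]
  {κ : ℝ} (hK : KernelCondition X Y H' κ) {ν : Measure X} [IsProbabilityMeasure ν]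

/-- The benchmark element belongs to the domain of the generator. -/
lemma exists_domain_eq {L : H →ₗ.[ℝ] H} {ℓL q : ℝ} (hL : IsGenerator L ℓL) (hq : 1 ≤ q)
    {fbar : L.domain} {g w : H} (hg : g - fbar = invPow L q w) :
    ∃ g' : L.domain, (g' : H) = g ∧ L (g' - fbar) = invPow L (q - 1) w := by
  have h := opPow_add_apply hL.inv_isPositive zero_le_one (sub_nonneg.2 hq) w
  rw [add_sub_cancel, opPow_one] at h
  obtain ⟨hmem, hLx⟩ := hL.isBoundedInverse_inv.1 (invPow L (q - 1) w)
  refine ⟨fbar + ⟨_, hmem⟩, ?_, ?_⟩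
  · change (fbar : H) + inv L (opPow (inv L) (q - 1) w) = g
    rw [← h]
    change (fbar : H) + invPow L q w = g
    rw [← hg]
    abel
  · rw [add_sub_cancel_left]
    exact hLx

/-- All operator theory ends here. The witnesses are the norms of `h = L(f - g)`, `L^(-(p+1)) h` and
`L^(-(q-1)) h`, linked by interpolation; what follows concerns real numbers only. -/
lemma sample_error_le {A : H → H'} {L : H →ₗ.[ℝ] H} {ℓL ℓA ℓ : ℝ} (hL : IsGenerator L ℓL)
    {fhat : H} {fbar f g : L.domain} {p q s α lam ℓ₁ δ₁ δ₂ : ℝ} (hp : 0 ≤ p) (hq₁ : 1 ≤ q)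
    (hq₂ : q ≤ 2 + p) (hlam : 0 < lam) (hδ₁ : 0 ≤ δ₁) (hδ₂ : 0 ≤ δ₂)
    {m : ℕ} {z : Fin m → X × Y} (hz : GoodSample hK ν lam (A fhat) δ₁ δ₂ z)
    (hmin : tikhonov A L fbar lam z f ≤ tikhonov A L fbar lam z g)
    (hℓ₁ : ‖A f - (2 : ℝ) • A fhat + A g‖ ≤ ℓ₁)
    (hLip : ‖A f - A g‖ ≤ ℓA * ‖(f : H) - g‖) (hℓ : ℓA / ℓL ≤ ℓ)
    (hstabf : negNorm L p (f - fhat) ≤ α * ‖inclusion hK ν (A f - A fhat)‖ ^ s)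
    (hstabg : negNorm L p (g - fhat) ≤ α * ‖inclusion hK ν (A g - A fhat)‖ ^ s)
    {w : H} (hw : L (g - fbar) = invPow L (q - 1) w) :
    ∃ τ n k : ℝ, 0 ≤ τ ∧ 0 ≤ n ∧ 0 ≤ k ∧
      ‖inclusion hK ν (A f - A fhat)‖ ^ 2 + lam * τ ^ 2
        ≤ ‖inclusion hK ν (A g - A fhat)‖ ^ 2 + 2 * lam * (‖w‖ * k)
          + (‖inclusion hK ν (A f - A fhat)‖ + ‖inclusion hK ν (A g - A fhat)‖
            + √lam * (|ℓ| * τ)) * (ℓ₁ * δ₂ + 2 * δ₁) ∧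
      k ≤ τ ^ (1 - (q - 1) / (p + 1)) * n ^ ((q - 1) / (p + 1)) ∧
      n ≤ α * (‖inclusion hK ν (A f - A fhat)‖ ^ s + ‖inclusion hK ν (A g - A fhat)‖ ^ s) ∧
      ‖(f : H) - g‖ ≤ τ ^ (p / (p + 1)) * n ^ (1 / (p + 1)) := by
  have hB := hL.inv_isPositive
  have hp1 : 0 < p + 1 := by linarith
  set h := L (f - g) with hh
  have hBh : (f : H) - g = opPow (inv L) 1 h := by
    rw [opPow_one, hh, hL.isBoundedInverse_inv.2]
    rfl
  have hn : negNorm L p ((f : H) - g) = ‖opPow (inv L) (p + 1) h‖ := by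
    rw [negNorm, hBh, opPow_add_apply hB hp zero_le_one]
    rfl
  have hinterp : ∀ θ, 0 ≤ θ → θ ≤ 1 → ‖opPow (inv L) (θ * (p + 1)) h‖
      ≤ ‖h‖ ^ (1 - θ) * ‖opPow (inv L) (p + 1) h‖ ^ θ := by
    intro θ h0 h1
    have hi := norm_opPow_interpolation hB hL.inv_injective le_rfl hp1.le h0 h1 h
    rwa [mul_zero, zero_add, opPow_zero] at hi
  have hc : ‖A f - A g‖ ≤ |ℓ| * ‖h‖ := by
    have h1 := hL.bound (f - g)
    rw [← hh] at h1
    have h2 : ‖(f : H) - g‖ ≤ ‖h‖ / ℓL := by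
      rw [le_div_iff₀ hL.const_pos, mul_comm]
      exact h1
    rcases le_total 0 ℓA with h0 | h0
    · calc _ ≤ ℓA * (‖h‖ / ℓL) := hLip.trans (by gcongr)
        _ = ℓA / ℓL * ‖h‖ := by ring
        _ ≤ _ := by gcongr; exact hℓ.trans (le_abs_self _)
    · exact hLip.trans ((mul_nonpos_of_nonpos_of_nonneg h0 (norm_nonneg _)).trans (by positivity))
  refine ⟨‖h‖, ‖opPow (inv L) (p + 1) h‖, ‖opPow (inv L) (q - 1) h‖, norm_nonneg _, norm_nonneg _,
    norm_nonneg _, ?_, ?_, ?_, ?_⟩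
  · have he := energy_inequality hK hδ₂ hz hmin hℓ₁
    rw [hw, ← hh] at he
    have h1 : -⟪invPow L (q - 1) w, h⟫_ℝ ≤ ‖w‖ * ‖opPow (inv L) (q - 1) h‖ := by
      rw [invPow, inner_opPow_left hB]
      exact (neg_le_abs _).trans (abs_real_inner_le_norm _ _)
    have h2 : weightedNorm hK ν lam (A f - A g)
        ≤ ‖inclusion hK ν (A f - A fhat)‖ + ‖inclusion hK ν (A g - A fhat)‖
          + √lam * (|ℓ| * ‖h‖) := by
      refine (weightedNorm_le hK ν hlam.le _).trans (add_le_add ?_ (by gcongr))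
      have h3 : A f - A g = (A f - A fhat) - (A g - A fhat) := by abel
      rw [h3, map_sub]
      exact norm_sub_le _ _
    have hℓ₁0 : 0 ≤ ℓ₁ := (norm_nonneg _).trans hℓ₁
    have h4 := mul_le_mul_of_nonneg_right h2 (by positivity : 0 ≤ ℓ₁ * δ₂ + 2 * δ₁)
    have h5 := mul_le_mul_of_nonneg_left h1 (by positivity : 0 ≤ 2 * lam)
    linarith
  · have hi := hinterp ((q - 1) / (p + 1)) (div_nonneg (by linarith) hp1.le)
      ((div_le_one hp1).2 (by linarith))
    rwa [div_mul_cancel₀ _ hp1.ne'] at hi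
  · rw [← hn, mul_add]
    refine le_trans ?_ (add_le_add hstabf hstabg)
    have h3 : (f : H) - g = ((f : H) - fhat) - ((g : H) - fhat) := by abel
    rw [negNorm, h3, map_sub]
    exact norm_sub_le _ _
  · have hi := hinterp (1 / (p + 1)) (by positivity) ((div_le_one hp1).2 (by linarith))
    rw [div_mul_cancel₀ _ hp1.ne'] at hi
    rw [hBh]
    refine hi.trans (le_of_eq ?_)
    congr 2
    field_simp
    ring

end SampleError

end HilbertScale

/-! ### The convergence rates -/

set_option maxHeartbeats 4000000 in
theorem mainTheorem3
    -- the parameters on which the constant may depend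
    (p q r s α β κ M S ℓ ℓ₁ R₀ c₀ u : ℝ)
    (hp : 0 ≤ p) (hs : 0 < s) (hα : 0 < α) (hβ : 0 < β) (hM : 0 < M) (hS : 0 ≤ S) (hc₀ : 0 < c₀)
    (hq₁ : 1 ≤ q) (hq₂ : q ≤ 2 + p) (hqs : q * (s - 1) ≤ p + s)
    (hr : 0 ≤ r) (hrq : r ≤ q) (hrp : r + p ≤ 2 * q)
    (hden : 0 < (p + r) - s * (r - 1))
    (hu : u = (p + r) / (2 * (p + r) - 2 * s * (r - 1))) :
    (2 * u * (s + p) - p) / (2 * (p + 1)) = s * r / (2 * (p + r) - 2 * s * (r - 1)) ∧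
    ∃ C : ℝ, 0 < C ∧
    ∀ {X Y H H' : Type*}
      [TopologicalSpace X] [PolishSpace X] [MeasurableSpace X] [BorelSpace X]
      [NormedAddCommGroup Y] [InnerProductSpace ℝ Y] [CompleteSpace Y]
      [TopologicalSpace.SeparableSpace Y] [MeasurableSpace Y] [BorelSpace Y]
      [NormedAddCommGroup H] [InnerProductSpace ℝ H] [CompleteSpace H]
      [TopologicalSpace.SeparableSpace H]
      [NormedAddCommGroup H'] [InnerProductSpace ℝ H'] [CompleteSpace H']
      [TopologicalSpace.SeparableSpace H'] [RKHS ℝ H' X Y]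
      (hK : HilbertScale.KernelCondition X Y H' κ)
      -- the Hilbert scale, the forward operator, the initial guess, the law of the data
      (L : H →ₗ.[ℝ] H) (ℓL : ℝ) (_ : HilbertScale.IsGenerator L ℓL)
      (A : H → H') (DA : Set H) (fhat : H) (fbar : L.domain) (_ : (fbar : H) ∈ DA)
      (ρ : Measure (X × Y)) [IsProbabilityMeasure ρ]
      (_ : MemLp (fun z : X × Y => z.2) 2 ρ)
      (_ : HilbertScale.TrueSolution ρ A DA fhat)
      (_ : HilbertScale.NoiseCondition ρ A fhat M S)
      (ℓA d₀ : ℝ) (_ : HilbertScale.OperatorCondition A DA fhat ℓA d₀) (_ : ℓA / ℓL ≤ ℓ)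
      -- the set `Q`, with the two-sided conditional stability estimate
      (θ d : ℝ) (_ : 0 ≤ θ) (_ : 0 < d) (Q : Set H)
      (_ : Q ⊆ HilbertScale.scaleBall L θ fhat d ∩ DA) (_ : Q ⊆ Metric.closedBall fhat d₀)
      (_ : ∀ f ∈ Q, ∀ g ∈ Q, ‖A f - (2 : ℝ) • A fhat + A g‖ ≤ ℓ₁)
      (_ : ∀ f ∈ Q, HilbertScale.negNorm L p (f - fhat)
        ≤ α * ‖HilbertScale.inclusion hK ρ.fst (A f - A fhat)‖ ^ s)
      (_ : ∀ f ∈ Q, α * ‖HilbertScale.inclusion hK ρ.fst (A f - A fhat)‖ ^ s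
        ≤ β * HilbertScale.negNorm L p (f - fhat))
      -- the source condition
      (v : H) (_ : fhat - fbar = HilbertScale.invPow L r v) (_ : ‖v‖ ≤ R₀)
      -- the regularization parameter
      (lam : ℕ → ℝ)
      (_ : ∀ᶠ m : ℕ in atTop,
        0 < lam m ∧ HilbertScale.thetaFun hK ρ.fst u (lam m) = 1 / √(m : ℝ))
      (_ : ∀ᶠ m : ℕ in atTop, lam m ≤ 1 ∧
        (HilbertScale.effDim hK ρ.fst (lam m) ≤ m * lam m ∨
          c₀ ≤ m * lam m * HilbertScale.effDim hK ρ.fst (lam m)))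
      -- the regularized solutions, and the benchmark elements, eventually belong to `Q`
      (fz : (m : ℕ) → (Fin m → X × Y) → L.domain)
      (_ : ∀ᶠ m : ℕ in atTop, ∀ᵐ z ∂(Measure.pi fun _ : Fin m => ρ),
        HilbertScale.IsTikhonovMinimizer A DA L fbar (lam m) z (fz m z) ∧ (fz m z : H) ∈ Q)
      (_ : ∀ᶠ R : ℝ in atTop, ∀ g : H,
        HilbertScale.IsBenchmarkMinimizer L q fbar fhat R g → g ∈ Q),
      ∀ᶠ m : ℕ in atTop, ∀ η : ℝ, 0 < η → η < 1 →
        (Measure.pi fun _ : Fin m => ρ)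
          {z | ¬ (‖HilbertScale.inclusion hK ρ.fst (A (fz m z) - A fhat)‖
                ≤ C * lam m ^ u * Real.log (4 / η) ∧
              ‖(fz m z : H) - fhat‖
                ≤ C * lam m ^ (s * r / (2 * (p + r) - 2 * s * (r - 1)))
                  * Real.log (4 / η) ^ max 1 ((p + s) / (p + 1)))}
          ≤ ENNReal.ofReal η := by
  have hp1 : 0 < p + 1 := by linarith
  set D := 2 * (p + r) - 2 * s * (r - 1) with hDdef
  have hD : 0 < D := by rw [hDdef]; linarith
  have hu0 : 0 ≤ u := by rw [hu]; positivity
  have huD : u * D = p + r := by rw [hu]; field_simp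
  have hexp : (2 * u * (s + p) - p) / (2 * (p + 1)) = s * r / D := by
    rw [div_eq_div_iff (by positivity) hD.ne']
    linear_combination (2 * (s + p)) * huD - p * hDdef
  refine ⟨hexp, ?_⟩
  obtain ⟨ρ₀, Kp, Kg, Kσ, hρ₀, hKp, hKg, hKσ, hσ, hbench⟩ :=
    HilbertScale.exists_benchmark_constants (p := p) (q := q) (r := r) (s := s) (α := α) (D := D) R₀
      hp hs hα hr hrq hrp hq₁ hqs hden hD
  set γ := (q - 1) / (p + 1) with hγdef
  have hγ : 0 ≤ γ := div_nonneg (by linarith) hp1.le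
  have hγ1 : γ ≤ 1 := (div_le_one hp1).2 (by linarith)
  have hγp : γ * (p + 1) = q - 1 := div_mul_cancel₀ _ hp1.ne'
  set e := s * (q - r) / D with hedef
  have heD : e * D = s * (q - r) := div_mul_cancel₀ _ hD.ne'
  have he : 1 - e + (u - 1 / 2) * (1 - γ) + u * s * γ = 2 * u := by
    refine mul_right_cancel₀ hD.ne' ?_
    linear_combination (-1) * heD + (1 - γ + s * γ - 2) * huD + (1 - (1 - γ) / 2) * hDdef
      + s * hγp
  -- Both alternatives on the parameter give `m lam N ≥ c₁`: the first yields `m lam N ≥ N²`, and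
  -- eventually `N ≥ 1/2`.
  set c₁ := min c₀ (1 / 4) with hc₁def
  have hc₁ : 0 < c₁ := lt_min hc₀ (by norm_num)
  have hsc₁ : 0 < √c₁ := Real.sqrt_pos.2 hc₁
  -- Absolute values of `κ`, `ℓ₁` and `ℓ` are used because the constants are fixed before any
  -- hypothesis determines a sign.
  set K₁ := |κ| * M / √c₁ + (1 + S ^ 2 / 2) with hK₁def
  set K₂ := 2 * κ ^ 2 / √c₁ + (1 + κ ^ 2) with hK₂def
  have hK₁ : 0 ≤ K₁ := by positivity
  have hK₂ : 0 ≤ K₂ := by positivity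
  set Kδ := |ℓ₁| * K₂ + 2 * K₁ with hKδdef
  have hKδ : 0 ≤ Kδ := by positivity
  set Kb := (β / α * Kp) ^ (1 / s) with hKbdef
  have hKb : 0 ≤ Kb := by positivity
  set CZ := HilbertScale.errorConst (2 * ρ₀ * α ^ γ) s γ |ℓ| Kb Kδ Kσ with hCZdef
  have hCZ : 0 ≤ CZ := by
    rw [hCZdef, HilbertScale.errorConst]; positivity
  set C₂ := CZ ^ (p / (p + 1)) * (α * (CZ ^ s + Kb ^ s)) ^ (1 / (p + 1)) with hC₂def
  have hC₂ : 0 ≤ C₂ := by positivity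
  refine ⟨CZ + C₂ + Kg + 1, by positivity, ?_⟩
  intro X Y H H' _ _ _ _ _ _ _ _ _ _ _ _ _ _ _ _ _ _ _ hK L ℓL hL A DA fhat fbar _ ρ _ hmem htrue
    hnoise ℓA d₀ hop hℓ θ d _ _ Q hQsub hQball hQℓ₁ hQup hQlow v hv hvR lam hlamΘ hlamc fz hfz hQb
  have hlim := HilbertScale.tendsto_parameter hK hu0 hlamΘ
  have hhalf : ∀ᶠ m : ℕ in atTop, 1 / 2 ≤ HilbertScale.effDim hK ρ.fst (lam m) := by
    obtain ⟨m, hm, hm0⟩ := (hlamΘ.and (eventually_gt_atTop 0)).exists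
    exact hlim.eventually (HilbertScale.eventually_half_le_effDim hK hm.1
      (HilbertScale.sqrt_effDim_div_of_thetaFun_eq hK hm.1 hm0 hm.2).1)
  have hben := hlim.eventually (hbench hL hv hvR hQb)
  filter_upwards [hlamΘ, hlamc, hfz, hhalf, hben, eventually_gt_atTop 0] with m hm hmc hmz hmN hmb hm0
  intro η hη hη1
  obtain ⟨hlam, hΘ⟩ := hm
  obtain ⟨g, hgQ, w, hgw, hwn, hgp, hgd⟩ := hmb
  obtain ⟨hN, hsq⟩ := HilbertScale.sqrt_effDim_div_of_thetaFun_eq hK hlam hm0 hΘ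
  have hm' : (0 : ℝ) < m := by exact_mod_cast hm0
  obtain ⟨g, rfl, hLg⟩ := HilbertScale.exists_domain_eq hL hq₁ hgw
  set Λ := Real.log (4 / η) with hΛdef
  have hΛ : 1 ≤ Λ := HilbertScale.one_le_log_four_div hη hη1
  set N := HilbertScale.effDim hK ρ.fst (lam m) with hNdef
  set P := lam m ^ u with hPdef
  have hP : 0 < P := Real.rpow_pos_of_pos hlam _
  -- A vanishing kernel bound would force `N = 0`, against the lower bound on `N`.
  have hκ0 : 0 < κ := by
    refine hK.nonneg.lt_of_ne fun h0 => ?_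
    have h1 := HilbertScale.effDim_le (ν := ρ.fst) hK hlam
    have h2 : κ ^ 2 / lam m = 0 := by rw [← h0]; simp
    linarith
  have hsqm : 1 / (√(lam m) * m) ≤ P / √c₁ := by
    rw [← hsq]
    refine HilbertScale.one_div_sqrt_mul_le hlam hm' hc₁ ?_
    rcases hmc.2 with h | h
    · refine (min_le_right _ _).trans ?_
      have h1 := mul_le_mul_of_nonneg_right h hN.le
      nlinarith
    · exact (min_le_left _ _).trans h
  set δ₁ := K₁ * P * Λ with hδ₁def
  set δ₂ := K₂ * P * Λ with hδ₂def
  have h₁ : (1 / (√(lam m) / (κ * M) * m) + (1 + S ^ 2 / 2) * √(N / m)) * Λ ≤ δ₁ := by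
    rw [hsq, hδ₁def, hK₁def, abs_of_pos hκ0]
    exact HilbertScale.bernstein_radius_le (by positivity) (by positivity) hsqm
  have h₂ : (1 / (√(lam m) / (2 * κ ^ 2) * m) + (1 + κ ^ 2) * √(N / m)) * Λ ≤ δ₂ := by
    rw [hsq, hδ₂def, hK₂def]
    exact HilbertScale.bernstein_radius_le (by positivity) (by positivity) hsqm
  have hgood := HilbertScale.measure_not_goodSample_le hK ρ hlam hκ0 hmem htrue.condMean hM hnoise hN
    hm0 hη hη1 h₁ h₂
  have hnull : (Measure.pi fun _ : Fin m => ρ)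
      {z | ¬ (HilbertScale.IsTikhonovMinimizer A DA L fbar (lam m) z (fz m z)
        ∧ (fz m z : H) ∈ Q)} = 0 := hmz
  refine (measure_mono (fun z hz => ?_)).trans ((measure_union_le _ _).trans
    ((add_le_add hgood hnull.le).trans (add_zero _).le))
  by_contra hcon
  simp only [Set.mem_union, Set.mem_ofPred_eq, not_or, not_not] at hcon
  obtain ⟨hzgood, hzmin, hzQ⟩ := hcon
  apply hz
  set f := fz m z with hfdef
  have hδ₁0 : 0 ≤ δ₁ := by positivity
  have hδ₂0 : 0 ≤ δ₂ := by positivity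
  obtain ⟨τ, n, k, hτ, hn, hk, hmain, hkn, hnx, hdist⟩ := HilbertScale.sample_error_le hK hL hp hq₁
    hq₂ hlam hδ₁0 hδ₂0 hzgood (hzmin.2 g (hQsub hgQ).2) (hQℓ₁ f hzQ g hgQ)
    (hop.lipschitz f ⟨hQball hzQ, (hQsub hzQ).2⟩ g ⟨hQball hgQ, (hQsub hgQ).2⟩) hℓ
    (hQup f hzQ) (hQup g hgQ) hLg
  set x := ‖HilbertScale.inclusion hK ρ.fst (A f - A fhat)‖ with hxdef
  set b := ‖HilbertScale.inclusion hK ρ.fst (A g - A fhat)‖ with hbdef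
  have hx : 0 ≤ x := norm_nonneg _
  have hb : 0 ≤ b := norm_nonneg _
  -- The lower stability half bounds `b^s` by the `H_{-p}` error of the benchmark, of order
  -- `lam^(us)`; the `s`-th root yields the target rate.
  have hbK : b ≤ Kb * P := by
    have h1 : b ^ s ≤ β / α * Kp * lam m ^ (u * s) := by
      have h2 : u * s = s * (r + p) / D := by
        rw [hu, add_comm r p]; ring
      rw [h2]
      have h3 := (hQlow g hgQ).trans (mul_le_mul_of_nonneg_left hgp hβ.le)
      rw [mul_comm] at h3
      calc b ^ s ≤ β * (Kp * lam m ^ (s * (r + p) / D)) / α := (le_div_iff₀ hα).2 h3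
        _ = _ := by ring
    have h4 := Real.rpow_le_rpow (by positivity) h1 (by positivity : 0 ≤ 1 / s)
    rwa [← Real.rpow_mul hb, mul_one_div_cancel hs.ne', Real.rpow_one,
      Real.mul_rpow (by positivity) (by positivity), ← Real.rpow_mul hlam.le, mul_assoc,
      mul_one_div_cancel hs.ne', mul_one] at h4
  have hδle : ℓ₁ * δ₂ + 2 * δ₁ ≤ Kδ * P * Λ := by
    have h1 : ℓ₁ * δ₂ ≤ |ℓ₁| * δ₂ := mul_le_mul_of_nonneg_right (le_abs_self _) hδ₂0
    calc _ ≤ |ℓ₁| * δ₂ + 2 * δ₁ := by linarith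
      _ = _ := by rw [hKδdef, hδ₁def, hδ₂def]; ring
  obtain ⟨hx1, hτ1⟩ := HilbertScale.scaled_error_le hlam hx hτ hb hn hk (abs_nonneg ℓ) hKδ hKσ hΛ hρ₀
    hα hs hγ hγ1 hσ he hmain hkn hnx hδle hbK hwn
  have hfg := HilbertScale.interpolated_error_le hlam hx hτ hb hn hΛ hα hs hp hCZ hKb hx1 hτ1 hbK hnx
    hdist
  have hexp2 : ((u - 1 / 2) * p + u * s) / (p + 1) = s * r / D := by
    rw [← hexp]
    field_simp
    ring
  rw [hexp2, ← hC₂def] at hfg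
  set E := max 1 ((p + s) / (p + 1)) with hEdef
  have hE0 : 0 ≤ E := zero_le_one.trans (le_max_left _ _)
  have hΛE : 1 ≤ Λ ^ E := Real.one_le_rpow hΛ hE0
  have hPr : 0 < lam m ^ (s * r / D) := Real.rpow_pos_of_pos hlam _
  refine ⟨?_, ?_⟩
  · calc x ≤ CZ * Λ * P := hx1
      _ = CZ * P * Λ := by ring
      _ ≤ (CZ + C₂ + Kg + 1) * P * Λ := by gcongr ?_ * P * Λ; linarith
  · have h1 : ‖(f : H) - fhat‖ ≤ ‖(f : H) - g‖ + ‖(g : H) - fhat‖ := by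
      refine le_trans (le_of_eq ?_) (norm_add_le _ _)
      congr 1
      abel
    have h2 : C₂ * lam m ^ (s * r / D) * Λ ^ ((p + s) / (p + 1))
        ≤ C₂ * lam m ^ (s * r / D) * Λ ^ E := by
      exact mul_le_mul_of_nonneg_left (Real.rpow_le_rpow_of_exponent_le hΛ (le_max_right _ _))
        (by positivity)
    have h3 : Kg * lam m ^ (s * r / D) ≤ Kg * lam m ^ (s * r / D) * Λ ^ E :=
      le_mul_of_one_le_right (by positivity) hΛE
    calc _ ≤ C₂ * lam m ^ (s * r / D) * Λ ^ E + Kg * lam m ^ (s * r / D) * Λ ^ E := by linarith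
      _ = (C₂ + Kg) * lam m ^ (s * r / D) * Λ ^ E := by ring
      _ ≤ (CZ + C₂ + Kg + 1) * lam m ^ (s * r / D) * Λ ^ E := by gcongr ?_ * _ * _; linarith
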